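/- Let $p>2$ be real, and let $H\ge 1$, $P\ge 0$, $L\ge 0$ be integers with $P+L>1$; if $P=0$, assume also $H\ge 2$. For $\ell>0$, let $\mathcal G_\ell$ be the regular single-knot metric graph of length $\ell$: it consists of $H$ half-lines $[0,\infty)$, $P$ pendants $[0,\ell]$ and $L$ loops $[0,2\ell]$, all attached at a single vertex $\mathbf 0$, which is the point $x=0$ of every edge and also the point $x=2\ell$ of every loop. Let $H^1(\mathcal G_\ell)$ be the set of continuous functions $u:\mathcal G_\ell\to\mathbb R$ whose restriction to each edge is in $H^1$ of that edge. A bound-state on $\mathcal G_\ell$ is a nontrivial weak solution $u\in H^1(\mathcal G_\ell)$ of $-u''+u=|u|^{p-2}u$, that is, $u\not\equiv 0$ and $\int_{\mathcal G_\ell}\left(u'\eta'+u\eta-|u|^{p-2}u\eta\right)dx=0$ for all $\eta\in H^1(\mathcal G_\ell)$. Its action is $S(u)=\frac12\int_{\mathcal G_\ell}\left(|u'|^2+|u|^2\right)dx-\frac1p\int_{\mathcal G_\ell}|u|^p\,dx$. An action ground-state is a bound-state whose action equals the infimum of $S$ over all bound-states on $\mathcal G_\ell$. Split each loop at its midpoint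 into two compact edges of length $\ell$, and parametrize every compact edge (pendants and half-loops) by $[0,\ell]$ with $x=0$ at $\mathbf 0$. A function $u\in H^1(\mathcal G_\ell)$ is core-symmetric if its restrictions to any two compact edges coincide as functions on $[0,\ell]$. Then there is $\ell_0>0$, depending only on $p,H,P,L$, such that for every $\ell\ge\ell_0$ no action ground-state on $\mathcal G_\ell$ is core-symmetric. -/

import Mathlib

open MeasureTheory Set Filter

namespace SingleKnot

noncomputable section

/-- The edges of a single-knot graph with `H` half-lines, `P` pendants and `L` loops, in this
order, all attached at the vertex `0`. -/
abbrev Edge (H P L : ℕ) : Type := Fin H ⊕ Fin P ⊕ Fin L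

variable {H P L : ℕ}

/-- The interval with which an edge of the regular single-knot graph of length `ℓ` is identified:
`[0, ∞)` for a half-line, `[0, ℓ]` for a pendant and `[0, 2ℓ]` for a loop. The vertex `0` is the
point `x = 0` of every edge, and also the point `x = 2ℓ` of every loop. -/
def dom (ℓ : ℝ) : Edge H P L → Set ℝ
  | .inl _ => Ici 0
  | .inr (.inl _) => Icc 0 ℓ
  | .inr (.inr _) => Icc 0 (2 * ℓ)

/-- Real functions on the graph, given by their restrictions to the edges. Only the values of
`u e` on `dom ℓ e` are ever used. -/
abbrev GraphFun (H P L : ℕ) : Type := Edge H P L → ℝ → ℝ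

/-- The integral over the graph: the sum of the integrals over all edges. -/
def graphIntegral (ℓ : ℝ) (w : GraphFun H P L) : ℝ :=
  ∑ e, ∫ x in dom ℓ e, w e x

/-- The function on the edge is in `H¹` of the edge (continuous representative): it is absolutely
continuous on the compact subintervals, and it and its derivative are square integrable. -/
def MemH1Edge (ℓ : ℝ) (e : Edge H P L) (f : ℝ → ℝ) : Prop :=
  (∀ b ∈ dom ℓ e, AbsolutelyContinuousOnInterval f 0 b) ∧
  MemLp f 2 (volume.restrict (dom ℓ e)) ∧
  MemLp (deriv f) 2 (volume.restrict (dom ℓ e))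

/-- `u ∈ H¹(G)`: `u` is in `H¹` of every edge and continuous at the vertex `0`, that is, the
values at all the edge ends that meet there agree. -/
def MemH1 (ℓ : ℝ) (u : GraphFun H P L) : Prop :=
  (∀ e, MemH1Edge ℓ e (u e)) ∧
  ∃ c : ℝ, (∀ e, u e 0 = c) ∧ ∀ j : Fin L, u (.inr (.inr j)) (2 * ℓ) = c

/-- The action functional `S(u) = ½ ∫ (|u'|² + |u|²) - (1/p) ∫ |u|ᵖ`. -/
def action (p ℓ : ℝ) (u : GraphFun H P L) : ℝ :=
  (1 / 2) * graphIntegral ℓ (fun e x => |deriv (u e) x| ^ 2 + |u e x| ^ 2)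
    - (1 / p) * graphIntegral ℓ (fun e x => |u e x| ^ p)

/-- A bound-state: a nontrivial weak solution in `H¹(G)` of `-u'' + u = |u|^(p-2) u`. -/
def IsBoundState (p ℓ : ℝ) (u : GraphFun H P L) : Prop :=
  MemH1 ℓ u ∧
  (∃ e, ∃ x ∈ dom ℓ e, u e x ≠ 0) ∧
  ∀ η : GraphFun H P L, MemH1 ℓ η →
    graphIntegral ℓ (fun e x =>
      deriv (u e) x * deriv (η e) x + u e x * η e x - |u e x| ^ (p - 2) * u e x * η e x) = 0

/-- The least action level: the infimum of the action over all bound-states. -/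
def leastAction (H P L : ℕ) (p ℓ : ℝ) : ℝ :=
  sInf {s | ∃ u : GraphFun H P L, IsBoundState p ℓ u ∧ action p ℓ u = s}

/-- An action ground-state: a bound-state that attains the least action level. -/
def IsActionGroundState (p ℓ : ℝ) (u : GraphFun H P L) : Prop :=
  IsBoundState p ℓ u ∧ action p ℓ u = leastAction H P L p ℓ

/-- The compact edges, all of length `ℓ`, once a dummy vertex is placed at the midpoint `x = ℓ` of
each loop: the pendants, the first halves of the loops, the second halves of the loops. -/
abbrev CoreEdge (P L : ℕ) : Type := Fin P ⊕ Fin L ⊕ Fin L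

/-- The restriction of `u` to a compact edge, parametrized by `[0, ℓ]` so that `x = 0` is the
vertex `0`. -/
def coreRestrict (ℓ : ℝ) (u : GraphFun H P L) : CoreEdge P L → ℝ → ℝ
  | .inl i => fun x => u (.inr (.inl i)) x
  | .inr (.inl j) => fun x => u (.inr (.inr j)) x
  | .inr (.inr j) => fun x => u (.inr (.inr j)) (2 * ℓ - x)

/-- `u` is core-symmetric: its restrictions to any two compact edges coincide. -/
def IsCoreSymmetric (ℓ : ℝ) (u : GraphFun H P L) : Prop :=
  ∀ κ₁ κ₂ : CoreEdge P L, ∀ x ∈ Icc 0 ℓ, coreRestrict ℓ u κ₁ x = coreRestrict ℓ u κ₂ x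

end

end SingleKnot

namespace SingleKnot

noncomputable section

/-! ### The nonlinearity and the half-soliton level -/

/-! Write J for `vari p (peak p)`, the action of half a soliton, and N = P + 2L for the number of
compact edges of length ℓ. Put K = 1 if there is a pendant and K = 2 otherwise, a loop counting as
two compact edges. For long edges some bound-state has action barely above K J, by concentrating
half a soliton on K compact edges only. A core-symmetric bound-state must treat all N ≥ 2K compact
edges alike, which keeps its action above K J by at least the fixed amount `vari p 1 / 2`.

Lower bound (`exists_action_lower_bound`). On the Nehari manifold the action is at least that of
every multiple t u, t ≥ 0 (`sum_density_le_action`). As long as |t u| stays below `peak p`, the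
energy density of t u dominates the derivative of `vari p (t * u)` by the arithmetic-geometric
inequality, so the energy of an interval dominates the oscillation of `vari p (t * |u|)`
(`vari_abs_sub_le_integral`). Take t so that the maximum of |t u| is `peak p`. If the edges are
long, the minimum of |u| on the core is small, since otherwise the p-mass alone exceeds the level.
If the maximum lies on the core, all N compact edges pay about J each. If it lies only on a
half-line, that half-line carries a full soliton peak and costs 2J - `vari p |c|`, where c is the
vertex value, and the core pays back the loss. For K = 2 this falls short of the bound, and one more
fact is needed: either a second half-line also has a peak, or the half-lines contribute
nonnegatively to the Nehari functional. In the latter case the core contributes nonpositively and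
must reach height one somewhere, which costs a definite extra amount.

Upper bound (`exists_boundState_action_le`). Half-lines carry decreasing soliton tails of height c;
the N - K passive compact edges carry small solutions at rest at the far end; the K active ones
start at the vertex with the slope required by the Kirchhoff condition and come to rest at their far
end. The condition K ≤ H makes this slope at least that of the soliton, so the active profile has
nonnegative energy. A shooting argument in the far-end height m of the passive profile
(`exists_shooting`) matches the length. It runs on a truncated flow, which is global and depends
continuously on its data. As c is small, the active edges cost about J each and everything else is
negligible. -/

/-- The nonlinearity `y - |y|^(p-2) y`, so that the equation reads `u'' = nl p u`. -/
def nl (p y : ℝ) : ℝ := y - |y| ^ (p - 2) * y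

/-- The potential `y² - (2/p) |y|^p`; its derivative is `2 nl p`. -/
def pot (p y : ℝ) : ℝ := y ^ 2 - 2 / p * |y| ^ p

/-- The positive zero of the potential, the maximum of the soliton. -/
def peak (p : ℝ) : ℝ := (p / 2) ^ (1 / (p - 2))

/-- The slope of the soliton as a function of its height. -/
def speed (p y : ℝ) : ℝ := √(pot p y)

/-- The primitive of `speed p`. Its value at `peak p` is the action of the half-soliton. -/
def vari (p y : ℝ) : ℝ := ∫ x in (0 : ℝ)..y, speed p x

variable {p : ℝ}

lemma hasDerivAt_pot (hp : 2 < p) (y : ℝ) : HasDerivAt (pot p) (2 * nl p y) y := by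
  have h := ((hasDerivAt_id y).pow 2).sub ((hasDerivAt_abs_rpow y (by linarith : 1 < p)).const_mul
    (2 / p))
  convert! h using 1
  have : p ≠ 0 := by linarith
  simp only [nl, id]
  field_simp
  ring

lemma continuous_nl (hp : 2 < p) : Continuous (nl p) := by
  unfold nl
  exact continuous_id.sub
    ((continuous_abs.rpow_const fun x => Or.inr (by linarith)).mul continuous_id)

lemma continuous_pot (hp : 2 < p) : Continuous (pot p) :=
  continuous_iff_continuousAt.2 fun y => (hasDerivAt_pot hp y).continuousAt

lemma continuous_speed (hp : 2 < p) : Continuous (speed p) := (continuous_pot hp).sqrt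

lemma continuous_abs_rpow (hp : 2 < p) : Continuous fun y : ℝ => |y| ^ p :=
  continuous_abs.rpow_const fun _ => Or.inr (by linarith)

lemma abs_rpow_eq (hp : 2 < p) (y : ℝ) : |y| ^ p = |y| ^ (p - 2) * y ^ 2 := by
  rcases eq_or_ne y 0 with rfl | hy
  · simp [Real.zero_rpow (show p ≠ 0 by linarith)]
  · rw [← sq_abs, ← Real.rpow_natCast, ← Real.rpow_add (abs_pos.2 hy)]
    norm_num

lemma pot_eq (hp : 2 < p) (y : ℝ) : pot p y = y ^ 2 * (1 - 2 / p * |y| ^ (p - 2)) := by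
  rw [pot, abs_rpow_eq hp]; ring

lemma nl_eq (y : ℝ) : nl p y = y * (1 - |y| ^ (p - 2)) := by
  rw [nl]; ring

lemma nl_mul_self (hp : 2 < p) (y : ℝ) : y * nl p y = y ^ 2 - |y| ^ p := by
  rw [abs_rpow_eq hp, nl]; ring

@[simp] lemma pot_neg (y : ℝ) : pot p (-y) = pot p y := by simp [pot]

lemma pot_zero (hp : 2 < p) : pot p 0 = 0 := by
  simp [pot, Real.zero_rpow (show p ≠ 0 by linarith)]

@[simp] lemma nl_zero : nl p 0 = 0 := by simp [nl]

lemma one_lt_peak (hp : 2 < p) : 1 < peak p :=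
  Real.one_lt_rpow (by linarith) (by apply one_div_pos.2; linarith)

lemma peak_pos (hp : 2 < p) : 0 < peak p := by linarith [one_lt_peak hp]

lemma peak_rpow (hp : 2 < p) : peak p ^ (p - 2) = p / 2 := by
  have : p - 2 ≠ 0 := by linarith
  rw [peak, ← Real.rpow_mul (by linarith), one_div_mul_cancel this, Real.rpow_one]

lemma pot_nonneg (hp : 2 < p) {y : ℝ} (hy : |y| ≤ peak p) : 0 ≤ pot p y := by
  rw [pot_eq hp]
  have h : |y| ^ (p - 2) ≤ p / 2 := by
    rw [← peak_rpow hp]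
    exact Real.rpow_le_rpow (abs_nonneg _) hy (by linarith)
  have : 2 / p * |y| ^ (p - 2) ≤ 2 / p * (p / 2) := by gcongr; 
  have h2 : 2 / p * (p / 2) = 1 := by field_simp
  apply mul_nonneg (sq_nonneg _); linarith

lemma pot_pos (hp : 2 < p) {y : ℝ} (h0 : y ≠ 0) (hy : |y| < peak p) : 0 < pot p y := by
  rw [pot_eq hp]
  have h : |y| ^ (p - 2) < p / 2 := by
    rw [← peak_rpow hp]
    exact Real.rpow_lt_rpow (abs_nonneg _) hy (by linarith)
  have : 2 / p * |y| ^ (p - 2) < 2 / p * (p / 2) := by gcongr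
  have h2 : 2 / p * (p / 2) = 1 := by field_simp
  apply mul_pos (by positivity); linarith

lemma pot_neg_of_peak_lt (hp : 2 < p) {y : ℝ} (hy : peak p < |y|) : pot p y < 0 := by
  rw [pot_eq hp]
  have h : p / 2 < |y| ^ (p - 2) := by
    rw [← peak_rpow hp]
    exact Real.rpow_lt_rpow (peak_pos hp).le hy (by linarith)
  have : 2 / p * (p / 2) < 2 / p * |y| ^ (p - 2) := by gcongr
  have h2 : 2 / p * (p / 2) = 1 := by field_simp
  have : y ≠ 0 := by
    rintro rfl
    simp at hy; linarith [peak_pos hp]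
  apply mul_neg_of_pos_of_neg (by positivity); linarith

lemma abs_eq_peak_of_pot_eq_zero (hp : 2 < p) {y : ℝ} (h0 : y ≠ 0) (h : pot p y = 0) :
    |y| = peak p := by
  rcases lt_trichotomy |y| (peak p) with h1 | h1 | h1
  · linarith [pot_pos hp h0 h1]
  · exact h1
  · linarith [pot_neg_of_peak_lt hp h1]

lemma pot_le_sq (hp : 2 < p) (y : ℝ) : pot p y ≤ y ^ 2 := by
  have : 0 ≤ 2 / p * |y| ^ p := by positivity
  rw [pot]; linarith

lemma speed_nonneg (y : ℝ) : 0 ≤ speed p y := Real.sqrt_nonneg _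

lemma speed_sq (hp : 2 < p) {y : ℝ} (hy : |y| ≤ peak p) : speed p y ^ 2 = pot p y :=
  Real.sq_sqrt (pot_nonneg hp hy)

lemma speed_le_abs (hp : 2 < p) (y : ℝ) : speed p y ≤ |y| := by
  rw [speed, ← Real.sqrt_sq_eq_abs]
  exact Real.sqrt_le_sqrt (pot_le_sq hp y)

lemma hasDerivAt_vari (hp : 2 < p) (y : ℝ) : HasDerivAt (vari p) (speed p y) y :=
  intervalIntegral.integral_hasDerivAt_right ((continuous_speed hp).intervalIntegrable _ _)
    ((continuous_speed hp).stronglyMeasurableAtFilter _ _) (continuous_speed hp).continuousAt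

lemma continuous_vari (hp : 2 < p) : Continuous (vari p) :=
  continuous_iff_continuousAt.2 fun y => (hasDerivAt_vari hp y).continuousAt

@[simp] lemma vari_zero : vari p 0 = 0 := by simp [vari]

lemma vari_mono (hp : 2 < p) : Monotone (vari p) :=
  monotone_of_deriv_nonneg (fun y => (hasDerivAt_vari hp y).differentiableAt) fun y => by
    rw [(hasDerivAt_vari hp y).deriv]; exact speed_nonneg y

lemma vari_nonneg (hp : 2 < p) {y : ℝ} (hy : 0 ≤ y) : 0 ≤ vari p y := by
  simpa using vari_mono hp hy

@[simp] lemma vari_neg (y : ℝ) : vari p (-y) = -vari p y := by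
  unfold vari
  have : ∀ x, speed p x = speed p (-x) := fun x => by simp [speed]
  calc ∫ x in (0 : ℝ)..-y, speed p x = ∫ x in (0 : ℝ)..-y, speed p (-x) := by
        congr 1; ext x; exact this x
    _ = ∫ x in y..0, speed p x := by rw [intervalIntegral.integral_comp_neg]; simp
    _ = _ := intervalIntegral.integral_symm _ _

lemma abs_vari (hp : 2 < p) (y : ℝ) : |vari p y| = vari p |y| := by
  rcases abs_cases y with ⟨h, h'⟩ | ⟨h, h'⟩ <;> rw [h]
  · exact abs_of_nonneg (vari_nonneg hp h')
  · rw [vari_neg, abs_of_nonpos]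
    have := vari_nonneg (p := p) hp (y := -y) (by linarith)
    rw [vari_neg] at this; linarith

lemma vari_abs_sub_le (hp : 2 < p) (a b : ℝ) :
    vari p |a| - vari p |b| ≤ |vari p a - vari p b| := by
  rw [← abs_vari hp, ← abs_vari hp]
  exact abs_sub_abs_le_abs_sub _ _

/-- Makes the contribution of a small minimum on the core quadratically small. -/
lemma vari_le_sq (hp : 2 < p) {y : ℝ} (hy : 0 ≤ y) : vari p y ≤ y ^ 2 := by
  have h : vari p y ≤ ∫ x in (0 : ℝ)..y, x := by
    apply intervalIntegral.integral_mono_on hy ((continuous_speed hp).intervalIntegrable _ _)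
      (continuous_id.intervalIntegrable _ _)
    intro x hx
    simpa [abs_of_nonneg hx.1] using speed_le_abs hp x
  rw [integral_id] at h
  nlinarith [sq_nonneg y]

lemma vari_one_pos (hp : 2 < p) : 0 < vari p 1 := by
  apply intervalIntegral.intervalIntegral_pos_of_pos_on
    ((continuous_speed hp).intervalIntegrable _ _) _ one_pos
  intro x hx
  exact Real.sqrt_pos.2 (pot_pos hp hx.1.ne'
    (by rw [abs_of_pos hx.1]; linarith [one_lt_peak hp, hx.2]))

/-- Beyond `peak p` the potential is negative and the real square root returns 0, so the primitive
is constant there. No upper bound on the height is therefore needed. -/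
lemma vari_le_peak (hp : 2 < p) (y : ℝ) : vari p y ≤ vari p (peak p) := by
  rcases le_total y (peak p) with h | h
  · exact vari_mono hp h
  · have : vari p y - vari p (peak p) = ∫ x in peak p..y, speed p x :=
      intervalIntegral.integral_interval_sub_left
        ((continuous_speed hp).intervalIntegrable _ _)
        ((continuous_speed hp).intervalIntegrable _ _)
    rw [intervalIntegral.integral_congr (g := fun _ => 0)] at this
    · simp at this; linarith
    · intro x hx
      rw [uIcc_of_le h] at hx
      rcases hx.1.eq_or_lt with h1 | h1
      · subst h1
        have : pot p (peak p) = 0 := by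
          rw [pot_eq hp, abs_of_pos (peak_pos hp), peak_rpow hp]
          have : p ≠ 0 := by linarith
          field_simp; simp
        simp [speed, this]
      · exact Real.sqrt_eq_zero_of_nonpos (pot_neg_of_peak_lt hp
          (by rwa [abs_of_pos ((peak_pos hp).trans h1)])).le

lemma half_sq_sub_rpow_div_le (hp : 2 < p) {t : ℝ} (ht : 0 ≤ t) :
    t ^ 2 / 2 - t ^ p / p ≤ 1 / 2 - 1 / p := by
  -- Bernoulli's inequality for (t²)^(p/2), which is tangent at t = 1.
  have h := one_add_mul_self_le_rpow_one_add (s := t ^ 2 - 1) (by nlinarith [sq_nonneg t])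
    (p := p / 2) (by linarith)
  have h2 : (1 + (t ^ 2 - 1)) ^ (p / 2) = t ^ p := by
    rw [add_sub_cancel, ← Real.rpow_natCast, ← Real.rpow_mul ht]
    congr 1; push_cast; ring
  rw [h2] at h
  have : t ^ p / p ≥ (1 + p / 2 * (t ^ 2 - 1)) / p := by gcongr
  have h3 : (1 + p / 2 * (t ^ 2 - 1)) / p = 1 / p + (t ^ 2 - 1) / 2 := by field_simp
  linarith

lemma pot_const_mul (t y : ℝ) (ht : 0 ≤ t) :
    pot p (t * y) = t ^ 2 * y ^ 2 - 2 / p * (t ^ p * |y| ^ p) := by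
  rw [pot, abs_mul, Real.mul_rpow (abs_nonneg _) (abs_nonneg _), abs_of_nonneg ht, mul_pow]

end

end SingleKnot

namespace SingleKnot

noncomputable section

variable {p : ℝ} {H P L : ℕ} {ℓ : ℝ}

/-! ### Regularity of bound-states -/

/-- `f` is a classical solution on `s` of `f'' = nl p f`, with derivative `w`. -/
structure ClassicalOn (p : ℝ) (s : Set ℝ) (f w : ℝ → ℝ) : Prop where
  cont : ContinuousOn f s
  cont_deriv : ContinuousOn w s
  hasDerivAt : ∀ x ∈ interior s, HasDerivAt f (w x) x
  hasDerivAt_deriv : ∀ x ∈ interior s, HasDerivAt w (nl p (f x)) x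

lemma ClassicalOn.mono {s t : Set ℝ} {f w : ℝ → ℝ} (h : ClassicalOn p s f w) (hts : t ⊆ s) :
    ClassicalOn p t f w where
  cont := h.cont.mono hts
  cont_deriv := h.cont_deriv.mono hts
  hasDerivAt x hx := h.hasDerivAt x (interior_mono hts hx)
  hasDerivAt_deriv x hx := h.hasDerivAt_deriv x (interior_mono hts hx)

/-- Conservation of energy: `pot p` has derivative `2 * nl p`. -/
lemma ClassicalOn.sq_sub_pot (hp : 2 < p) {a b : ℝ} {f w : ℝ → ℝ}
    (h : ClassicalOn p (Icc a b) f w) (hab : a ≤ b) :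
    w b ^ 2 - pot p (f b) = w a ^ 2 - pot p (f a) := by
  have := intervalIntegral.integral_eq_sub_of_hasDerivAt_of_le (f := fun x => w x ^ 2 - pot p (f x))
    (f' := fun _ => 0) hab
    ((h.cont_deriv.pow 2).sub ((continuous_pot hp).comp_continuousOn h.cont)) (fun x hx => ?_)
    (by simp)
  · simp at this; linarith
  · rw [← interior_Icc] at hx
    have h1 := ((h.hasDerivAt_deriv x hx).pow 2).sub
      ((hasDerivAt_pot hp (f x)).comp x (h.hasDerivAt x hx))
    convert! h1 using 1
    simp only [Nat.cast_ofNat]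
    ring

lemma measurableSet_dom (e : Edge H P L) : MeasurableSet (dom ℓ e) := by
  rcases e with _ | _ | _
  exacts [measurableSet_Ici, measurableSet_Icc, measurableSet_Icc]

lemma nonneg_of_mem_dom {e : Edge H P L} {x : ℝ} (hx : x ∈ dom ℓ e) : 0 ≤ x := by
  rcases e with _ | _ | _
  exacts [hx, hx.1, hx.1]

lemma Icc_subset_dom {e : Edge H P L} {b : ℝ} (hb : b ∈ dom ℓ e) : Icc 0 b ⊆ dom ℓ e := by
  rcases e with _ | _ | _
  exacts [fun x hx => hx.1, fun x hx => ⟨hx.1, hx.2.trans hb.2⟩, fun x hx => ⟨hx.1, hx.2.trans hb.2⟩]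

lemma mem_dom_of_mem_Icc (hℓ : 0 ≤ ℓ) {e : Edge H P L} {x : ℝ} (hx : x ∈ Icc 0 ℓ) :
    x ∈ dom ℓ e := by
  rcases e with _ | _ | _
  exacts [hx.1, hx, ⟨hx.1, by linarith [hx.2]⟩]

lemma zero_mem_dom (hℓ : 0 ≤ ℓ) (e : Edge H P L) : (0 : ℝ) ∈ dom ℓ e :=
  mem_dom_of_mem_Icc hℓ ⟨le_rfl, hℓ⟩

/-- A weak solution on `[0, b]` has a continuous derivative, which is a primitive of `nl p f`. -/
lemma exists_eq_integral_of_weak (hp : 2 < p) {b : ℝ} (hb : 0 < b) {f : ℝ → ℝ}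
    (hf : AbsolutelyContinuousOnInterval f 0 b)
    (hf2 : MemLp (deriv f) 2 (volume.restrict (Icc 0 b)))
    (hweak : ∀ k : ℝ → ℝ, MemLp k 2 volume → (∀ x ∉ Icc 0 b, k x = 0) →
      ∫ x in (0 : ℝ)..b, k x = 0 →
      ∫ x in (0 : ℝ)..b, (deriv f x * k x + nl p (f x) * ∫ t in (0 : ℝ)..x, k t) = 0) :
    ∃ C, ∀ x ∈ Icc 0 b, f x = f 0 + ∫ t in (0 : ℝ)..x, (C + ∫ s in (0 : ℝ)..t, nl p (f s)) := by
  have hfc : ContinuousOn f (Icc 0 b) := by simpa [uIcc_of_le hb.le] using hf.continuousOn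
  have hg : ContinuousOn (fun s => nl p (f s)) (uIcc 0 b) := by
    rw [uIcc_of_le hb.le]; exact (continuous_nl hp).comp_continuousOn hfc
  set G : ℝ → ℝ := fun t => ∫ s in (0 : ℝ)..t, nl p (f s) with hG
  have hGac : AbsolutelyContinuousOnInterval G 0 b :=
    hg.intervalIntegrable.absolutelyContinuousOnInterval_intervalIntegral (by simp)
  have hGc : ContinuousOn G (Icc 0 b) := by simpa [uIcc_of_le hb.le] using hGac.continuousOn
  have hGd : ∀ x ∈ Ioo 0 b, HasDerivAt G (nl p (f x)) x := by
    intro x hx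
    have hnx : Icc 0 b ∈ nhds x := Icc_mem_nhds hx.1 hx.2
    have hcont : ContinuousOn (fun s => nl p (f s)) (Ioo 0 b) :=
      hg.mono (by rw [uIcc_of_le hb.le]; exact Ioo_subset_Icc_self)
    exact intervalIntegral.integral_hasDerivAt_right
      ((hg.mono (uIcc_subset_uIcc_left (by rw [uIcc_of_le hb.le]; exact ⟨hx.1.le, hx.2.le⟩))).intervalIntegrable)
      (hcont.stronglyMeasurableAtFilter isOpen_Ioo x hx) (hcont.continuousAt (isOpen_Ioo.mem_nhds hx))
  -- This is the du Bois-Reymond argument. C is the mean of f' - G, so that k = f' - G - C has mean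
  -- zero and its primitive is a legitimate test function. The weak equation then says that k is
  -- orthogonal to itself.
  set C : ℝ := (∫ x in (0 : ℝ)..b, (deriv f x - G x)) / b with hC
  have hGL2 : MemLp G 2 (volume.restrict (Icc 0 b)) := by
    obtain ⟨R, hR⟩ := isCompact_Icc.exists_bound_of_continuousOn hGc
    exact MemLp.of_bound (hGc.aestronglyMeasurable measurableSet_Icc) R
      ((ae_restrict_iff' measurableSet_Icc).2 (Eventually.of_forall hR))
  have hhL2 : MemLp (fun x => deriv f x - G x - C) 2 (volume.restrict (Icc 0 b)) :=
    (hf2.sub hGL2).sub (memLp_const C)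
  set k : ℝ → ℝ := (Icc 0 b).indicator fun x => deriv f x - G x - C with hk
  have hkL2 : MemLp k 2 volume := (memLp_indicator_iff_restrict measurableSet_Icc).2 hhL2
  have hk0 : ∀ x ∉ Icc 0 b, k x = 0 := fun x hx => indicator_of_notMem hx _
  have hk1 : ∀ x ∈ Icc 0 b, k x = deriv f x - G x - C := fun x hx => indicator_of_mem hx _
  have hfi : IntervalIntegrable (deriv f) volume 0 b := hf.intervalIntegrable_deriv
  have hGi : IntervalIntegrable G volume 0 b := hGac.continuousOn.intervalIntegrable
  have hkint : ∫ x in (0 : ℝ)..b, k x = 0 := by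
    rw [intervalIntegral.integral_congr (g := fun x => deriv f x - G x - C)]
    · rw [intervalIntegral.integral_sub (hfi.sub hGi) (by simp), hC, intervalIntegral.integral_const]
      generalize (∫ x in (0 : ℝ)..b, (deriv f x - G x)) = A
      rw [sub_zero, smul_eq_mul]
      field_simp
      ring
    · intro x hx; rw [uIcc_of_le hb.le] at hx; exact hk1 x hx
  have hki : IntervalIntegrable k volume 0 b := by
    rw [intervalIntegrable_iff_integrableOn_Ioc_of_le hb.le]
    have h1 : IntegrableOn k (Icc 0 b) volume := (hkL2.restrict (Icc 0 b)).integrable (by norm_num)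
    exact h1.mono_set Ioc_subset_Icc_self
  set η : ℝ → ℝ := fun x => ∫ t in (0 : ℝ)..x, k t with hη
  have hηac : AbsolutelyContinuousOnInterval η 0 b :=
    hki.absolutelyContinuousOnInterval_intervalIntegral (by simp)
  have hηd : ∀ᵐ x, x ∈ uIcc 0 b → HasDerivAt η (k x) x := by
    filter_upwards [hki.ae_hasDerivAt_integral] with x hx hx' using hx hx' 0 (by simp)
  have hw := hweak k hkL2 hk0 hkint
  have hae_Ioo : ∀ᵐ x : ℝ, x ≠ b := by
    simp [ae_iff]
  -- No boundary terms: η vanishes at 0 by construction and at b because k has mean zero.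
  have hparts : ∫ x in (0 : ℝ)..b, nl p (f x) * η x = - ∫ x in (0 : ℝ)..b, G x * k x := by
    have h1 := hGac.integral_mul_deriv_eq_deriv_mul hηac
    have hηb : η b = 0 := hkint
    have hη0 : η 0 = 0 := by simp [hη]
    rw [hηb, hη0] at h1
    have h2 : ∫ x in (0 : ℝ)..b, G x * deriv η x = ∫ x in (0 : ℝ)..b, G x * k x := by
      apply intervalIntegral.integral_congr_ae
      filter_upwards [hηd] with x hx hx'
      rw [(hx (uIoc_subset_uIcc hx')).deriv]
    have h3 : ∫ x in (0 : ℝ)..b, deriv G x * η x = ∫ x in (0 : ℝ)..b, nl p (f x) * η x := by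
      apply intervalIntegral.integral_congr_ae
      filter_upwards [hae_Ioo] with x hx hx'
      rw [uIoc_of_le hb.le] at hx'
      rw [(hGd x ⟨hx'.1, lt_of_le_of_ne hx'.2 hx⟩).deriv]
    rw [h2, h3] at h1
    linarith
  have i1 : IntervalIntegrable (fun x => deriv f x * k x) volume 0 b := by
    rw [intervalIntegrable_iff_integrableOn_Ioc_of_le hb.le]
    have h1 : IntegrableOn (fun x => deriv f x * k x) (Icc 0 b) volume :=
      hf2.integrable_mul (hkL2.restrict (Icc 0 b))
    exact h1.mono_set Ioc_subset_Icc_self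
  have i2 : IntervalIntegrable (fun x => nl p (f x) * η x) volume 0 b :=
    (hg.mul hηac.continuousOn).intervalIntegrable
  have i3 : IntervalIntegrable (fun x => G x * k x) volume 0 b := hki.continuousOn_mul hGac.continuousOn
  rw [intervalIntegral.integral_add i1 i2, hparts] at hw
  have hsq : ∫ x in (0 : ℝ)..b, k x ^ 2 = 0 := by
    have : ∫ x in (0 : ℝ)..b, k x ^ 2 = ∫ x in (0 : ℝ)..b, (deriv f x * k x - G x * k x - C * k x) := by
      apply intervalIntegral.integral_congr
      intro x hx
      rw [uIcc_of_le hb.le] at hx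
      simp only
      rw [sq]
      nth_rewrite 1 [hk1 x hx]
      ring
    rw [this, intervalIntegral.integral_sub (i1.sub i3) (hki.const_mul C),
      intervalIntegral.integral_sub i1 i3, intervalIntegral.integral_const_mul, hkint]
    linarith
  have hkz : ∀ᵐ x ∂(volume.restrict (Ioc 0 b)), k x = 0 := by
    rw [intervalIntegral.integral_of_le hb.le] at hsq
    have hi : Integrable (fun x => k x ^ 2) (volume.restrict (Ioc 0 b)) :=
      (hkL2.restrict _).integrable_sq
    filter_upwards [(integral_eq_zero_iff_of_nonneg (fun x => sq_nonneg (k x)) hi).1 hsq] with x hx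
    simpa using hx
  refine ⟨C, fun x hx => ?_⟩
  have h1 := (hf.mono (c := 0) (d := x)
    (by rw [uIcc_of_le hb.le, uIcc_of_le hx.1]; exact Icc_subset_Icc_right hx.2)).integral_deriv_eq_sub
  rw [eq_add_of_sub_eq' h1.symm]
  congr 1
  apply intervalIntegral.integral_congr_ae
  have := (ae_restrict_iff' measurableSet_Ioc).1 hkz
  filter_upwards [this] with y hy hy'
  rw [uIoc_of_le hx.1] at hy'
  have hy2 : y ∈ Ioc 0 b := ⟨hy'.1, hy'.2.trans hx.2⟩
  have := hy hy2
  rw [hk1 y (Ioc_subset_Icc_self hy2)] at this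
  change deriv f y = C + G y
  linarith

/-- Testing the weak equation with functions supported in `[0, b]` on a single edge. -/
lemma IsBoundState.weak_edge {u : GraphFun H P L} (hu : IsBoundState p ℓ u)
    (e : Edge H P L) {b : ℝ} (hb : b ∈ dom ℓ e) {k : ℝ → ℝ} (hk : MemLp k 2 volume)
    (hk0 : ∀ x ∉ Icc 0 b, k x = 0) (hkint : ∫ x in (0 : ℝ)..b, k x = 0) :
    ∫ x in (0 : ℝ)..b, (deriv (u e) x * k x + nl p (u e x) * ∫ t in (0 : ℝ)..x, k t) = 0 := by
  classical
  have hb0 : 0 ≤ b := nonneg_of_mem_dom hb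
  have hki : Integrable k := by
    have h1 : MemLp k 2 (volume.restrict (Icc 0 b)) := hk.restrict _
    have h2 : IntegrableOn k (Icc 0 b) := h1.integrable (by norm_num)
    have h3 : (Icc 0 b).indicator k = k := by
      ext x; by_cases hx : x ∈ Icc 0 b
      · simp [indicator_of_mem hx]
      · simp [indicator_of_notMem hx, hk0 x hx]
    rw [← h3]; exact h2.integrable_indicator measurableSet_Icc
  set η : ℝ → ℝ := fun x => ∫ t in (0 : ℝ)..x, k t with hη
  have hηac : ∀ c, AbsolutelyContinuousOnInterval η 0 c := fun c =>
    hki.intervalIntegrable.absolutelyContinuousOnInterval_intervalIntegral (by simp)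
  have hηd : ∀ᵐ x, deriv η x = k x := by
    filter_upwards [LocallyIntegrable.ae_hasDerivAt_integral hki.locallyIntegrable] with x hx using (hx 0).deriv
  have hηb : ∀ x, b ≤ x → η x = 0 := by
    intro x hx
    have : η x = (∫ t in (0 : ℝ)..b, k t) + ∫ t in b..x, k t :=
      (intervalIntegral.integral_add_adjacent_intervals hki.intervalIntegrable
        hki.intervalIntegrable).symm
    rw [this, hkint, intervalIntegral.integral_of_le hx, setIntegral_eq_zero_of_forall_eq_zero]
    · simp
    · intro t ht; exact hk0 t fun h => absurd ht.1 (not_lt.2 h.2)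
  have hη0 : η 0 = 0 := by simp [hη]
  have hηc : Continuous η := intervalIntegral.continuous_primitive (fun _ _ => hki.intervalIntegrable) 0
  have hηL2 : MemLp η 2 (volume.restrict (dom ℓ e)) := by
    obtain ⟨R, hR⟩ := isCompact_Icc.exists_bound_of_continuousOn (s := Icc 0 b) hηc.continuousOn
    have h1 : MemLp ((Icc 0 b).indicator η) 2 volume :=
      (memLp_indicator_iff_restrict measurableSet_Icc).2
        (MemLp.of_bound (hηc.aestronglyMeasurable.restrict) R
          ((ae_restrict_iff' measurableSet_Icc).2 (Eventually.of_forall hR)))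
    refine (h1.restrict (dom ℓ e)).ae_eq ?_
    refine (ae_restrict_iff' (measurableSet_dom e)).2 (Eventually.of_forall fun x hx => ?_)
    by_cases hxb : x ∈ Icc 0 b
    · simp [indicator_of_mem hxb]
    · rw [indicator_of_notMem hxb, hηb]
      by_contra h
      exact hxb ⟨nonneg_of_mem_dom hx, by linarith⟩
  -- The primitive of k vanishes at 0 and from b on, so its extension by zero to the other edges is
  -- continuous at the vertex, even when b is the far end of a loop.
  have hmem : MemH1 ℓ (Pi.single e η : GraphFun H P L) := by
    refine ⟨fun e' => ?_, 0, fun e' => ?_, fun j => ?_⟩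
    · rcases eq_or_ne e' e with rfl | hne
      · rw [Pi.single_eq_same]
        exact ⟨fun c _ => hηac c, hηL2, (hk.restrict _).ae_eq (ae_restrict_of_ae
          (hηd.mono fun x hx => hx.symm))⟩
      · rw [Pi.single_eq_of_ne hne]
        refine ⟨fun c _ => ?_, MemLp.zero', ?_⟩
        · exact ((LipschitzWith.const (0 : ℝ)).lipschitzOnWith (s := uIcc 0 c)).absolutelyContinuousOnInterval
        · have : deriv (0 : ℝ → ℝ) = 0 := by ext x; exact deriv_const x 0
          rw [this]; exact MemLp.zero'
    · rcases eq_or_ne e' e with rfl | hne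
      · rw [Pi.single_eq_same]; exact hη0
      · rw [Pi.single_eq_of_ne hne]; rfl
    · rcases eq_or_ne (Sum.inr (Sum.inr j) : Edge H P L) e with rfl | hne
      · rw [Pi.single_eq_same]; exact hηb _ hb.2
      · rw [Pi.single_eq_of_ne hne]; rfl
  have hw := hu.2.2 _ hmem
  rw [graphIntegral, Finset.sum_eq_single e] at hw
  · refine Eq.trans ?_ hw
    rw [intervalIntegral.integral_of_le hb0, ← integral_Icc_eq_integral_Ioc, Pi.single_eq_same]
    symm
    rw [setIntegral_eq_of_subset_of_ae_sdiff_eq_zero (measurableSet_dom e).nullMeasurableSet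
      (Icc_subset_dom hb)]
    · apply setIntegral_congr_ae measurableSet_Icc
      filter_upwards [hηd] with x hx _
      rw [hx, nl]; ring
    · filter_upwards [hηd] with x hx hx'
      have hxb : ¬ x ≤ b := fun h => hx'.2 ⟨nonneg_of_mem_dom hx'.1, h⟩
      rw [hx, hηb x (by linarith), hk0 x hx'.2]; simp
  · intro e' _ hne
    rw [Pi.single_eq_of_ne hne]
    have : deriv (0 : ℝ → ℝ) = 0 := by ext x; exact deriv_const x 0
    simp [this]
  · simp

/-- A bound-state is a classical solution on every edge. -/
lemma IsBoundState.classicalOn (hp : 2 < p) (hℓ : 0 < ℓ) {u : GraphFun H P L}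
    (hu : IsBoundState p ℓ u) (e : Edge H P L) : ∃ w, ClassicalOn p (dom ℓ e) (u e) w := by
  obtain ⟨hac, -, hd2⟩ := hu.1.1 e
  have key : ∀ b ∈ dom ℓ e, 0 < b → ∃ C, ∀ x ∈ Icc 0 b,
      u e x = u e 0 + ∫ t in (0 : ℝ)..x, (C + ∫ s in (0 : ℝ)..t, nl p (u e s)) := fun b hb hb0 =>
    exists_eq_integral_of_weak hp hb0 (hac b hb)
      (hd2.mono_measure (Measure.restrict_mono (Icc_subset_dom hb) le_rfl))
      (fun k hk hk0 hkint => hu.weak_edge e hb hk hk0 hkint)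
  have hcont : ∀ b ∈ dom ℓ e, ContinuousOn (u e) (Icc 0 b) := fun b hb => by
    simpa [uIcc_of_le (nonneg_of_mem_dom hb)] using (hac b hb).continuousOn
  obtain ⟨C, hC⟩ := key ℓ (mem_dom_of_mem_Icc hℓ.le ⟨hℓ.le, le_rfl⟩) hℓ
  set w : ℝ → ℝ := fun t => C + ∫ s in (0 : ℝ)..t, nl p (u e s) with hw
  -- local statements on `[0, b]`
  have hloc : ∀ b ∈ dom ℓ e, 0 < b → ContinuousOn w (Icc 0 b) ∧
      (∀ x ∈ Ioo 0 b, HasDerivAt w (nl p (u e x)) x) := by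
    intro b hb hb0
    have hg : ContinuousOn (fun s => nl p (u e s)) (uIcc 0 b) := by
      rw [uIcc_of_le hb0.le]; exact (continuous_nl hp).comp_continuousOn (hcont b hb)
    constructor
    · have := intervalIntegral.continuousOn_primitive_interval (μ := volume) hg.integrableOn_uIcc
      rw [uIcc_of_le hb0.le] at this
      exact continuousOn_const.add this
    · intro x hx
      have hco : ContinuousOn (fun s => nl p (u e s)) (Ioo 0 b) :=
        hg.mono (by rw [uIcc_of_le hb0.le]; exact Ioo_subset_Icc_self)
      exact (intervalIntegral.integral_hasDerivAt_right
        ((hg.mono (uIcc_subset_uIcc_left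
          (by rw [uIcc_of_le hb0.le]; exact ⟨hx.1.le, hx.2.le⟩))).intervalIntegrable)
        (hco.stronglyMeasurableAtFilter isOpen_Ioo x hx)
        (hco.continuousAt (isOpen_Ioo.mem_nhds hx))).const_add C
  have hprim : ∀ b ∈ dom ℓ e, 0 < b → ∀ x ∈ Icc 0 b, u e x = u e 0 + ∫ t in (0 : ℝ)..x, w t := by
    intro b hb hb0 x hx
    obtain ⟨C', hC'⟩ := key b hb hb0
    -- The constant obtained on [0, b] could depend on b. Comparing the two formulas at a common
    -- point m > 0 shows that it does not.
    set m := min b ℓ with hm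
    have hm0 : 0 < m := lt_min hb0 hℓ
    have hwi : IntervalIntegrable (fun t => ∫ s in (0 : ℝ)..t, nl p (u e s)) volume 0 m := by
      have := ((hloc b hb hb0).1.mono (Icc_subset_Icc_right (min_le_left b ℓ))).fun_sub
        (continuousOn_const (c := C))
      simp only [hw, add_sub_cancel_left] at this
      exact ContinuousOn.intervalIntegrable (by rwa [uIcc_of_le hm0.le])
    have h1 := hC m ⟨hm0.le, min_le_right _ _⟩
    have h2 := hC' m ⟨hm0.le, min_le_left _ _⟩
    rw [h1] at h2
    rw [intervalIntegral.integral_add (by simp) hwi, intervalIntegral.integral_add (by simp) hwi] at h2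
    simp only [intervalIntegral.integral_const, sub_zero, smul_eq_mul] at h2
    have : m * C = m * C' := by linarith
    have hCC : C = C' := mul_left_cancel₀ hm0.ne' this
    rw [hw, hCC]; exact hC' x hx
  -- Reduces the local claims to a compact initial interval; only half-lines need b to vary with x.
  have hbig : ∀ x ∈ dom ℓ e, ∃ b ∈ dom ℓ e, 0 < b ∧ x ∈ Icc 0 b ∧
      (x ∈ interior (dom ℓ e) → x ∈ Ioo 0 b) ∧ Icc 0 b ∈ nhdsWithin x (dom ℓ e) := by
    intro x hx
    rcases e with i | i | i
    · refine ⟨x + 1, ?_, ?_, ?_, ?_, ?_⟩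
      · change 0 ≤ x + 1; change 0 ≤ x at hx; linarith
      · change 0 ≤ x at hx; linarith
      · exact ⟨hx, by linarith⟩
      · intro h; simp only [dom, interior_Ici] at h; exact ⟨h, by linarith⟩
      · simp only [dom]
        filter_upwards [self_mem_nhdsWithin, mem_nhdsWithin_of_mem_nhds (Iio_mem_nhds (lt_add_one x))]
          with y hy hy' using ⟨hy, le_of_lt hy'⟩
    · exact ⟨ℓ, ⟨hℓ.le, le_rfl⟩, hℓ, hx, fun h => by simpa [dom] using h, self_mem_nhdsWithin⟩
    · exact ⟨2 * ℓ, ⟨by linarith, le_rfl⟩, by linarith, hx, fun h => by simpa [dom] using h,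
        self_mem_nhdsWithin⟩
  refine ⟨w, ⟨?_, ?_, ?_, ?_⟩⟩
  · intro x hx
    obtain ⟨b, hb, hb0, hxb, -, hn⟩ := hbig x hx
    exact (hcont b hb x hxb).mono_of_mem_nhdsWithin hn
  · intro x hx
    obtain ⟨b, hb, hb0, hxb, -, hn⟩ := hbig x hx
    exact ((hloc b hb hb0).1 x hxb).mono_of_mem_nhdsWithin hn
  · intro x hx
    obtain ⟨b, hb, hb0, hxb, hi, -⟩ := hbig x (interior_subset hx)
    have hxi := hi hx
    have hwc : ContinuousOn w (Ioo 0 b) := (hloc b hb hb0).1.mono Ioo_subset_Icc_self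
    have h1 : HasDerivAt (fun y => u e 0 + ∫ t in (0 : ℝ)..y, w t) (w x) x := by
      refine (intervalIntegral.integral_hasDerivAt_right ?_
        (hwc.stronglyMeasurableAtFilter isOpen_Ioo x hxi)
        (hwc.continuousAt (isOpen_Ioo.mem_nhds hxi))).const_add _
      exact ContinuousOn.intervalIntegrable ((hloc b hb hb0).1.mono
        (by rw [uIcc_of_le hxb.1]; exact Icc_subset_Icc_right hxb.2))
    refine h1.congr_of_eventuallyEq ?_
    filter_upwards [Icc_mem_nhds hxi.1 hxi.2] with y hy using hprim b hb hb0 y hy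
  · intro x hx
    obtain ⟨b, hb, hb0, hxb, hi, -⟩ := hbig x (interior_subset hx)
    exact (hloc b hb hb0).2 x (hi hx)

end

end SingleKnot

namespace SingleKnot

noncomputable section

variable {p : ℝ} {H P L : ℕ} {ℓ : ℝ}

/-! ### Solutions on the half-line -/

section HalfLine

variable {f w : ℝ → ℝ}

lemma ClassicalOn.hasDerivAt_sq {s : Set ℝ} (h : ClassicalOn p s f w) {x : ℝ}
    (hx : x ∈ interior s) : HasDerivAt (fun x => f x ^ 2) (2 * (f x * w x)) x := by
  convert! (h.hasDerivAt x hx).pow 2 using 1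
  simp; ring

lemma ClassicalOn.hasDerivAt_mul (hp : 2 < p) {s : Set ℝ} (h : ClassicalOn p s f w) {x : ℝ}
    (hx : x ∈ interior s) :
    HasDerivAt (fun x => f x * w x) (w x ^ 2 + f x ^ 2 - |f x| ^ p) x := by
  convert! (h.hasDerivAt x hx).mul (h.hasDerivAt_deriv x hx) using 1
  rw [nl_mul_self hp]; ring

lemma ClassicalOn.memLp_deriv {a : ℝ} (h : ClassicalOn p (Ici a) f w)
    (h2 : MemLp (deriv f) 2 (volume.restrict (Ici a))) : MemLp w 2 (volume.restrict (Ioi a)) := by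
  refine (h2.mono_measure (Measure.restrict_mono Ioi_subset_Ici_self le_rfl)).ae_eq ?_
  refine (ae_restrict_iff' measurableSet_Ioi).2 (Eventually.of_forall fun x hx => ?_)
  exact (h.hasDerivAt x (by rwa [interior_Ici])).deriv

/-- Both f² and its derivative 2 f w are integrable. -/
lemma ClassicalOn.tendsto_zero {a : ℝ} (h : ClassicalOn p (Ici a) f w)
    (h1 : MemLp f 2 (volume.restrict (Ici a)))
    (h2 : MemLp (deriv f) 2 (volume.restrict (Ici a))) : Tendsto f atTop (nhds 0) := by
  have h1' : MemLp f 2 (volume.restrict (Ioi a)) :=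
    h1.mono_measure (Measure.restrict_mono Ioi_subset_Ici_self le_rfl)
  have := tendsto_zero_of_hasDerivAt_of_integrableOn_Ioi (a := a)
    (fun x hx => h.hasDerivAt_sq (by rwa [interior_Ici]))
    ((h1'.integrable_mul (h.memLp_deriv h2)).const_mul 2) h1'.integrable_sq
  have h3 := (Real.continuous_sqrt.tendsto 0).comp this
  simp only [Real.sqrt_zero] at h3
  refine tendsto_zero_iff_abs_tendsto_zero f |>.2 (h3.congr fun x => ?_)
  simp [Real.sqrt_sq_eq_abs]

/-- A continuous function on a half-line that vanishes at infinity attains its maximal modulus. -/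
lemma exists_abs_max_Ici {a : ℝ} (hf : ContinuousOn f (Ici a)) (h0 : Tendsto f atTop (nhds 0)) :
    ∃ x ∈ Ici a, ∀ y ∈ Ici a, |f y| ≤ |f x| := by
  by_cases hz : ∃ x ∈ Ici a, f x ≠ 0
  · obtain ⟨x₀, hx₀, hfx⟩ := hz
    have hev : ∀ᶠ x in cocompact ℝ ⊓ 𝓟 (Ici a), |f x| ≤ |f x₀| := by
      have h1 : ∀ᶠ x in atTop, |f x| ≤ |f x₀| := by
        have := (tendsto_zero_iff_abs_tendsto_zero f).1 h0
        exact (this.eventually (gt_mem_nhds (abs_pos.2 hfx))).mono fun x hx => le_of_lt hx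
      obtain ⟨N, hN⟩ := eventually_atTop.1 h1
      rw [eventually_inf_principal]
      filter_upwards [(isCompact_Icc (a := a) (b := N)).compl_mem_cocompact] with x hx hx'
      apply hN
      by_contra hlt
      exact hx ⟨hx', by linarith⟩
    obtain ⟨x, hx, hmax⟩ := hf.abs.exists_isMaxOn' isClosed_Ici hx₀ hev
    exact ⟨x, hx, fun y hy => hmax hy⟩
  · push Not at hz
    exact ⟨a, self_mem_Ici, fun y hy => by rw [hz y hy, hz a self_mem_Ici]⟩

lemma integrableOn_abs_rpow (hp : 2 < p) {s : Set ℝ} (hs : MeasurableSet s) (hf : ContinuousOn f s)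
    (h1 : MemLp f 2 (volume.restrict s)) {R : ℝ} (hR : ∀ x ∈ s, |f x| ≤ R) :
    IntegrableOn (fun x => |f x| ^ p) s := by
  refine Integrable.mono' (h1.integrable_sq.const_mul (R ^ (p - 2)))
    (((continuous_abs_rpow hp).comp_continuousOn hf).aestronglyMeasurable hs) ?_
  refine (ae_restrict_iff' hs).2 (Eventually.of_forall fun x hx => ?_)
  rw [Real.norm_of_nonneg (by positivity), abs_rpow_eq hp]
  exact mul_le_mul_of_nonneg_right
    (Real.rpow_le_rpow (abs_nonneg _) (hR x hx) (by linarith)) (sq_nonneg _)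

/-- The conserved energy is an integrable function on a set of infinite measure, hence zero: every
half-line solution lies on the soliton's orbit in the phase plane. -/
lemma ClassicalOn.sq_eq_pot (hp : 2 < p) (h : ClassicalOn p (Ici 0) f w)
    (h1 : MemLp f 2 (volume.restrict (Ici 0)))
    (h2 : MemLp (deriv f) 2 (volume.restrict (Ici 0))) {x : ℝ} (hx : 0 ≤ x) :
    w x ^ 2 = pot p (f x) := by
  have hE : ∀ x, 0 ≤ x → w x ^ 2 - pot p (f x) = w 0 ^ 2 - pot p (f 0) := fun x hx =>
    (h.mono Icc_subset_Ici_self).sq_sub_pot hp hx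
  obtain ⟨x₀, -, hx₀⟩ := exists_abs_max_Ici h.cont (h.tendsto_zero h1 h2)
  have hi : IntegrableOn (fun x => w x ^ 2 - (f x ^ 2 - 2 / p * |f x| ^ p)) (Ioi 0) :=
    (h.memLp_deriv h2).integrable_sq.sub
      ((h1.integrable_sq.mono_measure (Measure.restrict_mono Ioi_subset_Ici_self le_rfl)).sub
      (((integrableOn_abs_rpow hp measurableSet_Ici h.cont h1 hx₀).mono_set
        Ioi_subset_Ici_self).const_mul _))
  have hc : IntegrableOn (fun _ : ℝ => w 0 ^ 2 - pot p (f 0)) (Ioi 0) :=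
    hi.congr_fun (fun x hx => hE x (le_of_lt hx)) measurableSet_Ioi
  rw [integrableOn_const_iff] at hc
  simp at hc
  linarith [hE x hx]

lemma ClassicalOn.integral_half_line (hp : 2 < p) (h : ClassicalOn p (Ici 0) f w)
    (h1 : MemLp f 2 (volume.restrict (Ici 0)))
    (h2 : MemLp (deriv f) 2 (volume.restrict (Ici 0))) :
    ∫ x in Ici 0, (deriv f x ^ 2 + f x ^ 2 - |f x| ^ p) = -(f 0 * w 0) := by
  obtain ⟨x₀, -, hx₀⟩ := exists_abs_max_Ici h.cont (h.tendsto_zero h1 h2)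
  have h1' : MemLp f 2 (volume.restrict (Ioi 0)) :=
    h1.mono_measure (Measure.restrict_mono Ioi_subset_Ici_self le_rfl)
  have hi : IntegrableOn (fun x => w x ^ 2 + f x ^ 2 - |f x| ^ p) (Ioi 0) :=
    ((h.memLp_deriv h2).integrable_sq.add h1'.integrable_sq).sub
      ((integrableOn_abs_rpow hp measurableSet_Ici h.cont h1 hx₀).mono_set Ioi_subset_Ici_self)
  have hd : ∀ x ∈ Ioi (0 : ℝ), HasDerivAt (fun x => f x * w x) (w x ^ 2 + f x ^ 2 - |f x| ^ p) x :=
    fun x hx => h.hasDerivAt_mul hp (by rwa [interior_Ici])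
  have h3 := integral_Ioi_of_hasDerivAt_of_tendsto
    ((h.cont.mul h.cont_deriv) 0 self_mem_Ici) hd hi
    (tendsto_zero_of_hasDerivAt_of_integrableOn_Ioi hd hi
      (h1'.integrable_mul (h.memLp_deriv h2)))
  rw [integral_Ici_eq_integral_Ioi, setIntegral_congr_fun measurableSet_Ioi 
    (g := fun x => w x ^ 2 + f x ^ 2 - |f x| ^ p), h3]
  · simp
  · intro x hx
    simp only
    rw [(h.hasDerivAt x (by rwa [interior_Ici])).deriv]

/-- A solution on the half-line that vanishes at the origin is zero. -/
lemma ClassicalOn.eq_zero (hp : 2 < p) (h : ClassicalOn p (Ici 0) f w)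
    (h1 : MemLp f 2 (volume.restrict (Ici 0)))
    (h2 : MemLp (deriv f) 2 (volume.restrict (Ici 0))) (h0 : f 0 = 0) {x : ℝ} (hx : 0 ≤ x) :
    f x = 0 := by
  -- Zero energy gives w² ≤ f², hence (f²)' ≤ 2 f², and Grönwall's argument replaces a uniqueness
  -- theorem.
  have hanti : AntitoneOn (fun x => f x ^ 2 * Real.exp (-2 * x)) (Ici 0) := by
    refine antitoneOn_of_hasDerivWithinAt_nonpos (convex_Ici 0)
      ((h.cont.pow 2).mul (by fun_prop))
      (f' := fun x => 2 * (f x * w x) * Real.exp (-2 * x) + f x ^ 2 * (Real.exp (-2 * x) * (-2)))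
      (fun x hx => ?_) (fun x hx => ?_)
    · have : HasDerivAt (fun x : ℝ => Real.exp (-2 * x)) (Real.exp (-2 * x) * (-2)) x := by
        simpa using ((hasDerivAt_id x).const_mul (-2)).exp
      exact ((h.hasDerivAt_sq hx).mul this).hasDerivWithinAt
    · rw [interior_Ici] at hx
      have hw := h.sq_eq_pot hp h1 h2 (le_of_lt hx)
      have := pot_le_sq hp (f x)
      have h3 : f x * w x ≤ f x ^ 2 := by nlinarith [sq_nonneg (f x - w x)]
      nlinarith [Real.exp_pos (-2 * x)]
  have := hanti self_mem_Ici hx hx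
  simp only [h0] at this
  have h4 := Real.exp_pos (-2 * x)
  have : f x ^ 2 ≤ 0 := by
    by_contra hc
    push Not at hc
    have := mul_pos hc h4
    simp at *
    linarith
  nlinarith [sq_nonneg (f x), pow_eq_zero_iff (two_ne_zero) |>.1 (le_antisymm this (sq_nonneg (f x)))]

/-- A positive interior maximum of the modulus of a half-line solution is the soliton's. -/
lemma ClassicalOn.abs_eq_peak (hp : 2 < p) (h : ClassicalOn p (Ici 0) f w)
    (h1 : MemLp f 2 (volume.restrict (Ici 0)))
    (h2 : MemLp (deriv f) 2 (volume.restrict (Ici 0))) {x₀ : ℝ} (hx₀ : 0 < x₀) (hne : f x₀ ≠ 0)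
    (hmax : ∀ y, 0 ≤ y → |f y| ≤ |f x₀|) : |f x₀| = peak p := by
  have hloc : IsLocalMax (fun x => f x ^ 2) x₀ := by
    filter_upwards [Ioi_mem_nhds hx₀] with y hy
    exact sq_le_sq.2 (hmax y (le_of_lt hy))
  have hd := hloc.hasDerivAt_eq_zero (h.hasDerivAt_sq (by simpa using hx₀))
  have hw : w x₀ = 0 := by
    rcases mul_eq_zero.1 ((mul_eq_zero.1 hd).resolve_left two_ne_zero) with h | h
    exacts [absurd h hne, h]
  have := h.sq_eq_pot hp h1 h2 hx₀.le
  rw [hw] at this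
  exact abs_eq_peak_of_pot_eq_zero hp hne (by simpa using this.symm)

/-- A half-line solution whose modulus increases at the origin reaches the soliton's maximum. -/
lemma ClassicalOn.exists_abs_eq_peak (hp : 2 < p) (h : ClassicalOn p (Ici 0) f w)
    (h1 : MemLp f 2 (volume.restrict (Ici 0)))
    (h2 : MemLp (deriv f) 2 (volume.restrict (Ici 0))) (h0 : 0 < f 0 * w 0) :
    ∃ x, 0 ≤ x ∧ |f x| = peak p := by
  obtain ⟨x₀, hx₀, hmax⟩ := exists_abs_max_Ici h.cont (h.tendsto_zero h1 h2)
  have hf0 : f 0 ≠ 0 := left_ne_zero_of_mul h0.ne'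
  -- The maximum of |f| cannot sit at the origin, because f² is strictly increasing just to the
  -- right of it.
  rcases (mem_Ici.1 hx₀).eq_or_lt with rfl | hpos
  · exfalso
    have hc : ContinuousWithinAt (fun x => f x * w x) (Ici 0) 0 :=
      (h.cont.mul h.cont_deriv) 0 self_mem_Ici
    have hev := hc.eventually (lt_mem_nhds h0)
    obtain ⟨ε, hε, hεs⟩ := mem_nhdsGE_iff_exists_Icc_subset.1 hev
    have hmono : StrictMonoOn (fun x => f x ^ 2) (Icc 0 ε) := by
      refine strictMonoOn_of_deriv_pos (convex_Icc _ _)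
        ((h.cont.mono Icc_subset_Ici_self).pow 2) fun x hx => ?_
      rw [interior_Icc] at hx
      rw [(h.hasDerivAt_sq (by simpa using hx.1)).deriv]
      have : 0 < f x * w x := hεs ⟨hx.1.le, hx.2.le⟩
      linarith
    have hlt := hmono ⟨le_rfl, le_of_lt hε⟩ ⟨le_of_lt hε, le_rfl⟩ hε
    exact absurd (sq_le_sq.2 (hmax ε (le_of_lt hε))) (not_le.2 hlt)
  · have hne : f x₀ ≠ 0 := by
      have := (abs_pos.2 hf0).trans_le (hmax 0 self_mem_Ici)
      exact abs_pos.1 this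
    exact ⟨x₀, hx₀, h.abs_eq_peak hp h1 h2 hpos hne fun y hy => hmax y hy⟩

end HalfLine

/-! ### Edge energies -/

/-- The rescaled energy density of which the action controls the integral. -/
def density (p t : ℝ) (f : ℝ → ℝ) (x : ℝ) : ℝ := (t ^ 2 * deriv f x ^ 2 + pot p (t * f x)) / 2

lemma density_nonneg (hp : 2 < p) {t : ℝ} {f : ℝ → ℝ} {x : ℝ} (h : |t * f x| ≤ peak p) :
    0 ≤ density p t f x := by
  have := pot_nonneg hp h
  unfold density; positivity

/-- The derivative of `vari p (t * f)` is `speed p (t * f) * (t * w)`, and the density is half the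
sum of the squares of these two factors. The bound on |t f| ensures that `speed p` squared is the
potential. -/
lemma ClassicalOn.vari_sub_le (hp : 2 < p) {a b t : ℝ} {f w : ℝ → ℝ}
    (h : ClassicalOn p (Icc a b) f w) (hab : a ≤ b) (ht : ∀ x ∈ Icc a b, |t * f x| ≤ peak p)
    (hint : IntegrableOn (density p t f) (Icc a b)) :
    |vari p (t * f b) - vari p (t * f a)| ≤ ∫ x in Icc a b, density p t f x := by
  have hc : ContinuousOn (fun x => speed p (t * f x) * (t * w x)) (Icc a b) :=
    ((continuous_speed hp).comp_continuousOn (continuousOn_const.mul h.cont)).mul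
      (continuousOn_const.mul h.cont_deriv)
  have hci : IntervalIntegrable (fun x => speed p (t * f x) * (t * w x)) volume a b :=
    ContinuousOn.intervalIntegrable (by rwa [uIcc_of_le hab])
  have hftc := intervalIntegral.integral_eq_sub_of_hasDerivAt_of_le
    (f := fun x => vari p (t * f x)) (f' := fun x => speed p (t * f x) * (t * w x)) hab
    ((continuous_vari hp).comp_continuousOn (continuousOn_const.mul h.cont)) (fun x hx => ?_) hci
  · rw [← hftc, intervalIntegral.integral_of_le hab, ← integral_Icc_eq_integral_Ioc,
      ← Real.norm_eq_abs]
    refine norm_integral_le_of_norm_le hint ?_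
    rw [← restrict_Ioo_eq_restrict_Icc]
    refine (ae_restrict_iff' measurableSet_Ioo).2 (Eventually.of_forall fun x hx => ?_)
    have hd := (h.hasDerivAt x (by rwa [interior_Icc])).deriv
    have hs := speed_sq hp (ht x (Ioo_subset_Icc_self hx))
    rw [Real.norm_eq_abs, density, hd, ← hs, abs_le]
    constructor <;> nlinarith [sq_nonneg (speed p (t * f x) - t * w x),
      sq_nonneg (speed p (t * f x) + t * w x)]
  · rw [← interior_Icc] at hx
    exact (hasDerivAt_vari hp _).comp x ((h.hasDerivAt x hx).const_mul t)

/-- The energy over an interval controls the oscillation of the modulus. -/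
lemma ClassicalOn.vari_abs_sub_le_integral (hp : 2 < p) {s : Set ℝ} (hs : s.OrdConnected)
    (hsm : MeasurableSet s) {t : ℝ} (ht0 : 0 ≤ t) {f w : ℝ → ℝ}
    (h : ClassicalOn p s f w) (ht : ∀ x ∈ s, |t * f x| ≤ peak p)
    (hint : IntegrableOn (density p t f) s) {x y : ℝ} (hx : x ∈ s) (hy : y ∈ s) :
    vari p (t * |f x|) - vari p (t * |f y|) ≤ ∫ x in s, density p t f x := by
  have key : ∀ a b, a ∈ s → b ∈ s → a ≤ b →
      |vari p (t * f b) - vari p (t * f a)| ≤ ∫ x in s, density p t f x := by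
    intro a b ha hb hab
    have hsub : Icc a b ⊆ s := hs.out ha hb
    refine ((h.mono hsub).vari_sub_le hp hab (fun x hx => ht x (hsub hx))
      (hint.mono_set hsub)).trans ?_
    exact setIntegral_mono_set hint ((ae_restrict_iff' hsm).2
      (Eventually.of_forall fun x hx => density_nonneg hp (ht x hx))) hsub.eventuallyLE
  have h2 : vari p (t * |f x|) - vari p (t * |f y|) ≤ |vari p (t * f x) - vari p (t * f y)| := by
    have := vari_abs_sub_le hp (t * f x) (t * f y)
    rwa [abs_mul, abs_mul, abs_of_nonneg ht0] at this
  rcases le_total x y with hxy | hxy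
  · have := key x y hx hy hxy
    rw [abs_sub_comm] at this
    exact h2.trans this
  · exact h2.trans (key y x hy hx hxy)

/-- On a half-line the modulus also has to decay to zero. -/
lemma ClassicalOn.two_mul_vari_sub_le (hp : 2 < p) {t : ℝ} (ht0 : 0 ≤ t) {f w : ℝ → ℝ}
    (h : ClassicalOn p (Ici 0) f w) (hf0 : Tendsto f atTop (nhds 0))
    (ht : ∀ x ∈ Ici (0 : ℝ), |t * f x| ≤ peak p)
    (hint : IntegrableOn (density p t f) (Ici 0)) {x : ℝ} (hx : 0 ≤ x) :
    2 * vari p (t * |f x|) - vari p (t * |f 0|) ≤ ∫ x in Ici 0, density p t f x := by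
  have hs1 : Icc 0 x ⊆ Ici (0 : ℝ) := Icc_subset_Ici_self
  have hs2 : Ici x ⊆ Ici (0 : ℝ) := Ici_subset_Ici.2 hx
  have e1 := (h.mono hs1).vari_abs_sub_le_integral hp ordConnected_Icc measurableSet_Icc ht0
    (fun y hy => ht y (hs1 hy)) (hint.mono_set hs1) (x := x) (y := 0) ⟨hx, le_rfl⟩ ⟨le_rfl, hx⟩
  -- The second endpoint of the oscillation estimate is sent to infinity, where f vanishes.
  have e2 : vari p (t * |f x|) ≤ ∫ x in Ici x, density p t f x := by
    have hlim : Tendsto (fun y => vari p (t * |f x|) - vari p (t * |f y|)) atTop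
        (nhds (vari p (t * |f x|) - vari p (t * |(0 : ℝ)|))) :=
      tendsto_const_nhds.sub (((continuous_vari hp).tendsto _).comp (hf0.abs.const_mul t))
    simp only [abs_zero, mul_zero, vari_zero, sub_zero] at hlim
    refine le_of_tendsto hlim ?_
    filter_upwards [eventually_ge_atTop x] with y hy
    exact (h.mono hs2).vari_abs_sub_le_integral hp ordConnected_Ici measurableSet_Ici ht0
      (fun y hy => ht y (hs2 hy)) (hint.mono_set hs2) self_mem_Ici hy
  have hsplit : ∫ y in Ici 0, density p t f y =
      (∫ y in Icc 0 x, density p t f y) + ∫ y in Ici x, density p t f y := by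
    rw [integral_Icc_eq_integral_Ico, ← setIntegral_union _ measurableSet_Ici
      ((hint.mono_set hs1).mono_set Ico_subset_Icc_self) (hint.mono_set hs2), Ico_union_Ici_eq_Ici hx]
    exact Set.disjoint_left.2 fun y hy hy' => absurd hy.2 (not_lt.2 hy')
  linarith

end

end SingleKnot

namespace SingleKnot

noncomputable section

variable {p : ℝ} {H P L : ℕ} {ℓ : ℝ}

/-! ### Action of bound-states -/

namespace IsBoundState

variable {u : GraphFun H P L}

lemma exists_abs_max (hp : 2 < p) (hℓ : 0 < ℓ) (hu : IsBoundState p ℓ u) (e : Edge H P L) :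
    ∃ x ∈ dom ℓ e, ∀ y ∈ dom ℓ e, |u e y| ≤ |u e x| := by
  obtain ⟨w, hw⟩ := hu.classicalOn hp hℓ e
  rcases e with i | i | i
  · exact exists_abs_max_Ici hw.cont (hw.tendsto_zero (hu.1.1 _).2.1 (hu.1.1 _).2.2)
  · obtain ⟨x, hx, h⟩ := isCompact_Icc.exists_isMaxOn (nonempty_Icc.2 hℓ.le) hw.cont.abs
    exact ⟨x, hx, fun y hy => h hy⟩
  · obtain ⟨x, hx, h⟩ := isCompact_Icc.exists_isMaxOn
      (nonempty_Icc.2 (by linarith : (0 : ℝ) ≤ 2 * ℓ)) hw.cont.abs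
    exact ⟨x, hx, fun y hy => h hy⟩

lemma integrableOn_sq (hu : IsBoundState p ℓ u) (e : Edge H P L) :
    IntegrableOn (fun x => u e x ^ 2) (dom ℓ e) := (hu.1.1 e).2.1.integrable_sq

lemma integrableOn_deriv_sq (hu : IsBoundState p ℓ u) (e : Edge H P L) :
    IntegrableOn (fun x => deriv (u e) x ^ 2) (dom ℓ e) := (hu.1.1 e).2.2.integrable_sq

lemma integrableOn_rpow (hp : 2 < p) (hℓ : 0 < ℓ) (hu : IsBoundState p ℓ u) (e : Edge H P L) :
    IntegrableOn (fun x => |u e x| ^ p) (dom ℓ e) := by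
  obtain ⟨w, hw⟩ := hu.classicalOn hp hℓ e
  obtain ⟨x, -, hx⟩ := hu.exists_abs_max hp hℓ e
  exact integrableOn_abs_rpow hp (measurableSet_dom e) hw.cont (hu.1.1 e).2.1 hx

/-- A bound-state lies on the Nehari manifold. -/
lemma nehari (hp : 2 < p) (hu : IsBoundState p ℓ u) :
    ∑ e, ∫ x in dom ℓ e, (deriv (u e) x ^ 2 + u e x ^ 2 - |u e x| ^ p) = 0 := by
  rw [← hu.2.2 u hu.1, graphIntegral]
  refine Finset.sum_congr rfl fun e _ => ?_
  congr 1
  ext x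
  rw [abs_rpow_eq hp]; ring

/-- The Nehari identity trades the quadratic part for the p-mass. -/
lemma action_eq (hp : 2 < p) (hℓ : 0 < ℓ) (hu : IsBoundState p ℓ u) :
    action p ℓ u = (1 / 2 - 1 / p) * ∑ e, ∫ x in dom ℓ e, |u e x| ^ p := by
  have h := hu.nehari hp
  have h1 : ∑ e, ∫ x in dom ℓ e, (deriv (u e) x ^ 2 + u e x ^ 2 - |u e x| ^ p) =
      (∑ e, ∫ x in dom ℓ e, (deriv (u e) x ^ 2 + u e x ^ 2)) - ∑ e, ∫ x in dom ℓ e, |u e x| ^ p := by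
    rw [← Finset.sum_sub_distrib]
    exact Finset.sum_congr rfl fun e _ => integral_sub
      ((hu.integrableOn_deriv_sq e).add (hu.integrableOn_sq e)) (hu.integrableOn_rpow hp hℓ e)
  rw [h1, sub_eq_zero] at h
  rw [action, graphIntegral, graphIntegral]
  simp only [sq_abs]
  rw [h]; ring

lemma action_nonneg (hp : 2 < p) (hℓ : 0 < ℓ) (hu : IsBoundState p ℓ u) : 0 ≤ action p ℓ u := by
  rw [hu.action_eq hp hℓ]
  have : 1 / p ≤ 1 / 2 := one_div_le_one_div_of_le two_pos hp.le
  exact mul_nonneg (by linarith) (Finset.sum_nonneg fun e _ =>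
    integral_nonneg fun x => by positivity)

lemma integrableOn_density (hp : 2 < p) (hℓ : 0 < ℓ) (hu : IsBoundState p ℓ u) {t : ℝ}
    (ht : 0 ≤ t) (e : Edge H P L) : IntegrableOn (density p t (u e)) (dom ℓ e) := by
  have := (((hu.integrableOn_deriv_sq e).const_mul (t ^ 2)).add
    (((hu.integrableOn_sq e).const_mul (t ^ 2)).sub
      (((hu.integrableOn_rpow hp hℓ e).const_mul (t ^ p)).const_mul (2 / p)))).div_const 2
  refine this.congr (Eventually.of_forall fun x => ?_)
  simp only [density, pot_const_mul _ _ ht, Pi.add_apply, Pi.sub_apply]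

/-- The action is at least the energy of any rescaled copy. -/
lemma sum_density_le_action (hp : 2 < p) (hℓ : 0 < ℓ) (hu : IsBoundState p ℓ u) {t : ℝ}
    (ht : 0 ≤ t) : ∑ e, ∫ x in dom ℓ e, density p t (u e) x ≤ action p ℓ u := by
  -- After summation over the edges the first term vanishes by the Nehari identity, and the
  -- remaining coefficient is largest at t = 1.
  have h : ∀ e, ∫ x in dom ℓ e, density p t (u e) x =
      t ^ 2 / 2 * (∫ x in dom ℓ e, (deriv (u e) x ^ 2 + u e x ^ 2 - |u e x| ^ p)) +
      (t ^ 2 / 2 - t ^ p / p) * ∫ x in dom ℓ e, |u e x| ^ p := by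
    intro e
    rw [← integral_const_mul, ← integral_const_mul, ← integral_add]
    · refine integral_congr_ae (Eventually.of_forall fun x => ?_)
      simp only [density, pot_const_mul _ _ ht]
      have : p ≠ 0 := by linarith
      field_simp
      ring
    · exact (((hu.integrableOn_deriv_sq e).add (hu.integrableOn_sq e)).sub
        (hu.integrableOn_rpow hp hℓ e)).const_mul _
    · exact (hu.integrableOn_rpow hp hℓ e).const_mul _
  simp_rw [h]
  rw [Finset.sum_add_distrib, ← Finset.mul_sum, ← Finset.mul_sum, hu.nehari hp, hu.action_eq hp hℓ]
  have h0 : 0 ≤ ∑ e, ∫ x in dom ℓ e, |u e x| ^ p :=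
    Finset.sum_nonneg fun e _ => integral_nonneg fun x => by positivity
  have := mul_le_mul_of_nonneg_right (half_sq_sub_rpow_div_le hp ht) h0
  linarith

/-- Where a bound-state has modulus below one, the Nehari functional is positive. -/
lemma integral_edge_of_abs_lt_one (hp : 2 < p) (hℓ : 0 < ℓ) (hu : IsBoundState p ℓ u)
    (e : Edge H P L) (h1 : ∀ x ∈ dom ℓ e, |u e x| < 1) :
    0 ≤ ∫ x in dom ℓ e, (deriv (u e) x ^ 2 + u e x ^ 2 - |u e x| ^ p) ∧
    (∫ x in dom ℓ e, (deriv (u e) x ^ 2 + u e x ^ 2 - |u e x| ^ p) = 0 →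
      ∀ x ∈ dom ℓ e, u e x = 0) := by
  have hle : ∀ x ∈ dom ℓ e, |u e x| ^ (p - 2) ≤ 1 := fun x hx =>
    Real.rpow_le_one (abs_nonneg _) (h1 x hx).le (by linarith)
  have hnn : 0 ≤ᵐ[volume.restrict (dom ℓ e)]
      fun x => deriv (u e) x ^ 2 + u e x ^ 2 - |u e x| ^ p := by
    refine (ae_restrict_iff' (measurableSet_dom e)).2 (Eventually.of_forall fun x hx => ?_)
    have := mul_le_mul_of_nonneg_right (hle x hx) (sq_nonneg (u e x))
    simp only [Pi.zero_apply]
    rw [abs_rpow_eq hp]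
    nlinarith [sq_nonneg (deriv (u e) x)]
  refine ⟨integral_nonneg_of_ae hnn, fun hz x hx => ?_⟩
  obtain ⟨w, hw⟩ := hu.classicalOn hp hℓ e
  have hae := (integral_eq_zero_iff_of_nonneg_ae hnn
    (((hu.integrableOn_deriv_sq e).add (hu.integrableOn_sq e)).sub
        (hu.integrableOn_rpow hp hℓ e))).1 hz
  have hae2 : u e =ᵐ[volume.restrict (dom ℓ e)] fun _ => 0 := by
    filter_upwards [hae, (ae_restrict_iff' (measurableSet_dom e)).2
      (Eventually.of_forall fun x hx => hx)] with x hx hxd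
    by_contra hne
    have hlt : |u e x| ^ (p - 2) < 1 :=
      Real.rpow_lt_one (abs_nonneg _) (h1 x hxd) (by linarith)
    have hpos : 0 < u e x ^ 2 := by positivity
    have := mul_lt_mul_of_pos_right hlt hpos
    simp only [Pi.zero_apply] at hx
    rw [abs_rpow_eq hp] at hx
    nlinarith [sq_nonneg (deriv (u e) x)]
  -- Almost everywhere vanishing becomes vanishing everywhere, by continuity.
  have hcl : dom ℓ e ⊆ closure (interior (dom ℓ e)) := by
    rcases e with i | i | i
    · simp [dom, closure_Ioi]
    · exact (closure_interior_Icc hℓ.ne).symm.subset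
    · exact (closure_interior_Icc (by linarith : (0 : ℝ) < 2 * ℓ).ne).symm.subset
  exact Measure.eqOn_of_ae_eq hae2 hw.cont continuousOn_const hcl hx

/-- Below height one the Nehari integrand is nonnegative and vanishes only where u does, so a
nonpositive sum over some edges would force u = 0 on all of them. It is used for the whole graph and
for the core alone. -/
lemma exists_one_le_abs (hp : 2 < p) (hℓ : 0 < ℓ) (hu : IsBoundState p ℓ u)
    (s : Finset (Edge H P L))
    (hs : ∑ e ∈ s, ∫ x in dom ℓ e, (deriv (u e) x ^ 2 + u e x ^ 2 - |u e x| ^ p) ≤ 0)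
    (hne : ∃ e ∈ s, ∃ x ∈ dom ℓ e, u e x ≠ 0) : ∃ e ∈ s, ∃ x ∈ dom ℓ e, 1 ≤ |u e x| := by
  by_contra hcon
  push Not at hcon
  obtain ⟨e, he, x, hx, hxe⟩ := hne
  have hz := (Finset.sum_eq_zero_iff_of_nonneg fun e he =>
    (hu.integral_edge_of_abs_lt_one hp hℓ e (hcon e he)).1).1
    (le_antisymm hs (Finset.sum_nonneg fun e he =>
      (hu.integral_edge_of_abs_lt_one hp hℓ e (hcon e he)).1))
  exact hxe ((hu.integral_edge_of_abs_lt_one hp hℓ e (hcon e he)).2 (hz e he) x hx)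

/-- Energy of a core-symmetric bound-state on the compact edges. -/
lemma core_energy (hp : 2 < p) (hℓ : 0 < ℓ) (hu : IsBoundState p ℓ u)
    {t M m : ℝ} (ht : 0 ≤ t) (hpk : ∀ e, ∀ x ∈ dom ℓ e, |t * u e x| ≤ peak p)
    (hM : ∀ κ, ∃ x ∈ Icc 0 ℓ, |coreRestrict ℓ u κ x| = M)
    (hm : ∀ κ, ∃ x ∈ Icc 0 ℓ, |coreRestrict ℓ u κ x| = m) :
    (P + 2 * L) * (vari p (t * M) - vari p (t * m)) ≤
      ∑ e : Fin P ⊕ Fin L, ∫ x in dom ℓ (.inr e : Edge H P L), density p t (u (.inr e)) x := by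
  rw [Fintype.sum_sum_type]
  have hP : ∀ i : Fin P, vari p (t * M) - vari p (t * m) ≤
      ∫ x in dom ℓ (.inr (.inl i) : Edge H P L), density p t (u (.inr (.inl i))) x := by
    intro i
    obtain ⟨w, hw⟩ := hu.classicalOn hp hℓ (.inr (.inl i))
    obtain ⟨x, hx, rfl⟩ := hM (.inl i)
    obtain ⟨y, hy, rfl⟩ := hm (.inl i)
    exact hw.vari_abs_sub_le_integral hp ordConnected_Icc measurableSet_Icc ht
      (hpk (.inr (.inl i))) (hu.integrableOn_density hp hℓ ht _) hx hy
  have hL : ∀ i : Fin L, 2 * (vari p (t * M) - vari p (t * m)) ≤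
      ∫ x in dom ℓ (.inr (.inr i) : Edge H P L), density p t (u (.inr (.inr i))) x := by
    intro i
    obtain ⟨w, hw⟩ := hu.classicalOn hp hℓ (.inr (.inr i))
    have hint := hu.integrableOn_density hp hℓ ht (.inr (.inr i))
    have s1 : Icc 0 ℓ ⊆ dom ℓ (.inr (.inr i) : Edge H P L) :=
      Icc_subset_Icc_right (by linarith)
    have s2 : Icc ℓ (2 * ℓ) ⊆ dom ℓ (.inr (.inr i) : Edge H P L) := Icc_subset_Icc_left hℓ.le
    have e1 : vari p (t * M) - vari p (t * m) ≤
        ∫ x in Icc 0 ℓ, density p t (u (.inr (.inr i))) x := by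
      obtain ⟨x, hx, rfl⟩ := hM (.inr (.inl i))
      obtain ⟨y, hy, rfl⟩ := hm (.inr (.inl i))
      exact (hw.mono s1).vari_abs_sub_le_integral hp ordConnected_Icc measurableSet_Icc ht
        (fun x hx => hpk _ x (s1 hx)) (hint.mono_set s1) hx hy
    have e2 : vari p (t * M) - vari p (t * m) ≤
        ∫ x in Icc ℓ (2 * ℓ), density p t (u (.inr (.inr i))) x := by
      obtain ⟨x, hx, rfl⟩ := hM (.inr (.inr i))
      obtain ⟨y, hy, rfl⟩ := hm (.inr (.inr i))
      exact (hw.mono s2).vari_abs_sub_le_integral hp ordConnected_Icc measurableSet_Icc ht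
        (fun x hx => hpk _ x (s2 hx)) (hint.mono_set s2)
        ⟨by linarith [hx.2], by linarith [hx.1]⟩ ⟨by linarith [hy.2], by linarith [hy.1]⟩
    have hsplit : ∫ x in dom ℓ (.inr (.inr i) : Edge H P L), density p t (u (.inr (.inr i))) x =
        (∫ x in Icc 0 ℓ, density p t (u (.inr (.inr i))) x) +
        ∫ x in Icc ℓ (2 * ℓ), density p t (u (.inr (.inr i))) x := by
      rw [integral_Icc_eq_integral_Ico (y := ℓ), ← setIntegral_union _ measurableSet_Icc
        ((hint.mono_set s1).mono_set Ico_subset_Icc_self) (hint.mono_set s2),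
        Ico_union_Icc_eq_Icc hℓ.le (by linarith)]
      · rfl
      · exact Set.disjoint_left.2 fun y hy hy' => absurd hy.2 (not_lt.2 hy'.1)
    linarith
  have h1 := Finset.sum_le_sum fun i (_ : i ∈ Finset.univ) => hP i
  have h2 := Finset.sum_le_sum fun i (_ : i ∈ Finset.univ) => hL i
  simp only [Finset.sum_const, Finset.card_univ, Fintype.card_fin, nsmul_eq_mul] at h1 h2
  linarith

end IsBoundState

/-! ### Lower bound for the action of core-symmetric bound-states -/

set_option maxHeartbeats 1000000 in
/-- For long compact edges, a core-symmetric bound-state has action well above the level of one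
half-soliton per distinguished compact edge. -/
theorem exists_action_lower_bound (hp : 2 < p) (H P L K : ℕ) (hN : 2 * K ≤ P + 2 * L)
    (hK : K = 1 ∨ (K = 2 ∧ 2 ≤ H)) :
    ∃ ℓ₀ : ℝ, 0 < ℓ₀ ∧ ∀ ℓ, ℓ₀ ≤ ℓ → ∀ u : GraphFun H P L, IsBoundState p ℓ u →
      IsCoreSymmetric ℓ u → K * vari p (peak p) + vari p 1 / 2 ≤ action p ℓ u := by
  classical
  have hV1 := vari_one_pos hp
  have hVJ := vari_le_peak hp 1
  set J := vari p (peak p) with hJ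
  have hpk := peak_pos hp
  have hK1 : 1 ≤ K := by rcases hK with h | h <;> omega
  have hK1' : (1 : ℝ) ≤ K := by exact_mod_cast hK1
  have hN' : 2 * (K : ℝ) ≤ P + 2 * L := by exact_mod_cast hN
  set N : ℝ := P + 2 * L with hNdef
  have hN0 : 0 < N := by linarith
  have hpp : 0 < 1 / 2 - 1 / p := by
    have : 1 / p < 1 / 2 := one_div_lt_one_div_of_lt two_pos hp
    linarith
  -- Chosen so that N `peak p`² ε² = `vari p 1 / 2`: a minimum of size ε on each of the N compact
  -- edges loses at most this much in total.
  set ε := √(vari p 1 / (2 * N * peak p ^ 2)) with hε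
  have hε0 : 0 < ε := Real.sqrt_pos.2 (by positivity)
  have hε2 : ε ^ 2 = vari p 1 / (2 * N * peak p ^ 2) := Real.sq_sqrt (by positivity)
  have hJ0 : 0 < J := hV1.trans_le hVJ
  -- If |u| > ε on a compact edge of this length, the p-mass of that edge already gives action at
  -- least K J + `vari p 1`.
  have hℓ₀ : 0 < (K * J + vari p 1) / ((1 / 2 - 1 / p) * ε ^ p) :=
    div_pos (by positivity) (mul_pos hpp (by positivity))
  refine ⟨(K * J + vari p 1) / ((1 / 2 - 1 / p) * ε ^ p), hℓ₀, ?_⟩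
  intro ℓ hℓ u hu hsym
  have hℓ0 : 0 < ℓ := lt_of_lt_of_le hℓ₀ hℓ
  by_contra! hlt
  -- the profile on the compact edges
  have hκ : Nonempty (CoreEdge P L) := by
    rcases Nat.eq_zero_or_pos P with h | h
    · exact ⟨.inr (.inl ⟨0, by omega⟩)⟩
    · exact ⟨.inl ⟨0, h⟩⟩
  obtain ⟨κ₀⟩ := hκ
  set v := coreRestrict ℓ u κ₀ with hv
  have hvκ : ∀ κ, ∀ x ∈ Icc 0 ℓ, coreRestrict ℓ u κ x = v x := fun κ x hx => hsym κ κ₀ x hx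
  obtain ⟨c, hc0, hcL⟩ := hu.1.2
  have hvc : v 0 = c := by
    rcases hk : κ₀ with i | i | i <;> rw [hv, hk] <;> simp [coreRestrict, hc0, hcL]
  have hvcont : ContinuousOn v (Icc 0 ℓ) := by
    rcases hk : κ₀ with i | i | i <;> rw [hv, hk]
    · exact (hu.classicalOn hp hℓ0 (.inr (.inl i))).choose_spec.cont
    · exact (hu.classicalOn hp hℓ0 (.inr (.inr i))).choose_spec.cont.mono
        (Icc_subset_Icc_right (by linarith))
    · refine (hu.classicalOn hp hℓ0 (.inr (.inr i))).choose_spec.cont.comp (by fun_prop) ?_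
      exact fun x hx => ⟨by linarith [hx.2], by linarith [hx.1]⟩
  obtain ⟨xM, hxM, hMmax⟩ := isCompact_Icc.exists_isMaxOn (nonempty_Icc.2 hℓ0.le) hvcont.abs
  obtain ⟨xm, hxm, hmmin⟩ := isCompact_Icc.exists_isMinOn (nonempty_Icc.2 hℓ0.le) hvcont.abs
  have hcM : |c| ≤ |v xM| := by
    rw [← hvc]; exact hMmax (left_mem_Icc.2 hℓ0.le)
  have hcore : ∀ e : Fin P ⊕ Fin L, ∀ x ∈ dom ℓ (.inr e : Edge H P L),
      ∃ y ∈ Icc 0 ℓ, u (.inr e) x = v y := by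
    rintro (i | i) x hx
    · exact ⟨x, hx, hvκ (.inl i) x hx⟩
    · rcases le_total x ℓ with h | h
      · exact ⟨x, ⟨hx.1, h⟩, hvκ (.inr (.inl i)) x ⟨hx.1, h⟩⟩
      · refine ⟨2 * ℓ - x, ⟨by linarith [hx.2], by linarith⟩, ?_⟩
        rw [← hvκ (.inr (.inr i)) _ ⟨by linarith [hx.2], by linarith⟩]
        simp [coreRestrict]
  have hcoreM : ∀ e : Fin P ⊕ Fin L, ∀ x ∈ dom ℓ (.inr e : Edge H P L),
      |u (.inr e) x| ≤ |v xM| := by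
    intro e x hx
    obtain ⟨y, hy, h⟩ := hcore e x hx
    rw [h]; exact hMmax hy
  -- the minimum on the compact edges is small
  have hmε : |v xm| ≤ ε := by
    by_contra! hgt
    have hone : ∃ e : Fin P ⊕ Fin L, ℓ * ε ^ p ≤ ∫ x in dom ℓ (.inr e : Edge H P L),
        |u (.inr e) x| ^ p := by
      obtain ⟨e⟩ : Nonempty (Fin P ⊕ Fin L) := by
        rcases κ₀ with i | i | i
        exacts [⟨.inl i⟩, ⟨.inr i⟩, ⟨.inr i⟩]
      refine ⟨e, ?_⟩
      have hsub : Icc 0 ℓ ⊆ dom ℓ (.inr e : Edge H P L) := fun x hx => mem_dom_of_mem_Icc hℓ0.le hx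
      have hi := hu.integrableOn_rpow hp hℓ0 (.inr e)
      calc ℓ * ε ^ p = ∫ _ in Icc 0 ℓ, ε ^ p := by simp [hℓ0.le]
        _ ≤ ∫ x in Icc 0 ℓ, |u (.inr e) x| ^ p := by
          refine setIntegral_mono_on (by simp) (hi.mono_set hsub) measurableSet_Icc fun x hx => ?_
          obtain ⟨y, hy, h⟩ := hcore e x (hsub hx)
          rw [h]
          exact Real.rpow_le_rpow hε0.le (hgt.le.trans (hmmin hy)) (by linarith)
        _ ≤ _ := setIntegral_mono_set hi (Eventually.of_forall fun x => by simp only [Pi.zero_apply]; positivity)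
          hsub.eventuallyLE
    obtain ⟨e, he⟩ := hone
    have h1 : ℓ * ε ^ p ≤ ∑ e : Edge H P L, ∫ x in dom ℓ e, |u e x| ^ p :=
      he.trans (Finset.single_le_sum (f := fun e : Edge H P L => ∫ x in dom ℓ e, |u e x| ^ p)
        (fun e _ => integral_nonneg fun x => by positivity) (Finset.mem_univ (Sum.inr e)))
    have h2 : (1 / 2 - 1 / p) * (ℓ * ε ^ p) ≤ action p ℓ u := by
      rw [hu.action_eq hp hℓ0]; exact mul_le_mul_of_nonneg_left h1 hpp.le
    rw [div_le_iff₀ (mul_pos hpp (by positivity))] at hℓ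
    linarith
  -- the global maximum
  have hmaxe := fun e => hu.exists_abs_max hp hℓ0 e
  choose xe hxe hxemax using hmaxe
  have hne : Nonempty (Edge H P L) := ⟨hu.2.1.choose⟩
  obtain ⟨e₁, he₁⟩ := Finite.exists_max fun e => |u e (xe e)|
  set M := |u e₁ (xe e₁)| with hM
  have hMall : ∀ e, ∀ x ∈ dom ℓ e, |u e x| ≤ M := fun e x hx => (hxemax e x hx).trans (he₁ e)
  have hM1 : 1 ≤ M := by
    obtain ⟨e, -, x, hx, h⟩ := hu.exists_one_le_abs hp hℓ0 Finset.univ (hu.nehari hp).le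
      (by obtain ⟨e, x, hx, h⟩ := hu.2.1; exact ⟨e, Finset.mem_univ _, x, hx, h⟩)
    exact h.trans (hMall e x hx)
  -- The rescaling that lifts the global maximum exactly to the soliton's. Since M ≥ 1, t ≤ `peak
  -- p`, which keeps the rescaled minimum small uniformly in u.
  set t := peak p / M with ht
  have ht0 : 0 < t := by positivity
  have htpk : t ≤ peak p := div_le_self hpk.le hM1
  have htM : t * M = peak p := by rw [ht]; field_simp
  have htall : ∀ e, ∀ x ∈ dom ℓ e, |t * u e x| ≤ peak p := by
    intro e x hx
    rw [abs_mul, abs_of_pos ht0, ← htM]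
    exact mul_le_mul_of_nonneg_left (hMall e x hx) ht0.le
  have hdec : ∑ i : Fin H, (∫ x in dom ℓ (.inl i : Edge H P L), density p t (u (.inl i)) x) +
      ∑ e : Fin P ⊕ Fin L, (∫ x in dom ℓ (.inr e : Edge H P L), density p t (u (.inr e)) x)
      ≤ action p ℓ u := by
    rw [← Fintype.sum_sum_type (fun e : Edge H P L => ∫ x in dom ℓ e, density p t (u e) x)]
    exact hu.sum_density_le_action hp hℓ0 ht0.le
  have hcoreE := hu.core_energy hp hℓ0 (M := |v xM|) (m := |v xm|) ht0.le htall
    (fun κ => ⟨xM, hxM, by rw [hvκ κ _ hxM]⟩) (fun κ => ⟨xm, hxm, by rw [hvκ κ _ hxm]⟩)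
  have hsmall : N * vari p (t * |v xm|) ≤ vari p 1 / 2 := by
    have h1 : t * |v xm| ≤ peak p * ε := mul_le_mul htpk hmε (abs_nonneg _) hpk.le
    have h2 : vari p (t * |v xm|) ≤ peak p ^ 2 * ε ^ 2 := by
      refine (vari_mono hp h1).trans ?_
      rw [← mul_pow]; exact vari_le_sq hp (by positivity)
    calc N * vari p (t * |v xm|) ≤ N * (peak p ^ 2 * ε ^ 2) := by gcongr
      _ = vari p 1 / 2 := by rw [hε2]; field_simp
  have hHnn : ∀ i : Fin H, 0 ≤ ∫ x in dom ℓ (.inl i : Edge H P L), density p t (u (.inl i)) x :=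
    fun i => setIntegral_nonneg (measurableSet_dom _) fun x hx => density_nonneg hp (htall _ x hx)
  rw [← hNdef, mul_sub] at hcoreE
  by_cases hcase : M ≤ |v xM|
  · -- the maximum is attained on the compact edges
    have h1 : vari p (t * |v xM|) = J := by
      refine le_antisymm (vari_le_peak hp _) ?_
      rw [hJ, ← htM]; exact vari_mono hp (mul_le_mul_of_nonneg_left hcase ht0.le)
    have h2 := Finset.sum_nonneg fun i (_ : i ∈ Finset.univ) => hHnn i
    rw [h1] at hcoreE
    have h3 := mul_le_mul_of_nonneg_right hN' hJ0.le
    have h4 := mul_le_mul_of_nonneg_right hK1' hJ0.le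
    linarith
  · -- the maximum is attained on a half-line
    push Not at hcase
    obtain ⟨i₁, hi₁⟩ : ∃ i₁ : Fin H, e₁ = .inl i₁ := by
      rcases h : e₁ with i | i
      · exact ⟨i, rfl⟩
      · exfalso
        have hx := hxe e₁
        rw [h] at hx
        have := hcoreM i _ hx
        rw [← h] at this
        linarith
    have hL2 := fun i : Fin H => (hu.1.1 (.inl i)).2.1
    have hD2 := fun i : Fin H => (hu.1.1 (.inl i)).2.2
    have hcl := fun i : Fin H => hu.classicalOn hp hℓ0 (.inl i)
    choose w hw using hcl
    have hfin : ∀ i : Fin H, ∀ x, 0 ≤ x → |u (.inl i) x| = peak p → t = 1 →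
        2 * J - vari p |c| ≤ ∫ x in dom ℓ (.inl i : Edge H P L), density p t (u (.inl i)) x := by
      intro i x hx hxp ht1
      have := (hw i).two_mul_vari_sub_le hp ht0.le ((hw i).tendsto_zero (hL2 i) (hD2 i))
        (htall (.inl i)) (hu.integrableOn_density hp hℓ0 ht0.le (.inl i)) hx
      rw [hxp, hc0] at this
      simp only [ht1, one_mul] at this ⊢
      exact this
    have hx₁ := hxe e₁
    have hMpk : M = peak p := by
      rw [hi₁] at hx₁
      -- The maximum exceeds every value on the core, in particular |c|, so it is not at the vertex.
      have h0 : 0 < xe (.inl i₁) := by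
        rcases (mem_Ici.1 hx₁).eq_or_lt with h | h
        · exfalso
          have : M = |c| := by rw [hM, hi₁, ← h, hc0]
          linarith
        · exact h
      have := (hw i₁).abs_eq_peak hp (hL2 i₁) (hD2 i₁) h0 (by
        intro hz
        rw [← hi₁] at hz
        rw [hM, hz] at hM1
        simp at hM1; linarith) (fun y hy => hxemax (.inl i₁) y hy)
      rw [hM, hi₁, this]
    have ht1 : t = 1 := by rw [ht, hMpk]; exact div_self hpk.ne'
    have hone : 2 * J - vari p |c| ≤
        ∫ x in dom ℓ (.inl i₁ : Edge H P L), density p t (u (.inl i₁)) x := by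
      refine hfin i₁ (xe (.inl i₁)) ?_ ?_ ht1
      · rw [hi₁] at hx₁; exact hx₁
      · rw [← hMpk, hM, hi₁]
    have hcv : vari p |c| ≤ vari p |v xM| := vari_mono hp hcM
    have hvM0 : 0 ≤ vari p |v xM| := vari_nonneg hp (abs_nonneg _)
    simp only [ht1, one_mul] at hcoreE hsmall
    have hsum1 : (∫ x in dom ℓ (.inl i₁ : Edge H P L), density p t (u (.inl i₁)) x) ≤
        ∑ i : Fin H, (∫ x in dom ℓ (.inl i : Edge H P L), density p t (u (.inl i)) x) :=
      Finset.single_le_sum (f := fun i : Fin H =>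
        ∫ x in dom ℓ (.inl i : Edge H P L), density p t (u (.inl i)) x)
        (fun i _ => hHnn i) (Finset.mem_univ i₁)
    simp only [ht1] at hsum1 hone hdec hfin
    rcases hK with rfl | ⟨rfl, hH2⟩
    -- One half-line with a peak pays 2J - `vari p |c|`; since |c| is at most the core maximum, the
    -- compact edges cover the loss.
    · have h3 := mul_le_mul_of_nonneg_right hN' hvM0
      push_cast at hlt h3
      linarith
    · have hN4 : 4 ≤ N := by norm_num at hN'; linarith
      -- If a second half-line starts with increasing modulus it also reaches the peak, giving 4J -
      -- 2 `vari p |c|` in total, and N ≥ 4 compact edges cover both losses.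
      by_cases htwo : ∃ i₂, i₂ ≠ i₁ ∧ 0 < u (.inl i₂) 0 * w i₂ 0
      · obtain ⟨i₂, hi₂, hpos⟩ := htwo
        obtain ⟨x, hx, hxp⟩ := (hw i₂).exists_abs_eq_peak hp (hL2 i₂) (hD2 i₂) hpos
        have h2 := hfin i₂ x hx hxp trivial
        have hsum2 := Finset.add_le_sum (f := fun i : Fin H =>
          ∫ x in dom ℓ (.inl i : Edge H P L), density p 1 (u (.inl i)) x) (s := Finset.univ)
          (fun i _ => by have := hHnn i; rwa [ht1] at this) (Finset.mem_univ i₁)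
          (Finset.mem_univ i₂) hi₂.symm
        have h3 := mul_le_mul_of_nonneg_right hN4 hvM0
        push_cast at hlt
        linarith
      · push Not at htwo
        have hcne : c ≠ 0 := by
          intro hcz
          have := (hw i₁).eq_zero hp (hL2 i₁) (hD2 i₁) (by rw [hc0, hcz]) (x := xe (.inl i₁))
            (by rw [hi₁] at hx₁; exact hx₁)
          rw [hM, hi₁, this] at hM1
          simp at hM1; linarith
        have hcw : ∀ i, (c * w i 0) ^ 2 = c ^ 2 * pot p c := by
          intro i
          rw [mul_pow, (hw i).sq_eq_pot hp (hL2 i) (hD2 i) le_rfl, hc0]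
        -- All the numbers c w_i(0) have the same modulus, because the squared slope is `pot p c` on
        -- every half-line. Only i₁ can be positive, and one nonpositive companion cancels it; this
        -- uses H ≥ 2.
        have hsumle : ∑ i, c * w i 0 ≤ 0 := by
          obtain ⟨i₂, hi₂⟩ : ∃ i₂ : Fin H, i₂ ≠ i₁ := by
            have : Nontrivial (Fin H) := Fin.nontrivial_iff_two_le.2 hH2
            exact exists_ne i₁
          have h2 := htwo i₂ hi₂
          rw [hc0] at h2
          have h12 : c * w i₁ 0 ≤ -(c * w i₂ 0) := by
            apply le_of_sq_le_sq _ (by linarith)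
            rw [neg_sq, hcw, hcw]
          have hrest : ∑ i ∈ (Finset.univ.erase i₁).erase i₂, c * w i 0 ≤ 0 := by
            refine Finset.sum_nonpos fun i hi => ?_
            have := htwo i (by simp at hi; exact hi.2)
            rwa [hc0] at this
          rw [← Finset.add_sum_erase _ _ (Finset.mem_univ i₁),
            ← Finset.add_sum_erase _ _ (Finset.mem_erase.2 ⟨hi₂, Finset.mem_univ i₂⟩)]
          linarith
        have hneh := hu.nehari hp
        rw [Fintype.sum_sum_type] at hneh
        have hhl : ∑ i : Fin H, ∫ x in dom ℓ (.inl i : Edge H P L),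
            (deriv (u (.inl i)) x ^ 2 + u (.inl i) x ^ 2 - |u (.inl i) x| ^ p) =
            - ∑ i, c * w i 0 := by
          rw [← Finset.sum_neg_distrib]
          refine Finset.sum_congr rfl fun i _ => ?_
          rw [← hc0 (.inl i)]
          exact (hw i).integral_half_line hp (hL2 i) (hD2 i)
        rw [hhl] at hneh
        -- The half-lines contribute at least 0 to the Nehari functional, so the core contributes at
        -- most 0 and reaches height one.
        obtain ⟨e, he, x, hx, h1⟩ := hu.exists_one_le_abs hp hℓ0
          (Finset.univ.map Function.Embedding.inr) (by rw [Finset.sum_map]; simp only [Function.Embedding.inr_apply]; linarith) (by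
            obtain ⟨e⟩ : Nonempty (Fin P ⊕ Fin L) := by
              rcases κ₀ with i | i | i
              exacts [⟨.inl i⟩, ⟨.inr i⟩, ⟨.inr i⟩]
            exact ⟨.inr e, by simp, 0, zero_mem_dom hℓ0.le _, by rw [hc0]; exact hcne⟩)
        obtain ⟨e, -, rfl⟩ := Finset.mem_map.1 he
        have hv1 : vari p 1 ≤ vari p |v xM| := vari_mono hp (h1.trans (hcoreM e x hx))
        have h3 := mul_le_mul_of_nonneg_right hN4 hvM0
        push_cast at hlt
        linarith

end

end SingleKnot

namespace SingleKnot

noncomputable section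

variable {p : ℝ} {H P L : ℕ} {ℓ : ℝ}

/-! ### Bound-states from classical solutions -/

/-- `f` solves `f'' = nl p f` at every point of `s`, with derivative `w`. -/
def SolvesOn (p : ℝ) (s : Set ℝ) (f w : ℝ → ℝ) : Prop :=
  ∀ x ∈ s, HasDerivAt f (w x) x ∧ HasDerivAt w (nl p (f x)) x

namespace SolvesOn

variable {s : Set ℝ} {f w : ℝ → ℝ} {b : ℝ}

lemma mono {t : Set ℝ} (h : SolvesOn p s f w) (hts : t ⊆ s) : SolvesOn p t f w :=
  fun x hx => h x (hts hx)

lemma continuousOn (h : SolvesOn p s f w) : ContinuousOn f s :=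
  fun x hx => (h x hx).1.continuousAt.continuousWithinAt

lemma continuousOn_deriv (h : SolvesOn p s f w) : ContinuousOn w s :=
  fun x hx => (h x hx).2.continuousAt.continuousWithinAt

lemma classicalOn (h : SolvesOn p s f w) : ClassicalOn p s f w where
  cont := h.continuousOn
  cont_deriv := h.continuousOn_deriv
  hasDerivAt x hx := (h x (interior_subset hx)).1
  hasDerivAt_deriv x hx := (h x (interior_subset hx)).2

end SolvesOn

lemma absolutelyContinuousOnInterval_of_hasDerivAt {f w : ℝ → ℝ} {a b : ℝ}
    (h : ∀ x ∈ uIcc a b, HasDerivAt f (w x) x) (hw : ContinuousOn w (uIcc a b)) :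
    AbsolutelyContinuousOnInterval f a b := by
  obtain ⟨C, hC⟩ := isCompact_uIcc.exists_bound_of_continuousOn hw
  have hlip : LipschitzOnWith C.toNNReal f (uIcc a b) :=
    (convex_uIcc a b).lipschitzOnWith_of_nnnorm_hasDerivWithin_le
      (fun x hx => (h x hx).hasDerivWithinAt) fun x hx => by
        rw [← NNReal.coe_le_coe, coe_nnnorm]
        exact (hC x hx).trans (Real.le_coe_toNNReal C)
  exact hlip.absolutelyContinuousOnInterval

lemma SolvesOn.ac (hp : 2 < p) {f w : ℝ → ℝ} {b : ℝ} (hb : 0 ≤ b) (h : SolvesOn p (Icc 0 b) f w) :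
    AbsolutelyContinuousOnInterval f 0 b ∧ AbsolutelyContinuousOnInterval w 0 b := by
  rw [← uIcc_of_le hb] at h
  exact ⟨absolutelyContinuousOnInterval_of_hasDerivAt (fun x hx => (h x hx).1) h.continuousOn_deriv,
    absolutelyContinuousOnInterval_of_hasDerivAt (fun x hx => (h x hx).2)
      ((continuous_nl hp).comp_continuousOn h.continuousOn)⟩

/-- The weak form on an interval reduces to boundary terms. -/
lemma SolvesOn.integral_weak (hp : 2 < p) {f w η : ℝ → ℝ} {b : ℝ} (hb : 0 ≤ b)
    (h : SolvesOn p (Icc 0 b) f w) (hη : AbsolutelyContinuousOnInterval η 0 b) :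
    ∫ x in Icc 0 b, (deriv f x * deriv η x + f x * η x - |f x| ^ (p - 2) * f x * η x) =
      w b * η b - w 0 * η 0 := by
  rw [← (h.ac hp hb).2.integral_deriv_mul_eq_sub hη, intervalIntegral.integral_of_le hb,
    ← integral_Icc_eq_integral_Ioc]
  refine setIntegral_congr_fun measurableSet_Icc fun x hx => ?_
  simp only [(h x hx).1.deriv, (h x hx).2.deriv, nl]
  ring

/-- The weak form on a half-line reduces to the boundary term at the origin. -/
lemma SolvesOn.integral_weak_Ici (hp : 2 < p) {f w η : ℝ → ℝ} {R : ℝ}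
    (h : SolvesOn p (Ici 0) f w) (hR : ∀ x ∈ Ici (0 : ℝ), |f x| ≤ R)
    (hf : MemLp f 2 (volume.restrict (Ici 0))) (hw : MemLp w 2 (volume.restrict (Ici 0)))
    (hη : ∀ b, 0 ≤ b → AbsolutelyContinuousOnInterval η 0 b)
    (hη1 : MemLp η 2 (volume.restrict (Ici 0)))
    (hη2 : MemLp (deriv η) 2 (volume.restrict (Ici 0))) :
    ∫ x in Ici 0, (deriv f x * deriv η x + f x * η x - |f x| ^ (p - 2) * f x * η x) =
      -(w 0 * η 0) := by
  have hcont : ContinuousOn (fun x => |f x| ^ (p - 2) * f x) (Ici 0) :=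
    (h.continuousOn.abs.rpow_const fun x _ => Or.inr (by linarith)).mul h.continuousOn
  have hnl : MemLp (fun x => |f x| ^ (p - 2) * f x) 2 (volume.restrict (Ici 0)) := by
    refine (hf.const_mul (R ^ (p - 2))).mono (hcont.aestronglyMeasurable measurableSet_Ici) ?_
    refine (ae_restrict_iff' measurableSet_Ici).2 (Eventually.of_forall fun x hx => ?_)
    have h1 : |f x| ^ (p - 2) ≤ R ^ (p - 2) :=
      Real.rpow_le_rpow (abs_nonneg _) (hR x hx) (by linarith)
    rw [norm_mul, norm_mul, Real.norm_of_nonneg (by positivity : (0 : ℝ) ≤ |f x| ^ (p - 2)),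
      Real.norm_of_nonneg ((by positivity : (0 : ℝ) ≤ |f x| ^ (p - 2)).trans h1)]
    exact mul_le_mul_of_nonneg_right h1 (norm_nonneg _)
  have hderiv : MemLp (deriv f) 2 (volume.restrict (Ici 0)) :=
    hw.ae_eq ((ae_restrict_iff' measurableSet_Ici).2
      (Eventually.of_forall fun x hx => (h x hx).1.deriv.symm))
  have hint : IntegrableOn
      (fun x => deriv f x * deriv η x + f x * η x - |f x| ^ (p - 2) * f x * η x) (Ici 0) :=
    ((hderiv.integrable_mul hη2).add (hf.integrable_mul hη1)).sub (hnl.integrable_mul hη1)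
  have hlim := intervalIntegral_tendsto_integral_Ioi 0 (hint.mono_set Ioi_subset_Ici_self) tendsto_id
  rw [integral_Ici_eq_integral_Ioi]
  set I := ∫ x in Ioi 0, (deriv f x * deriv η x + f x * η x - |f x| ^ (p - 2) * f x * η x)
  have hbd : Tendsto (fun b => w b * η b) atTop (nhds (I + w 0 * η 0)) := by
    refine (hlim.add_const (w 0 * η 0)).congr' ?_
    filter_upwards [eventually_ge_atTop 0] with b hb
    have := (h.mono Icc_subset_Ici_self).integral_weak hp hb (hη b hb)
    rw [integral_Icc_eq_integral_Ioc, ← intervalIntegral.integral_of_le hb] at this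
    simp only [id]
    rw [this]; ring
  -- The boundary term w η has a limit at infinity and is integrable, so the limit is 0.
  have hz : I + w 0 * η 0 = 0 := by
    refine IntegrableAtFilter.eq_zero_of_tendsto (μ := volume) (l := atTop)
      ⟨Ici 0, Ici_mem_atTop 0, hw.integrable_mul hη1⟩ ?_ hbd
    intro s hs
    obtain ⟨b, hb⟩ := mem_atTop_sets.1 hs
    rw [← top_le_iff, ← Real.volume_Ici (a := b)]
    exact measure_mono hb
  linarith

/-- Classical solutions on the edges that satisfy the vertex conditions form a bound-state. -/
theorem isBoundState_of_solvesOn (hp : 2 < p) (hℓ : 0 < ℓ) {u w : GraphFun H P L} {c R : ℝ}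
    (hc : c ≠ 0) (hne : Nonempty (Edge H P L)) (hsol : ∀ e, SolvesOn p (dom ℓ e) (u e) (w e))
    (hu0 : ∀ e, u e 0 = c) (huL : ∀ j, u (.inr (.inr j)) (2 * ℓ) = c)
    (hbd : ∀ i : Fin H, ∀ x ∈ Ici (0 : ℝ), |u (.inl i) x| ≤ R)
    (hL2 : ∀ i : Fin H, MemLp (u (.inl i)) 2 (volume.restrict (Ici 0)))
    (hL2' : ∀ i : Fin H, MemLp (w (.inl i)) 2 (volume.restrict (Ici 0)))
    (hend : ∀ i, w (.inr (.inl i)) ℓ = 0)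
    (hkir : ∑ i, w (.inl i) 0 + (∑ i, w (.inr (.inl i)) 0 +
      ∑ j, (w (.inr (.inr j)) 0 - w (.inr (.inr j)) (2 * ℓ))) = 0) :
    IsBoundState p ℓ u := by
  have hac : ∀ e, ∀ b ∈ dom ℓ e, AbsolutelyContinuousOnInterval (u e) 0 b := fun e b hb =>
    (((hsol e).mono (Icc_subset_dom hb)).ac hp (nonneg_of_mem_dom hb)).1
  have hcpt : ∀ e : Edge H P L, ∀ b, dom ℓ e = Icc 0 b → MemH1Edge ℓ e (u e) := by
    intro e b hb
    have hd : ∀ x ∈ dom ℓ e, deriv (u e) x = w e x := fun x hx => (hsol e x hx).1.deriv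
    have hm : ∀ g : ℝ → ℝ, ContinuousOn g (dom ℓ e) → MemLp g 2 (volume.restrict (dom ℓ e)) := by
      intro g hg
      rw [hb] at hg ⊢
      obtain ⟨C, hC⟩ := isCompact_Icc.exists_bound_of_continuousOn hg
      exact MemLp.of_bound (hg.aestronglyMeasurable measurableSet_Icc) C
        ((ae_restrict_iff' measurableSet_Icc).2 (Eventually.of_forall hC))
    exact ⟨hac e, hm _ (hsol e).continuousOn, (hm _ (hsol e).continuousOn_deriv).ae_eq
      ((ae_restrict_iff' (measurableSet_dom e)).2 (Eventually.of_forall fun x hx => (hd x hx).symm))⟩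
  refine ⟨⟨?_, c, hu0, huL⟩, ⟨hne.some, 0, zero_mem_dom hℓ.le _, by rwa [hu0]⟩, ?_⟩
  · rintro (i | i | i)
    · exact ⟨hac _, hL2 i, (hL2' i).ae_eq ((ae_restrict_iff' measurableSet_Ici).2
        (Eventually.of_forall fun x hx => (hsol (.inl i) x hx).1.deriv.symm))⟩
    · exact hcpt _ ℓ rfl
    · exact hcpt _ (2 * ℓ) rfl
  · rintro η ⟨hη, d, hd0, hdL⟩
    rw [graphIntegral, Fintype.sum_sum_type, Fintype.sum_sum_type]
    have h1 : ∀ i : Fin H, ∫ x in dom ℓ (.inl i : Edge H P L), (deriv (u (.inl i)) x *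
        deriv (η (.inl i)) x + u (.inl i) x * η (.inl i) x -
        |u (.inl i) x| ^ (p - 2) * u (.inl i) x * η (.inl i) x) = -(w (.inl i) 0 * d) := fun i => by
      rw [← hd0 (.inl i)]
      exact (hsol (.inl i)).integral_weak_Ici hp (hbd i) (hL2 i) (hL2' i) (hη (.inl i)).1
        (hη (.inl i)).2.1 (hη (.inl i)).2.2
    have h2 : ∀ i : Fin P, ∫ x in dom ℓ (.inr (.inl i) : Edge H P L), (deriv (u (.inr (.inl i))) x *
        deriv (η (.inr (.inl i))) x + u (.inr (.inl i)) x * η (.inr (.inl i)) x -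
        |u (.inr (.inl i)) x| ^ (p - 2) * u (.inr (.inl i)) x * η (.inr (.inl i)) x) =
        -(w (.inr (.inl i)) 0 * d) := fun i => by
      have := (hsol (.inr (.inl i))).integral_weak hp hℓ.le
        ((hη (.inr (.inl i))).1 ℓ (right_mem_Icc.2 hℓ.le))
      rw [hend, hd0] at this
      refine this.trans ?_
      ring
    have h3 : ∀ i : Fin L, ∫ x in dom ℓ (.inr (.inr i) : Edge H P L), (deriv (u (.inr (.inr i))) x *
        deriv (η (.inr (.inr i))) x + u (.inr (.inr i)) x * η (.inr (.inr i)) x -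
        |u (.inr (.inr i)) x| ^ (p - 2) * u (.inr (.inr i)) x * η (.inr (.inr i)) x) =
        -((w (.inr (.inr i)) 0 - w (.inr (.inr i)) (2 * ℓ)) * d) := fun i => by
      have h2ℓ : 0 ≤ 2 * ℓ := by linarith
      have := (hsol (.inr (.inr i))).integral_weak hp h2ℓ
        ((hη (.inr (.inr i))).1 (2 * ℓ) (right_mem_Icc.2 h2ℓ))
      rw [hd0, hdL] at this
      refine this.trans ?_
      ring
    simp_rw [h1, h2, h3, Finset.sum_neg_distrib, ← Finset.sum_mul]
    -- Every boundary term is a slope times the common vertex value d of the test function; the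
    -- Kirchhoff condition cancels their sum.
    linear_combination (-d) * hkir

/-! ### Small solutions -/

/-- The mass of a small nonnegative solution is controlled by its slopes at the ends. -/
lemma SolvesOn.integral_rpow_le (hp : 2 < p) {f w : ℝ → ℝ} {b c : ℝ} (hb : 0 ≤ b)
    (h : SolvesOn p (Icc 0 b) f w) (hc0 : 0 ≤ c) (hc1 : c < 1)
    (hf : ∀ x ∈ Icc 0 b, 0 ≤ f x ∧ f x ≤ c) :
    ∫ x in (0 : ℝ)..b, |f x| ^ p ≤ c ^ (p - 1) * (w b - w 0) / (1 - c ^ (p - 2)) := by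
  have hcp : c ^ (p - 2) < 1 := Real.rpow_lt_one hc0 hc1 (by linarith)
  have hcont : ContinuousOn f (uIcc 0 b) := by rw [uIcc_of_le hb]; exact h.continuousOn
  have hnl : IntervalIntegrable (fun x => nl p (f x)) volume 0 b :=
    ((continuous_nl hp).comp_continuousOn hcont).intervalIntegrable
  have hftc := intervalIntegral.integral_eq_sub_of_hasDerivAt
    (fun x hx => (h x (by rwa [uIcc_of_le hb] at hx)).2) hnl
  rw [le_div_iff₀ (by linarith), ← hftc, ← intervalIntegral.integral_const_mul,
    ← intervalIntegral.integral_mul_const]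
  refine intervalIntegral.integral_mono_on hb
    ((((continuous_abs_rpow hp).comp_continuousOn hcont)).intervalIntegrable.mul_const _)
    (hnl.const_mul _) fun x hx => ?_
  obtain ⟨h0, h1⟩ := hf x hx
  -- For 0 ≤ f ≤ c one has f^p ≤ c^(p-1) f and (1 - c^(p-2)) f ≤ f'', and f'' integrates to the
  -- difference of the end slopes.
  have e1 : f x ^ (p - 2) ≤ c ^ (p - 2) := Real.rpow_le_rpow h0 h1 (by linarith)
  have e2 : f x ^ (p - 1) ≤ c ^ (p - 1) := Real.rpow_le_rpow h0 h1 (by linarith)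
  have e3 : f x ^ p = f x ^ (p - 1) * f x := by
    rw [← Real.rpow_add_one' h0 (by linarith)]; congr 1; ring
  rw [nl_eq, abs_of_nonneg h0, e3]
  have e4 : f x ^ (p - 1) * f x ≤ c ^ (p - 1) * f x := mul_le_mul_of_nonneg_right e2 h0
  calc f x ^ (p - 1) * f x * (1 - c ^ (p - 2)) ≤ c ^ (p - 1) * f x * (1 - c ^ (p - 2)) :=
        mul_le_mul_of_nonneg_right e4 (by linarith)
    _ = c ^ (p - 1) * (f x * (1 - c ^ (p - 2))) := by ring
    _ ≤ _ := by
      apply mul_le_mul_of_nonneg_left _ (by positivity)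
      exact mul_le_mul_of_nonneg_left (by linarith) h0

/-! ### The soliton -/

/-- The soliton `peak p * cosh ((p - 2) / 2 * x + b) ^ (-2 / (p - 2))`. -/
def soliton (p b x : ℝ) : ℝ :=
  peak p * Real.cosh ((p - 2) / 2 * x + b) ^ (-(2 / (p - 2)))

/-- The derivative of the soliton. -/
def solitonDeriv (p b x : ℝ) : ℝ :=
  -(soliton p b x * (Real.sinh ((p - 2) / 2 * x + b) / Real.cosh ((p - 2) / 2 * x + b)))

lemma soliton_pos (hp : 2 < p) (b x : ℝ) : 0 < soliton p b x :=
  mul_pos (peak_pos hp) (Real.rpow_pos_of_pos (Real.cosh_pos _) _)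

lemma hasDerivAt_soliton (hp : 2 < p) (b x : ℝ) :
    HasDerivAt (soliton p b) (solitonDeriv p b x) x := by
  have h1 : HasDerivAt (fun x => (p - 2) / 2 * x + b) ((p - 2) / 2) x := by
    simpa using ((hasDerivAt_id x).const_mul ((p - 2) / 2)).add_const b
  have h2 := ((h1.cosh).rpow_const (p := -(2 / (p - 2)))
    (Or.inl (Real.cosh_pos _).ne')).const_mul (peak p)
  convert! h2 using 1
  have hc := Real.cosh_pos ((p - 2) / 2 * x + b)
  have : p - 2 ≠ 0 := by linarith
  rw [solitonDeriv, soliton, Real.rpow_sub_one hc.ne']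
  field_simp

lemma soliton_rpow (hp : 2 < p) (b x : ℝ) :
    soliton p b x ^ (p - 2) = p / 2 / Real.cosh ((p - 2) / 2 * x + b) ^ 2 := by
  have hc := Real.cosh_pos ((p - 2) / 2 * x + b)
  have : p - 2 ≠ 0 := by linarith
  rw [soliton, Real.mul_rpow (peak_pos hp).le (by positivity), peak_rpow hp,
    ← Real.rpow_mul hc.le]
  rw [show -(2 / (p - 2)) * (p - 2) = -(2 : ℕ) by field_simp; norm_num, Real.rpow_neg hc.le,
    Real.rpow_natCast, ← div_eq_mul_inv]

lemma hasDerivAt_solitonDeriv (hp : 2 < p) (b x : ℝ) :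
    HasDerivAt (solitonDeriv p b) (nl p (soliton p b x)) x := by
  have h1 : HasDerivAt (fun x => (p - 2) / 2 * x + b) ((p - 2) / 2) x := by
    simpa using ((hasDerivAt_id x).const_mul ((p - 2) / 2)).add_const b
  have hc := Real.cosh_pos ((p - 2) / 2 * x + b)
  have h2 := ((hasDerivAt_soliton hp b x).mul (h1.sinh.div h1.cosh hc.ne')).neg
  convert! h2 using 1
  rw [nl_eq, abs_of_pos (soliton_pos hp b x), soliton_rpow hp, solitonDeriv]
  have hsc := Real.cosh_sq ((p - 2) / 2 * x + b)
  simp only [Pi.div_apply]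
  generalize Real.cosh ((p - 2) / 2 * x + b) = C at *
  generalize Real.sinh ((p - 2) / 2 * x + b) = S at *
  have : S ^ 2 = C ^ 2 - 1 := by linarith
  field_simp
  rw [this]; ring

lemma solvesOn_soliton (hp : 2 < p) (b : ℝ) (s : Set ℝ) :
    SolvesOn p s (soliton p b) (solitonDeriv p b) :=
  fun x _ => ⟨hasDerivAt_soliton hp b x, hasDerivAt_solitonDeriv hp b x⟩

lemma abs_solitonDeriv_le (hp : 2 < p) (b x : ℝ) : |solitonDeriv p b x| ≤ soliton p b x := by
  have hc := Real.cosh_pos ((p - 2) / 2 * x + b)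
  rw [solitonDeriv, abs_neg, abs_mul, abs_of_pos (soliton_pos hp b x)]
  refine mul_le_of_le_one_right (soliton_pos hp b x).le ?_
  rw [abs_div, abs_of_pos hc, div_le_one hc]
  exact abs_le_of_sq_le_sq (by linarith [Real.cosh_sq ((p - 2) / 2 * x + b)]) hc.le

lemma memLp_soliton (hp : 2 < p) {b : ℝ} (hb : 0 ≤ b) :
    MemLp (soliton p b) 2 (volume.restrict (Ici 0)) := by
  have hp2 : 0 < p - 2 := by linarith
  have hexp : MemLp (fun x : ℝ => Real.exp (-x)) 2 (volume.restrict (Ici 0)) := by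
    rw [memLp_two_iff_integrable_sq (by fun_prop)]
    have h1 : IntegrableOn (fun x : ℝ => Real.exp (-2 * x)) (Ioi 0) :=
      integrableOn_exp_mul_Ioi (by norm_num) 0
    have h2 : IntegrableOn (fun x : ℝ => Real.exp (-2 * x)) (Ici 0) :=
      (integrableOn_Ici_iff_integrableOn_Ioi (by simp)).2 h1
    refine h2.congr (Eventually.of_forall fun x => ?_)
    simp only
    rw [sq, ← Real.exp_add]; ring_nf
  have hcont : Continuous (soliton p b) :=
    continuous_iff_continuousAt.2 fun x => (hasDerivAt_soliton hp b x).continuousAt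
  refine (hexp.const_mul (peak p * 2 ^ (2 / (p - 2)))).mono hcont.aestronglyMeasurable ?_
  refine (ae_restrict_iff' measurableSet_Ici).2 (Eventually.of_forall fun x hx => ?_)
  have hx0 : 0 ≤ x := hx
  rw [Real.norm_of_nonneg (soliton_pos hp b x).le,
    Real.norm_of_nonneg (by have := peak_pos hp; positivity), soliton, mul_assoc]
  refine mul_le_mul_of_nonneg_left ?_ (peak_pos hp).le
  have hc : Real.exp ((p - 2) / 2 * x) / 2 ≤ Real.cosh ((p - 2) / 2 * x + b) := by
    rw [Real.cosh_eq]
    have h1 : Real.exp ((p - 2) / 2 * x) ≤ Real.exp ((p - 2) / 2 * x + b) :=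
      Real.exp_le_exp.2 (by linarith)
    have h2 := Real.exp_pos (-((p - 2) / 2 * x + b))
    linarith
  calc Real.cosh ((p - 2) / 2 * x + b) ^ (-(2 / (p - 2)))
      ≤ (Real.exp ((p - 2) / 2 * x) / 2) ^ (-(2 / (p - 2))) :=
        Real.rpow_le_rpow_of_nonpos (by positivity) hc (by simp; positivity)
    _ = 2 ^ (2 / (p - 2)) * Real.exp (-x) := by
      rw [Real.div_rpow (Real.exp_pos _).le two_pos.le, ← Real.exp_mul, Real.rpow_neg two_pos.le,
        div_inv_eq_mul, mul_comm]
      congr 2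
      field_simp

/-- The decreasing half-line solution that starts at a small height `c`. -/
lemma exists_half_line (hp : 2 < p) {c : ℝ} (hc0 : 0 < c) (hc1 : c < 1) :
    ∃ Y w : ℝ → ℝ, SolvesOn p (Ici 0) Y w ∧ Y 0 = c ∧ w 0 = -speed p c ∧
      (∀ x ∈ Ici (0 : ℝ), |Y x| ≤ c) ∧ MemLp Y 2 (volume.restrict (Ici 0)) ∧
      MemLp w 2 (volume.restrict (Ici 0)) ∧
      ∫ x in Ici 0, |Y x| ^ p ≤ c ^ (p - 1) * c / (1 - c ^ (p - 2)) := by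
  have hp2 : 0 < p - 2 := by linarith
  have hpk := peak_pos hp
  have hq : 1 ≤ peak p / c := by
    rw [one_le_div hc0]; linarith [one_lt_peak hp]
  -- The phase at which the soliton has height c on its decreasing side, b ≥ 0.
  set b := Real.arcosh ((peak p / c) ^ ((p - 2) / 2)) with hbdef
  have h1 : 1 ≤ (peak p / c) ^ ((p - 2) / 2) := Real.one_le_rpow hq (by positivity)
  have hb : 0 ≤ b := Real.arcosh_nonneg h1
  have hY0 : soliton p b 0 = c := by
    rw [soliton, mul_zero, zero_add, hbdef, Real.cosh_arcosh h1, ← Real.rpow_mul (by positivity),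
      show (p - 2) / 2 * -(2 / (p - 2)) = -1 by field_simp, Real.rpow_neg_one]
    field_simp
  have hw : ∀ x, 0 ≤ x → solitonDeriv p b x ≤ 0 := by
    intro x hx
    have hs : 0 ≤ Real.sinh ((p - 2) / 2 * x + b) := Real.sinh_nonneg_iff.2 (by positivity)
    have := soliton_pos hp b x
    have := Real.cosh_pos ((p - 2) / 2 * x + b)
    rw [solitonDeriv]
    simp only [Left.neg_nonpos_iff]
    positivity
  have hsol := solvesOn_soliton hp b (Ici 0)
  have hanti : AntitoneOn (soliton p b) (Ici 0) :=
    antitoneOn_of_hasDerivWithinAt_nonpos (convex_Ici 0) hsol.continuousOn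
      (fun x _ => (hasDerivAt_soliton hp b x).hasDerivWithinAt) fun x hx => by
        rw [interior_Ici] at hx; exact hw x (le_of_lt hx)
  have hle : ∀ x ∈ Ici (0 : ℝ), |soliton p b x| ≤ c := by
    intro x hx
    rw [abs_of_pos (soliton_pos hp b x), ← hY0]
    exact hanti self_mem_Ici hx hx
  have hL2 := memLp_soliton hp hb
  have hwc : Continuous (solitonDeriv p b) :=
    continuous_iff_continuousAt.2 fun x => (hasDerivAt_solitonDeriv hp b x).continuousAt
  have hL2' : MemLp (solitonDeriv p b) 2 (volume.restrict (Ici 0)) := by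
    refine hL2.mono hwc.aestronglyMeasurable (Eventually.of_forall fun x => ?_)
    rw [Real.norm_eq_abs, Real.norm_of_nonneg (soliton_pos hp b x).le]
    exact abs_solitonDeriv_le hp b x
  have hd2 : MemLp (deriv (soliton p b)) 2 (volume.restrict (Ici 0)) := by
    have : deriv (soliton p b) = solitonDeriv p b := by
      ext x; exact (hasDerivAt_soliton hp b x).deriv
    rwa [this]
  have hw0 : solitonDeriv p b 0 = -speed p c := by
    have h2 := hsol.classicalOn.sq_eq_pot hp hL2 hd2 le_rfl
    rw [hY0] at h2
    rw [speed, ← h2, Real.sqrt_sq_eq_abs, abs_of_nonpos (hw 0 le_rfl), neg_neg]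
  refine ⟨soliton p b, solitonDeriv p b, hsol, hY0, hw0, hle, hL2, hL2', ?_⟩
  have hint := integrableOn_abs_rpow hp measurableSet_Ici hsol.continuousOn hL2 hle
  rw [integral_Ici_eq_integral_Ioi]
  refine le_of_tendsto (intervalIntegral_tendsto_integral_Ioi 0
    (hint.mono_set Ioi_subset_Ici_self) tendsto_id) ?_
  filter_upwards [eventually_ge_atTop 0] with x hx
  refine ((hsol.mono Icc_subset_Ici_self).integral_rpow_le hp hx hc0.le hc1 fun y hy =>
    ⟨(soliton_pos hp b y).le, (le_abs_self _).trans (hle y hy.1)⟩).trans ?_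
  have h3 : c ^ (p - 2) < 1 := Real.rpow_lt_one hc0.le hc1 hp2
  have h4 := speed_le_abs hp c
  rw [abs_of_pos hc0] at h4
  apply div_le_div_of_nonneg_right _ (by linarith)
  apply mul_le_mul_of_nonneg_left _ (by positivity)
  rw [hw0]
  linarith [hw x hx]

end

end SingleKnot

namespace SingleKnot

noncomputable section

open scoped NNReal

variable {p : ℝ}

/-! ### A truncated flow -/

/-- A bounded Lipschitz vector field on the plane has a global continuous flow. -/
lemma exists_flow {X : ℝ × ℝ → ℝ × ℝ} {K B : ℝ≥0} (hX : LipschitzWith K X) (hB : ∀ x, ‖X x‖ ≤ B)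
    {T r : ℝ} (hT : 0 < T) (hr : 0 ≤ r) :
    ∃ Φ : ℝ × ℝ → ℝ → ℝ × ℝ, Continuous (fun q : (ℝ × ℝ) × ℝ => Φ q.1 q.2) ∧
      ∀ x, |x.1| ≤ r → |x.2| ≤ r → Φ x 0 = x ∧
        ∀ t ∈ Ioo (-T) T, HasDerivAt (Φ x) (X (Φ x t)) t := by
  have hTT : -T ≤ T := by linarith
  have hpl : IsPicardLindelof (fun _ => X) (tmin := -T) (tmax := T)
      ⟨0, by linarith, hT.le⟩ (0 : ℝ × ℝ) (r.toNNReal + B * T.toNNReal) r.toNNReal B K := by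
    refine ⟨fun t _ => hX.lipschitzOnWith, fun x _ => continuousOn_const, fun t _ x _ => hB x, ?_⟩
    change (B : ℝ) * max (T - 0) (0 - -T) ≤
      ((r.toNNReal + B * T.toNNReal : ℝ≥0) : ℝ) - (r.toNNReal : ℝ)
    rw [sub_zero, zero_sub, neg_neg, max_self]
    push_cast
    rw [Real.coe_toNNReal T hT.le]
    linarith
  obtain ⟨α, hα, hαc⟩ := hpl.exists_forall_mem_closedBall_eq_hasDerivWithinAt_continuousOn
  -- Picard-Lindelöf gives continuity only on a ball of data and a time interval. Clamping both
  -- makes the flow continuous everywhere without changing it where it is used.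
  set ρ : ℝ → ℝ := fun x => max (-r) (min r x) with hρ
  have hρr : ∀ x, |ρ x| ≤ r := fun x =>
    abs_le.2 ⟨le_max_left _ _, max_le (by linarith) (min_le_left _ _)⟩
  have hρid : ∀ x, |x| ≤ r → ρ x = x := fun x hx => by
    rw [hρ]; simp only; rw [min_eq_right (abs_le.1 hx).2, max_eq_right (abs_le.1 hx).1]
  have hball : ∀ x : ℝ × ℝ, (ρ x.1, ρ x.2) ∈ Metric.closedBall (0 : ℝ × ℝ) r.toNNReal := fun x => by
    rw [mem_closedBall_zero_iff, Real.coe_toNNReal r hr, Prod.norm_def]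
    exact max_le (hρr _) (hρr _)
  have hρc : Continuous ρ := by fun_prop
  refine ⟨fun x t => α ((ρ x.1, ρ x.2), (projIcc (-T) T hTT t : ℝ)), ?_, fun x h1 h2 => ?_⟩
  · refine hαc.comp_continuous ?_ fun q => ⟨hball q.1, (projIcc (-T) T hTT q.2).2⟩
    have : Continuous fun t : ℝ => (projIcc (-T) T hTT t : ℝ) :=
      continuous_subtype_val.comp continuous_projIcc
    fun_prop
  · have hx : (ρ x.1, ρ x.2) = x := by rw [hρid _ h1, hρid _ h2]
    have hb := hball x
    rw [hx] at hb
    simp only [hx]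
    obtain ⟨h0, hd⟩ := hα x hb
    constructor
    · rw [projIcc_of_mem hTT ⟨by linarith, hT.le⟩]; exact h0
    · intro t ht
      have h3 := (hd t (Ioo_subset_Icc_self ht)).hasDerivAt (Icc_mem_nhds ht.1 ht.2)
      rw [projIcc_of_mem hTT (Ioo_subset_Icc_self ht)]
      refine h3.congr_of_eventuallyEq ?_
      filter_upwards [Icc_mem_nhds ht.1 ht.2] with s hs
      rw [projIcc_of_mem hTT hs]

/-! ### The truncated field and its trajectories -/

/-- Truncation to `[-R, R]`. -/
def clampSym (R z : ℝ) : ℝ := max (-R) (min R z)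

/-- Truncation to `[0, R]`. -/
def clampPos (R y : ℝ) : ℝ := max 0 (min R y)

/-- The nonlinearity, frozen outside `[0, R]`. -/
def nlTrunc (p R y : ℝ) : ℝ := clampPos R y - clampPos R y ^ (p - 1)

lemma clampSym_of_abs_le {R z : ℝ} (h : |z| ≤ R) : clampSym R z = z := by
  rw [clampSym, min_eq_right (abs_le.1 h).2, max_eq_right (abs_le.1 h).1]

lemma clampSym_neg {R : ℝ} (hR : 0 ≤ R) (z : ℝ) : clampSym R (-z) = -clampSym R z := by
  unfold clampSym
  grind

lemma clampPos_mem {R : ℝ} (hR : 0 ≤ R) (y : ℝ) : clampPos R y ∈ Icc 0 R :=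
  ⟨le_max_left _ _, max_le hR (min_le_left _ _)⟩

lemma clampPos_of_mem {R y : ℝ} (h : y ∈ Icc 0 R) : clampPos R y = y := by
  rw [clampPos, min_eq_right h.2, max_eq_right h.1]

lemma lipschitzWith_clampSym (R : ℝ) : LipschitzWith 1 (clampSym R) :=
  (LipschitzWith.id.const_min R).const_max (-R)

lemma lipschitzWith_clampPos (R : ℝ) : LipschitzWith 1 (clampPos R) :=
  (LipschitzWith.id.const_min R).const_max 0

lemma nl_eq_of_nonneg (hp : 2 < p) {y : ℝ} (hy : 0 ≤ y) : nl p y = y - y ^ (p - 1) := by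
  rw [nl, abs_of_nonneg hy, ← Real.rpow_add_one' hy (by linarith)]
  ring_nf

lemma nlTrunc_eq (hp : 2 < p) {R : ℝ} (hR : 0 ≤ R) (y : ℝ) :
    nlTrunc p R y = nl p (clampPos R y) := by
  rw [nlTrunc, nl_eq_of_nonneg hp (clampPos_mem hR y).1]

lemma nlTrunc_of_mem (hp : 2 < p) {R y : ℝ} (h : y ∈ Icc 0 R) : nlTrunc p R y = nl p y := by
  rw [nlTrunc_eq hp (h.1.trans h.2), clampPos_of_mem h]

lemma exists_lipschitzWith_nlTrunc (hp : 2 < p) {R : ℝ} (hR : 0 ≤ R) :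
    ∃ K, LipschitzWith K (nlTrunc p R) := by
  have h1 : ContDiff ℝ 1 fun y : ℝ => y - y ^ (p - 1) :=
    contDiff_id.sub (by exact_mod_cast Real.contDiff_rpow_const_of_le (n := 1) (by simp; linarith))
  obtain ⟨K, hK⟩ := h1.contDiffOn.exists_lipschitzOnWith (by decide) (convex_Icc 0 R) isCompact_Icc
  refine ⟨K * 1, ?_⟩
  rw [← lipschitzOnWith_univ]
  exact hK.comp (lipschitzWith_clampPos R).lipschitzOnWith fun y _ => clampPos_mem hR y

/-- The truncated Hamiltonian vector field. -/
def truncField (p R : ℝ) (x : ℝ × ℝ) : ℝ × ℝ := (clampSym R x.2, nlTrunc p R x.1)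

lemma exists_lipschitzWith_truncField (hp : 2 < p) {R : ℝ} (hR : 0 ≤ R) :
    ∃ K, LipschitzWith K (truncField p R) := by
  obtain ⟨K, hK⟩ := exists_lipschitzWith_nlTrunc hp hR
  exact ⟨_, ((lipschitzWith_clampSym R).comp LipschitzWith.prod_snd).prodMk
    (hK.comp LipschitzWith.prod_fst)⟩

lemma exists_norm_truncField_le (hp : 2 < p) {R : ℝ} (hR : 0 ≤ R) :
    ∃ B : ℝ≥0, ∀ x, ‖truncField p R x‖ ≤ B := by
  obtain ⟨C, hC⟩ := isCompact_Icc.exists_bound_of_continuousOn (s := Icc 0 R)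
    (continuous_nl hp).continuousOn
  refine ⟨(max R C).toNNReal, fun x => ?_⟩
  refine le_trans ?_ (Real.le_coe_toNNReal _)
  rw [Prod.norm_def]
  refine max_le_max ?_ ?_
  · exact abs_le.2 ⟨le_max_left _ _, max_le (by linarith) (min_le_left _ _)⟩
  · simp only [truncField]
    rw [nlTrunc_eq hp hR]
    exact hC _ (clampPos_mem hR _)

/-- A trajectory of the truncated field on the open interval `I`. -/
def IsTrajectory (p R : ℝ) (I : Set ℝ) (y z : ℝ → ℝ) : Prop :=
  ∀ t ∈ I, HasDerivAt y (clampSym R (z t)) t ∧ HasDerivAt z (nlTrunc p R (y t)) t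

/-- The truncated flow, in coordinates. -/
lemma exists_truncFlow (hp : 2 < p) {R T : ℝ} (hR : 0 ≤ R) (hT : 0 < T) :
    ∃ Y Z : ℝ × ℝ → ℝ → ℝ, Continuous (fun q : (ℝ × ℝ) × ℝ => Y q.1 q.2) ∧
      Continuous (fun q : (ℝ × ℝ) × ℝ => Z q.1 q.2) ∧
      ∀ a b, |a| ≤ R → |b| ≤ R → Y (a, b) 0 = a ∧ Z (a, b) 0 = b ∧
        IsTrajectory p R (Ioo (-T) T) (Y (a, b)) (Z (a, b)) := by
  obtain ⟨K, hK⟩ := exists_lipschitzWith_truncField hp hR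
  obtain ⟨B, hB⟩ := exists_norm_truncField_le hp hR
  obtain ⟨Φ, hΦ, h⟩ := exists_flow hK hB hT hR
  refine ⟨fun x t => (Φ x t).1, fun x t => (Φ x t).2, hΦ.fst, hΦ.snd, fun a b ha hb => ?_⟩
  obtain ⟨h0, hd⟩ := h (a, b) ha hb
  refine ⟨by simp only [h0], by simp only [h0], fun t ht => ?_⟩
  exact ⟨(hd t ht).fst, (hd t ht).snd⟩

/-- Trajectories through a common point coincide. -/
lemma IsTrajectory.unique (hp : 2 < p) {R a b t₀ : ℝ} (hR : 0 ≤ R) {y z y' z' : ℝ → ℝ}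
    (h : IsTrajectory p R (Ioo a b) y z) (h' : IsTrajectory p R (Ioo a b) y' z')
    (ht₀ : t₀ ∈ Ioo a b) (hy : y t₀ = y' t₀) (hz : z t₀ = z' t₀) :
    ∀ t ∈ Ioo a b, y t = y' t ∧ z t = z' t := by
  obtain ⟨K, hK⟩ := exists_lipschitzWith_truncField hp hR
  have := ODE_solution_unique_of_mem_Ioo (v := fun _ => truncField p R) (s := fun _ => univ)
    (K := K) (f := fun t => (y t, z t)) (g := fun t => (y' t, z' t))
    (fun t _ => hK.lipschitzOnWith) ht₀ (fun t ht => ⟨(h t ht).1.prodMk (h t ht).2, mem_univ _⟩)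
    (fun t ht => ⟨(h' t ht).1.prodMk (h' t ht).2, mem_univ _⟩) (by simp [hy, hz])
  intro t ht
  simpa using this ht

/-- A trajectory with zero slope at `t₀` is symmetric about `t₀`. -/
lemma IsTrajectory.reflect (hp : 2 < p) {R t₀ d : ℝ} (hR : 0 ≤ R) {y z : ℝ → ℝ} (hd : 0 < d)
    (h : IsTrajectory p R (Ioo (t₀ - d) (t₀ + d)) y z) (hz : z t₀ = 0) :
    ∀ t ∈ Ioo (t₀ - d) (t₀ + d), y (2 * t₀ - t) = y t ∧ z (2 * t₀ - t) = -z t := by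
  have h' : IsTrajectory p R (Ioo (t₀ - d) (t₀ + d)) (fun t => y (2 * t₀ - t))
      (fun t => -z (2 * t₀ - t)) := by
    intro t ht
    have ht' : 2 * t₀ - t ∈ Ioo (t₀ - d) (t₀ + d) := ⟨by linarith [ht.2], by linarith [ht.1]⟩
    have hs : HasDerivAt (fun t : ℝ => 2 * t₀ - t) (-1) t := by
      simpa using (hasDerivAt_id t).const_sub (2 * t₀)
    have h1 := (h _ ht').1.comp t hs
    have h2 := ((h _ ht').2.comp t hs).neg
    refine ⟨?_, ?_⟩
    · convert! h1 using 1
      rw [clampSym_neg hR]; ring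
    · convert! h2 using 1
      ring
  intro t ht
  have := h'.unique hp hR h (t₀ := t₀) ⟨by linarith, by linarith⟩
    (by rw [show 2 * t₀ - t₀ = t₀ by ring])
    (by rw [show 2 * t₀ - t₀ = t₀ by ring, hz, neg_zero]) t ht
  exact ⟨this.1, by linarith [this.2]⟩

/-! ### Conserved energy and confinement of trajectories -/

/-- Twice the truncated kinetic energy. -/
def kinTrunc (R z : ℝ) : ℝ := ∫ s in (0 : ℝ)..z, 2 * clampSym R s

/-- The truncated potential. -/
def potTrunc (p R y : ℝ) : ℝ := ∫ s in (0 : ℝ)..y, 2 * nlTrunc p R s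

lemma continuous_clampSym (R : ℝ) : Continuous (clampSym R) := (lipschitzWith_clampSym R).continuous

lemma continuous_nlTrunc (hp : 2 < p) {R : ℝ} (hR : 0 ≤ R) : Continuous (nlTrunc p R) :=
  (exists_lipschitzWith_nlTrunc hp hR).choose_spec.continuous

lemma hasDerivAt_primitive {g : ℝ → ℝ} (hg : Continuous g) (x : ℝ) :
    HasDerivAt (fun x => ∫ s in (0 : ℝ)..x, g s) (g x) x :=
  intervalIntegral.integral_hasDerivAt_right (hg.intervalIntegrable _ _)
    (hg.stronglyMeasurableAtFilter _ _) hg.continuousAt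

lemma IsTrajectory.conserved (hp : 2 < p) {R T : ℝ} (hR : 0 ≤ R) {y z : ℝ → ℝ}
    (h : IsTrajectory p R (Ioo (-T) T) y z) {t : ℝ} (ht : t ∈ Ioo (-T) T) :
    kinTrunc R (z t) - potTrunc p R (y t) = kinTrunc R (z 0) - potTrunc p R (y 0) := by
  have h0 : (0 : ℝ) ∈ Ioo (-T) T := ⟨by linarith [ht.1, ht.2], by linarith [ht.1, ht.2]⟩
  have hsub : uIcc 0 t ⊆ Ioo (-T) T := ordConnected_Ioo.uIcc_subset h0 ht
  have := intervalIntegral.integral_eq_sub_of_hasDerivAt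
    (f := fun t => kinTrunc R (z t) - potTrunc p R (y t)) (f' := fun _ => 0) (a := 0) (b := t)
    (fun s hs => ?_) (by simp)
  · simp at this; linarith
  · have h1 := (hasDerivAt_primitive (g := fun s => 2 * clampSym R s)
      (continuous_const.mul (continuous_clampSym R)) (z s)).comp s (h s (hsub hs)).2
    have h2 := (hasDerivAt_primitive (g := fun s => 2 * nlTrunc p R s)
      (continuous_const.mul (continuous_nlTrunc hp hR)) (y s)).comp s (h s (hsub hs)).1
    convert! h1.sub h2 using 1
    ring

lemma kinTrunc_of_abs_le {R z : ℝ} (h : |z| ≤ R) : kinTrunc R z = z ^ 2 := by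
  rw [kinTrunc, intervalIntegral.integral_congr (g := fun s => 2 * s)]
  · rw [intervalIntegral.integral_const_mul, integral_id]; ring
  · intro s hs
    have hs' : |s| ≤ R := by
      rcases mem_uIcc.1 hs with hs | hs <;> rw [abs_le] at h ⊢ <;> constructor <;> linarith [hs.1, hs.2]
    simp only [clampSym_of_abs_le hs']

lemma kinTrunc_neg {R : ℝ} (hR : 0 ≤ R) (z : ℝ) : kinTrunc R (-z) = kinTrunc R z := by
  unfold kinTrunc
  have h1 := intervalIntegral.integral_comp_neg (a := 0) (b := z) (fun s => 2 * clampSym R s)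
  simp only [clampSym_neg hR, neg_zero, mul_neg, intervalIntegral.integral_neg] at h1
  rw [intervalIntegral.integral_symm (-z) 0]
  linarith

lemma sq_le_kinTrunc {R z : ℝ} (hR : 0 ≤ R) (h : R ≤ |z|) : R ^ 2 ≤ kinTrunc R z := by
  wlog hz : 0 ≤ z generalizing z
  · have := this (z := -z) (by rwa [abs_neg]) (by linarith)
    rwa [kinTrunc_neg hR] at this
  rw [abs_of_nonneg hz] at h
  have hc : Continuous fun s => 2 * clampSym R s := continuous_const.mul (continuous_clampSym R)
  rw [kinTrunc, ← intervalIntegral.integral_add_adjacent_intervals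
    (hc.intervalIntegrable 0 R) (hc.intervalIntegrable R z)]
  have h1 : ∫ s in (0 : ℝ)..R, 2 * clampSym R s = R ^ 2 :=
    kinTrunc_of_abs_le (abs_of_nonneg hR).le
  have h2 : 0 ≤ ∫ s in R..z, 2 * clampSym R s := by
    refine intervalIntegral.integral_nonneg h fun s hs => ?_
    rw [clampSym, min_eq_left hs.1]
    have : R ≤ max (-R) R := le_max_right _ _
    linarith
  linarith

lemma kinTrunc_nonneg {R : ℝ} (hR : 0 ≤ R) (z : ℝ) : 0 ≤ kinTrunc R z := by
  rcases le_total |z| R with h | h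
  · rw [kinTrunc_of_abs_le h]; positivity
  · exact (sq_nonneg R).trans (sq_le_kinTrunc hR h)

lemma potTrunc_of_mem (hp : 2 < p) {R y : ℝ} (h : y ∈ Icc 0 R) : potTrunc p R y = pot p y := by
  rw [potTrunc, intervalIntegral.integral_congr (g := fun s => 2 * nl p s)]
  · rw [intervalIntegral.integral_eq_sub_of_hasDerivAt (fun s _ => hasDerivAt_pot hp s)
      ((continuous_const.mul (continuous_nl hp)).intervalIntegrable _ _), pot_zero hp, sub_zero]
  · intro s hs
    rw [uIcc_of_le h.1] at hs
    simp only [nlTrunc_of_mem hp ⟨hs.1, hs.2.trans h.2⟩]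

lemma potTrunc_of_nonpos (hp : 2 < p) {R y : ℝ} (h : y ≤ 0) :
    potTrunc p R y = 0 := by
  rw [potTrunc, intervalIntegral.integral_congr (g := fun _ => 0)]
  · simp
  · intro s hs
    rw [uIcc_of_ge h] at hs
    have : clampPos R s = 0 := max_eq_left ((min_le_right _ _).trans hs.2)
    simp [nlTrunc, this, Real.zero_rpow (show p - 1 ≠ 0 by linarith)]

/-- Above R ≥ 1 the frozen nonlinearity is nonpositive, so the truncated potential cannot increase
past R. -/
lemma potTrunc_of_le (hp : 2 < p) {R y : ℝ} (hR : 1 ≤ R) (h : R ≤ y) :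
    potTrunc p R y ≤ pot p R := by
  have hR0 : 0 ≤ R := by linarith
  have hc : Continuous fun s => 2 * nlTrunc p R s :=
    continuous_const.mul (continuous_nlTrunc hp hR0)
  rw [potTrunc, ← intervalIntegral.integral_add_adjacent_intervals
    (hc.intervalIntegrable 0 R) (hc.intervalIntegrable R y)]
  have h1 : ∫ s in (0 : ℝ)..R, 2 * nlTrunc p R s = pot p R :=
    potTrunc_of_mem hp (right_mem_Icc.2 hR0)
  have h2 : ∫ s in R..y, 2 * nlTrunc p R s ≤ 0 := by
    rw [← neg_nonneg, ← intervalIntegral.integral_neg]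
    refine intervalIntegral.integral_nonneg h fun s hs => ?_
    have : clampPos R s = R := by rw [clampPos, min_eq_left hs.1, max_eq_right hR0]
    have h3 : R ≤ R ^ (p - 1) := by
      nth_rewrite 1 [← Real.rpow_one R]
      exact Real.rpow_le_rpow_of_exponent_le hR (by linarith)
    rw [nlTrunc, this]; linarith
  linarith

lemma pot_le_one (hp : 2 < p) {y : ℝ} (hy : 0 ≤ y) : pot p y ≤ 1 := by
  have := half_sq_sub_rpow_div_le hp hy
  have h2 : 0 < 1 / p := by positivity
  rw [pot, abs_of_nonneg hy]
  have : 2 / p * y ^ p = 2 * (y ^ p / p) := by ring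
  linarith

lemma potTrunc_le_one (hp : 2 < p) {R : ℝ} (hR : 1 ≤ R) (y : ℝ) : potTrunc p R y ≤ 1 := by
  rcases le_total y 0 with h | h
  · rw [potTrunc_of_nonpos hp h]; norm_num
  rcases le_total y R with h' | h'
  · rw [potTrunc_of_mem hp ⟨h, h'⟩]; exact pot_le_one hp h
  · exact (potTrunc_of_le hp hR h').trans (pot_le_one hp (by linarith))

/-- The truncation level is admissible for trajectories of energy at most `A`. -/
structure Admissible (p R A : ℝ) : Prop where
  one_le : 1 ≤ R
  lt_sq : A + 1 < R ^ 2
  pot_lt : pot p R < -A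

lemma exists_admissible (hp : 2 < p) (B : ℝ) (hB : 0 ≤ B) : ∃ R, B ≤ R ∧ Admissible p R (B ^ 2) := by
  have hp2 : 0 < p - 2 := by linarith
  -- With R^(p-2) ≥ p the bracket in `pot_eq` is at most -1, so `pot p R` ≤ -R² < -B².
  set R := max (p ^ (1 / (p - 2))) (B + 2) with hR
  have h1 : B + 2 ≤ R := le_max_right _ _
  have h2 : p ≤ R ^ (p - 2) := by
    have h3 : (p ^ (1 / (p - 2))) ^ (p - 2) = p := by
      rw [← Real.rpow_mul (by linarith), one_div_mul_cancel hp2.ne', Real.rpow_one]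
    rw [← h3, h3]
    nth_rewrite 1 [← h3]
    exact Real.rpow_le_rpow (by positivity) (le_max_left _ _) hp2.le
  refine ⟨R, by linarith, by linarith, by nlinarith, ?_⟩
  rw [pot_eq hp, abs_of_pos (by linarith)]
  have h4 : 2 / p * p ≤ 2 / p * R ^ (p - 2) := mul_le_mul_of_nonneg_left h2 (by positivity)
  have h5 : 2 / p * p = 2 := by field_simp
  nlinarith

/-- Trajectories of low energy never meet the truncation, as long as they are nonnegative. -/
lemma IsTrajectory.confined (hp : 2 < p) {R T A : ℝ} (hA : Admissible p R A) {y z : ℝ → ℝ}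
    (h : IsTrajectory p R (Ioo (-T) T) y z) (hy0 : y 0 ∈ Icc 0 R) (hz0 : |z 0| ≤ R)
    (he : z 0 ^ 2 - pot p (y 0) ≤ A) {t : ℝ} (ht : t ∈ Ioo (-T) T) :
    |z t| ≤ R ∧ y t ≤ R ∧ (0 ≤ y t → z t ^ 2 - pot p (y t) = z 0 ^ 2 - pot p (y 0)) ∧
      (z 0 ^ 2 - pot p (y 0) < 0 → 0 < y t) := by
  have hR0 : 0 ≤ R := by linarith [hA.one_le]
  have hcons := h.conserved hp hR0 ht
  rw [kinTrunc_of_abs_le hz0, potTrunc_of_mem hp hy0] at hcons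
  have hk := kinTrunc_nonneg hR0 (z t)
  -- A slope beyond R would need kinetic energy at least R², more than A + 1; a height beyond R
  -- would make the conserved energy exceed A; a nonpositive height is impossible at negative
  -- energy, since the truncated potential vanishes there.
  have hz : |z t| ≤ R := by
    by_contra! hlt
    have h1 := sq_le_kinTrunc hR0 hlt.le
    have h2 := potTrunc_le_one hp hA.one_le (y t)
    linarith [hA.lt_sq]
  have hy : y t ≤ R := by
    by_contra! hlt
    have h2 := potTrunc_of_le hp hA.one_le hlt.le
    linarith [hA.pot_lt]
  refine ⟨hz, hy, fun h0 => ?_, fun hneg => ?_⟩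
  · rwa [kinTrunc_of_abs_le hz, potTrunc_of_mem hp ⟨h0, hy⟩] at hcons
  · by_contra! h0
    rw [potTrunc_of_nonpos hp h0] at hcons
    linarith

end

end SingleKnot

namespace SingleKnot

noncomputable section

variable {p : ℝ}

/-! ### Shooting -/

lemma nl_nonneg (hp : 2 < p) {y : ℝ} (h0 : 0 ≤ y) (h1 : y ≤ 1) : 0 ≤ nl p y := by
  rw [nl_eq, abs_of_nonneg h0]
  exact mul_nonneg h0 (by linarith [Real.rpow_le_one h0 h1 (by linarith : 0 ≤ p - 2)])

lemma nlTrunc_nonneg (hp : 2 < p) {R y : ℝ} (hR : 0 ≤ R) (h1 : y ≤ 1) : 0 ≤ nlTrunc p R y := by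
  rw [nlTrunc_eq hp hR]
  exact nl_nonneg hp (clampPos_mem hR y).1 (max_le zero_le_one ((min_le_right _ _).trans h1))

/-- Trajectories that start at rest below the soliton are positive classical solutions. -/
lemma IsTrajectory.solvesOn_of_rest (hp : 2 < p) {R T B m : ℝ} (hA : Admissible p R (B ^ 2))
    {y z : ℝ → ℝ} (h : IsTrajectory p R (Ioo (-T) T) y z) (hm0 : 0 < m) (hm1 : m ≤ 1)
    (hy0 : y 0 = m) (hz0 : z 0 = 0) :
    SolvesOn p (Ioo (-T) T) y z ∧ ∀ t ∈ Ioo (-T) T, 0 < y t ∧ |z t| ≤ R ∧ z t ^ 2 ≤ pot p (y t) := by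
  have hpk := one_lt_peak hp
  have hR := hA.one_le
  have hpot : 0 < pot p m := pot_pos hp hm0.ne' (by rw [abs_of_pos hm0]; linarith)
  have hc := fun t ht => h.confined hp hA (t := t) (by rw [hy0]; exact ⟨hm0.le, by linarith⟩)
    (by rw [hz0, abs_zero]; linarith) (by rw [hy0, hz0]; nlinarith [sq_nonneg B]) ht
  rw [hy0, hz0] at hc
  have hpos : ∀ t ∈ Ioo (-T) T, 0 < y t := fun t ht => (hc t ht).2.2.2 (by linarith)
  refine ⟨fun t ht => ?_, fun t ht => ⟨hpos t ht, (hc t ht).1, ?_⟩⟩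
  · obtain ⟨h1, h2⟩ := h t ht
    rw [clampSym_of_abs_le (hc t ht).1] at h1
    rw [nlTrunc_of_mem hp ⟨(hpos t ht).le, (hc t ht).2.1⟩] at h2
    exact ⟨h1, h2⟩
  · have := (hc t ht).2.2.1 (hpos t ht).le
    linarith

/-- Before reaching height one, a trajectory started at rest is nondecreasing. -/
lemma SolvesOn.monotoneOn_of_le_one (hp : 2 < p) {y z : ℝ → ℝ} {ℓ : ℝ}
    (h : SolvesOn p (Icc 0 ℓ) y z) (hy : ∀ t ∈ Icc 0 ℓ, 0 ≤ y t ∧ y t ≤ 1) (hz0 : z 0 = 0) :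
    (∀ t ∈ Icc 0 ℓ, 0 ≤ z t) ∧ MonotoneOn y (Icc 0 ℓ) := by
  have hz : MonotoneOn z (Icc 0 ℓ) :=
    monotoneOn_of_hasDerivWithinAt_nonneg (convex_Icc _ _) h.continuousOn_deriv
      (fun t ht => (h t (interior_subset ht)).2.hasDerivWithinAt) fun t ht =>
        nl_nonneg hp (hy t (interior_subset ht)).1 (hy t (interior_subset ht)).2
  have hz' : ∀ t ∈ Icc 0 ℓ, 0 ≤ z t := fun t ht => by
    rw [← hz0]; exact hz ⟨le_rfl, ht.1.trans ht.2⟩ ht ht.1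
  exact ⟨hz', monotoneOn_of_hasDerivWithinAt_nonneg (convex_Icc _ _) h.continuousOn
    (fun t ht => (h t (interior_subset ht)).1.hasDerivWithinAt) fun t ht => hz' t (interior_subset ht)⟩

/-- Nondecreasing trajectories with positive start are classical solutions. -/
lemma IsTrajectory.solvesOn_of_nonneg (hp : 2 < p) {R T B c s ℓ : ℝ} (hA : Admissible p R (B ^ 2))
    {y z : ℝ → ℝ} (h : IsTrajectory p R (Ioo (-T) T) y z) (hc0 : 0 < c) (hc1 : c ≤ 1)
    (hB : B ≤ R) (hs : speed p c ≤ s) (hsB : s ≤ B) (hy0 : y 0 = c) (hz0 : z 0 = s)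
    (hℓ : Icc 0 ℓ ⊆ Ioo (-T) T) (hz : ∀ t ∈ Icc 0 ℓ, 0 ≤ z t) :
    SolvesOn p (Icc 0 ℓ) y z ∧ MonotoneOn y (Icc 0 ℓ) ∧
      ∀ t ∈ Icc 0 ℓ, c ≤ y t ∧ y t ≤ R ∧ |z t| ≤ R ∧ z t ^ 2 - pot p (y t) = s ^ 2 - pot p c := by
  have hpk := one_lt_peak hp
  have hR := hA.one_le
  have hs0 : 0 ≤ s := (speed_nonneg c).trans hs
  have hpot : 0 ≤ pot p c := pot_nonneg hp (by rw [abs_of_pos hc0]; linarith)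
  have hc := fun t ht => h.confined hp hA (t := t) (by rw [hy0]; exact ⟨hc0.le, by linarith⟩)
    (by rw [hz0, abs_of_nonneg hs0]; linarith) (by rw [hy0, hz0]; nlinarith) ht
  rw [hy0, hz0] at hc
  have hd : ∀ t ∈ Icc 0 ℓ, HasDerivAt y (z t) t := fun t ht => by
    have := (h t (hℓ ht)).1
    rwa [clampSym_of_abs_le (hc t (hℓ ht)).1] at this
  have hmono : MonotoneOn y (Icc 0 ℓ) :=
    monotoneOn_of_hasDerivWithinAt_nonneg (convex_Icc _ _)
      (fun t ht => (hd t ht).continuousAt.continuousWithinAt)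
      (fun t ht => (hd t (interior_subset ht)).hasDerivWithinAt) fun t ht => hz t (interior_subset ht)
  have hyc : ∀ t ∈ Icc 0 ℓ, c ≤ y t := fun t ht => by
    rw [← hy0]; exact hmono ⟨le_rfl, ht.1.trans ht.2⟩ ht ht.1
  refine ⟨fun t ht => ⟨hd t ht, ?_⟩, hmono, fun t ht => ⟨hyc t ht, (hc t (hℓ ht)).2.1,
    (hc t (hℓ ht)).1, (hc t (hℓ ht)).2.2.1 (hc0.le.trans (hyc t ht))⟩⟩
  have := (h t (hℓ ht)).2
  rwa [nlTrunc_of_mem hp ⟨hc0.le.trans (hyc t ht), (hc t (hℓ ht)).2.1⟩] at this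

/-- Nondecreasing solutions of nonnegative energy only live for a bounded time. -/
lemma exists_time_bound (hp : 2 < p) {c₁ R : ℝ} (hc₁ : 0 < c₁) :
    ∃ C : ℝ, ∀ ℓ, 0 ≤ ℓ → ∀ y z : ℝ → ℝ, SolvesOn p (Icc 0 ℓ) y z →
      (∀ t ∈ Icc 0 ℓ, c₁ ≤ y t ∧ y t ≤ R ∧ |z t| ≤ R ∧ 0 ≤ z t ∧ pot p (y t) ≤ z t ^ 2) → ℓ ≤ C := by
  have hp2 : 0 < p - 2 := by linarith
  have hpk := one_lt_peak hp
  obtain ⟨y₁, hy1, hy2⟩ := exists_between hpk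
  -- A threshold y₁ strictly between the equilibrium 1 and the peak. Below it the nonnegative energy
  -- forces a slope of at least k₁; above it the slope decreases at rate at least k₂.
  have hpot : 0 < pot p y₁ := pot_pos hp (by linarith) (by rw [abs_of_pos (by linarith)]; exact hy2)
  set a := 1 - 2 / p * y₁ ^ (p - 2) with ha
  have ha0 : 0 < a := by
    rw [pot_eq hp, abs_of_pos (by linarith)] at hpot
    exact pos_of_mul_pos_right hpot (sq_nonneg _)
  set k₁ := c₁ * √a with hk₁
  have hk₁0 : 0 < k₁ := mul_pos hc₁ (Real.sqrt_pos.2 ha0)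
  set k₂ := y₁ ^ (p - 2) - 1 with hk₂
  have hk₂0 : 0 < k₂ := by
    have := Real.one_lt_rpow hy1 hp2
    linarith
  set lam := (y₁ + 1) / k₁ with hlam
  have hlam0 : 0 < lam := div_pos (by linarith) hk₁0
  set κ := min 1 k₂ with hκ
  have hκ0 : 0 < κ := lt_min one_pos hk₂0
  refine ⟨(lam + 1) * R / κ, fun ℓ hℓ y z h hb => ?_⟩
  have hpt : ∀ t ∈ Icc 0 ℓ, κ ≤ lam * z t - nl p (y t) := by
    intro t ht
    obtain ⟨h1, h2, h3, h4, h5⟩ := hb t ht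
    have hy0 : 0 < y t := hc₁.trans_le h1
    rw [nl_eq, abs_of_pos hy0]
    rcases le_total (y t) y₁ with hle | hle
    · have e1 : (y t) ^ (p - 2) ≤ y₁ ^ (p - 2) := Real.rpow_le_rpow hy0.le hle hp2.le
      have e2 : k₁ ^ 2 ≤ z t ^ 2 := by
        refine le_trans ?_ h5
        rw [pot_eq hp, abs_of_pos hy0, hk₁, mul_pow, Real.sq_sqrt ha0.le]
        have e3 : 2 / p * y t ^ (p - 2) ≤ 2 / p * y₁ ^ (p - 2) :=
          mul_le_mul_of_nonneg_left e1 (by positivity)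
        have e4 : c₁ ^ 2 ≤ y t ^ 2 := pow_le_pow_left₀ hc₁.le h1 2
        exact mul_le_mul e4 (by linarith) ha0.le (sq_nonneg _)
      have e5 : k₁ ≤ z t := le_of_sq_le_sq e2 h4
      have e6 : y₁ + 1 ≤ lam * z t := by
        calc y₁ + 1 = lam * k₁ := by rw [hlam]; field_simp
          _ ≤ lam * z t := mul_le_mul_of_nonneg_left e5 hlam0.le
      have e7 : 0 ≤ y t * y t ^ (p - 2) := by positivity
      have : κ ≤ 1 := min_le_left _ _
      nlinarith
    · have e1 : y₁ ^ (p - 2) ≤ (y t) ^ (p - 2) := Real.rpow_le_rpow (by linarith) hle hp2.le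
      have e2 : 0 ≤ lam * z t := mul_nonneg hlam0.le h4
      have : κ ≤ k₂ := min_le_right _ _
      nlinarith
  -- The combination lam y - z grows at rate at least κ in both regimes while staying bounded, which
  -- bounds the lifetime.
  have hmono : MonotoneOn (fun t => lam * y t - z t - κ * t) (Icc 0 ℓ) := by
    refine monotoneOn_of_hasDerivWithinAt_nonneg (convex_Icc _ _)
      (f' := fun t => lam * z t - nl p (y t) - κ * 1)
      (((continuousOn_const.mul h.continuousOn).sub h.continuousOn_deriv).sub (by fun_prop))
      (fun t ht => ?_) fun t ht => by linarith [hpt t (interior_subset ht)]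
    have h1 := h t (interior_subset ht)
    exact (((h1.1.const_mul lam).sub h1.2).sub ((hasDerivAt_id t).const_mul κ)).hasDerivWithinAt
  have h0 : (0 : ℝ) ∈ Icc 0 ℓ := ⟨le_rfl, hℓ⟩
  have h1 : ℓ ∈ Icc 0 ℓ := ⟨hℓ, le_rfl⟩
  have hm := hmono h0 h1 hℓ
  simp only at hm
  obtain ⟨a1, a2, a3, a4, a5⟩ := hb 0 h0
  obtain ⟨b1, b2, b3, b4, b5⟩ := hb ℓ h1
  rw [le_div_iff₀ hκ0]
  have a6 := le_abs_self (z 0)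
  have : lam * y ℓ ≤ lam * R := mul_le_mul_of_nonneg_left b2 hlam0.le
  have : 0 ≤ lam * y 0 := mul_nonneg hlam0.le (by linarith)
  nlinarith

/-- A positive solution with nonnegative slope and nonnegative energy can only be at rest at the
right end. -/
lemma SolvesOn.slope_right_eq_zero (hp : 2 < p) {y z : ℝ → ℝ} {ℓ E : ℝ}
    (h : SolvesOn p (Icc 0 ℓ) y z) (hz : ∀ t ∈ Icc 0 ℓ, 0 ≤ z t) (hy : ∀ t ∈ Icc 0 ℓ, 0 < y t)
    (hz0 : 0 < z 0) (hE : ∀ t ∈ Icc 0 ℓ, z t ^ 2 - pot p (y t) = E) (hE0 : 0 ≤ E) {t : ℝ}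
    (ht : t ∈ Icc 0 ℓ) (hzt : z t = 0) : z ℓ = 0 := by
  rcases ht.2.eq_or_lt with hr | hr
  · rwa [← hr]
  rcases ht.1.eq_or_lt with hl | hl
  · rw [← hl] at hzt; linarith
  exfalso
  -- An interior zero of z ≥ 0 is a minimum, so the trajectory would be at the equilibrium y = 1,
  -- whose energy is negative.
  have hmin : IsLocalMin z t := by
    filter_upwards [Icc_mem_nhds hl hr] with t' ht'
    rw [hzt]; exact hz t' ht'
  have hd := hmin.hasDerivAt_eq_zero (h t ht).2
  have hpos := hy t ht
  rw [nl_eq, abs_of_pos hpos] at hd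
  have hone : y t ^ (p - 2) = 1 := by
    rcases mul_eq_zero.1 hd with h | h <;> linarith
  have hone' : y t = 1 := by
    rcases lt_trichotomy (y t) 1 with h | h | h
    · linarith [Real.rpow_lt_one hpos.le h (by linarith : 0 < p - 2)]
    · exact h
    · linarith [Real.one_lt_rpow h (by linarith : 0 < p - 2)]
  have hEt := hE t ht
  have hpk := one_lt_peak hp
  have : 0 < pot p 1 := pot_pos hp one_ne_zero (by simpa using hpk)
  rw [hzt, hone'] at hEt
  linarith

set_option maxHeartbeats 1000000 in
/-- Simultaneous shooting: a trajectory at rest in the middle of the passive edges, and one that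
leaves the vertex with the slope prescribed by the Kirchhoff condition and is nondecreasing up to
the middle of the active edges, where it is at rest. -/
lemma exists_shooting (hp : 2 < p) {N H K c₁ R : ℝ} (hN : 0 ≤ N) (hK : 1 ≤ K) (hKH : K ≤ H)
    (hc₁ : 0 < c₁) (hc₁' : c₁ < 1) (hR : N + H ≤ R) (hA : Admissible p R ((N + H) ^ 2)) :
    ∃ ℓ₀ : ℝ, 0 < ℓ₀ ∧ ∀ ℓ, ℓ₀ ≤ ℓ → ∃ (m : ℝ) (y z Y Z : ℝ → ℝ), 0 < m ∧ m ≤ 1 ∧ y 0 = m ∧ z 0 = 0 ∧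
      IsTrajectory p R (Ioo (-(3 * ℓ)) (3 * ℓ)) y z ∧
      (∀ t ∈ Icc 0 ℓ, y t ≤ c₁) ∧ IsTrajectory p R (Ioo (-(3 * ℓ)) (3 * ℓ)) Y Z ∧
      Y 0 = y ℓ ∧ Z 0 = (N * z ℓ + H * speed p (y ℓ)) / K ∧
      (speed p (y ℓ) ≤ Z 0 ∧ Z 0 ≤ (N + H) * y ℓ ∧ Z 0 ≤ N + H) ∧
      (∀ t ∈ Icc 0 ℓ, 0 ≤ Z t) ∧ Z ℓ = 0 := by
  have hpk := one_lt_peak hp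
  have hR1 := hA.one_le
  have hR0 : 0 ≤ R := by linarith
  have hK0 : 0 < K := by linarith
  obtain ⟨C, hC⟩ := exists_time_bound (R := R) hp hc₁
  refine ⟨max C 0 + 1, by positivity, fun ℓ hℓ => ?_⟩
  have hℓC : C < ℓ := by linarith [le_max_left C 0]
  have hℓ0 : 0 < ℓ := by linarith [le_max_right C 0]
  obtain ⟨F, G, hF, hG, hFG⟩ := exists_truncFlow hp hR0 (T := 3 * ℓ) (by linarith)
  have hsub : Icc 0 ℓ ⊆ Ioo (-(3 * ℓ)) (3 * ℓ) := fun t ht =>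
    ⟨by linarith [ht.1], by linarith [ht.2]⟩
  have hIne : (Icc 0 ℓ).Nonempty := nonempty_Icc.2 hℓ0.le
  set cc : ℝ → ℝ := fun m => F (m, 0) ℓ with hcc
  set dd : ℝ → ℝ := fun m => G (m, 0) ℓ with hdd
  set ss : ℝ → ℝ := fun m => (N * dd m + H * speed p (cc m)) / K with hss
  have hccc : Continuous cc := hF.comp (by fun_prop : Continuous fun m : ℝ => (((m, 0), ℓ) : (ℝ × ℝ) × ℝ))
  have hddc : Continuous dd := hG.comp (by fun_prop : Continuous fun m : ℝ => (((m, 0), ℓ) : (ℝ × ℝ) × ℝ))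
  have hssc : Continuous ss := by
    have := (continuous_speed hp).comp hccc
    exact ((continuous_const.mul hddc).add (continuous_const.mul this)).div_const K
  -- For the parameter m, Q is the maximal height of the passive trajectory, q that of the active
  -- one, and r the least slope of the active one. The desired m is a zero of r; all three are
  -- continuous because the time interval is compact.
  set Q : ℝ → ℝ := fun m => sSup ((fun t => F (m, 0) t) '' Icc 0 ℓ) with hQ
  set q : ℝ → ℝ := fun m => sSup ((fun t => F (cc m, ss m) t) '' Icc 0 ℓ) with hq
  set r : ℝ → ℝ := fun m => sInf ((fun t => G (cc m, ss m) t) '' Icc 0 ℓ) with hr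
  have hQc : Continuous Q := isCompact_Icc.continuous_sSup
    (hF.comp (by fun_prop : Continuous fun x : ℝ × ℝ => (((x.1, 0), x.2) : (ℝ × ℝ) × ℝ)))
  have hqc : Continuous q := isCompact_Icc.continuous_sSup
    (hF.comp (by fun_prop : Continuous fun x : ℝ × ℝ => (((cc x.1, ss x.1), x.2) : (ℝ × ℝ) × ℝ)))
  have hrc : Continuous r := isCompact_Icc.continuous_sInf
    (hG.comp (by fun_prop : Continuous fun x : ℝ × ℝ => (((cc x.1, ss x.1), x.2) : (ℝ × ℝ) × ℝ)))
  have hFt : ∀ x, Continuous (F x) := fun x => hF.comp (by fun_prop : Continuous fun t : ℝ => (x, t))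
  have hGt : ∀ x, Continuous (G x) := fun x => hG.comp (by fun_prop : Continuous fun t : ℝ => (x, t))
  have hleQ : ∀ x, ∀ t ∈ Icc 0 ℓ, F x t ≤ sSup ((fun t => F x t) '' Icc 0 ℓ) := fun x t ht =>
    le_csSup (isCompact_Icc.image (hFt x)).bddAbove (mem_image_of_mem _ ht)
  have hger : ∀ x, ∀ t ∈ Icc 0 ℓ, sInf ((fun t => G x t) '' Icc 0 ℓ) ≤ G x t := fun x t ht =>
    csInf_le (isCompact_Icc.image (hGt x)).bddBelow (mem_image_of_mem _ ht)
  -- the zero solution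
  have hzero : ∀ t ∈ Icc 0 ℓ, F (0, 0) t = 0 ∧ G (0, 0) t = 0 := by
    obtain ⟨h1, h2, h3⟩ := hFG 0 0 (by simpa using hR0) (by simpa using hR0)
    have h0 : IsTrajectory p R (Ioo (-(3 * ℓ)) (3 * ℓ)) (fun _ => 0) (fun _ => 0) := by
      intro t _
      rw [clampSym_of_abs_le (by simpa using hR0), nlTrunc_of_mem hp ⟨le_rfl, hR0⟩, nl_zero]
      exact ⟨hasDerivAt_const _ _, hasDerivAt_const _ _⟩
    intro t ht
    exact h3.unique hp hR0 h0 (t₀ := 0) ⟨by linarith, by linarith⟩ h1 h2 t (hsub ht)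
  have hsp0 : speed p 0 = 0 := by simp [speed, pot_zero hp]
  have hconst : ((fun _ : ℝ => (0 : ℝ)) '' Icc 0 ℓ) = {0} := hIne.image_const 0
  have hℓmem : ℓ ∈ Icc 0 ℓ := ⟨hℓ0.le, le_rfl⟩
  have h0mem : (0 : ℝ) ∈ Icc 0 ℓ := ⟨le_rfl, hℓ0.le⟩
  have hcc0 : cc 0 = 0 := (hzero ℓ hℓmem).1
  have hss0 : ss 0 = 0 := by
    simp only [hss, hcc0, hsp0, (hzero ℓ hℓmem).2, hdd, mul_zero, add_zero, zero_div]
  have hQ0 : Q 0 = 0 := by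
    rw [hQ]; simp only
    rw [image_congr fun t ht => (hzero t ht).1, hconst, csSup_singleton]
  have hq0 : q 0 = 0 := by
    rw [hq]; simp only
    rw [hcc0, hss0, image_congr fun t ht => (hzero t ht).1, hconst, csSup_singleton]
  -- the largest admissible parameter
  have hQ1 : 1 ≤ Q 1 := by
    have := hleQ (1, 0) 0 h0mem
    rwa [(hFG 1 0 (by simpa using hR1) (by simpa using hR0)).1] at this
  have hS : (Icc 0 1 ∩ Q ⁻¹' {c₁}).Nonempty := by
    obtain ⟨m, hm, h⟩ := intermediate_value_Icc zero_le_one hQc.continuousOn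
      (show c₁ ∈ Icc (Q 0) (Q 1) from ⟨by rw [hQ0]; exact hc₁.le, by linarith⟩)
    exact ⟨m, hm, h⟩
  -- The first parameter at which the passive height reaches c₁, so that it stays at most c₁ for
  -- every smaller positive one.
  obtain ⟨m₁, ⟨hm₁, hQm₁⟩, hleast⟩ :=
    (isCompact_Icc.inter_right (isClosed_singleton.preimage hQc)).exists_isLeast hS
  have hQm₁ : Q m₁ = c₁ := hQm₁
  have hm₁0 : 0 < m₁ := by
    rcases hm₁.1.eq_or_lt with h | h
    · rw [← h, hQ0] at hQm₁; linarith
    · exact h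
  have hQle : ∀ m ∈ Ioc 0 m₁, Q m ≤ c₁ := by
    intro m hm
    by_contra! hlt
    obtain ⟨m', hm', h'⟩ := intermediate_value_Icc hm.1.le hQc.continuousOn
      (show c₁ ∈ Icc (Q 0) (Q m) from ⟨by rw [hQ0]; exact hc₁.le, hlt.le⟩)
    have h1 : m₁ ≤ m' := hleast ⟨⟨hm'.1, by linarith [hm'.2, hm.2, hm₁.2]⟩, h'⟩
    have h2 : m = m₁ := le_antisymm hm.2 (h1.trans hm'.2)
    rw [h2, hQm₁] at hlt
    exact lt_irrefl _ hlt
  -- the passive trajectory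
  have hpas : ∀ m ∈ Ioc 0 m₁, F (m, 0) 0 = m ∧ G (m, 0) 0 = 0 ∧
      IsTrajectory p R (Ioo (-(3 * ℓ)) (3 * ℓ)) (F (m, 0)) (G (m, 0)) := fun m hm =>
    hFG m 0 (by rw [abs_of_pos hm.1]; linarith [hm.2, hm₁.2]) (by simpa using hR0)
  have hpas2 : ∀ m ∈ Ioc 0 m₁, (∀ t ∈ Icc 0 ℓ, F (m, 0) t ≤ c₁) ∧ MonotoneOn (F (m, 0)) (Icc 0 ℓ) ∧
      0 < cc m ∧ 0 ≤ dd m ∧ dd m ≤ speed p (cc m) := by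
    intro m hm
    obtain ⟨h1, h2, h3⟩ := hpas m hm
    obtain ⟨h4, h5⟩ := h3.solvesOn_of_rest hp hA hm.1 (hm.2.trans hm₁.2) h1 h2
    have hle : ∀ t ∈ Icc 0 ℓ, F (m, 0) t ≤ c₁ := fun t ht => (hleQ _ t ht).trans (hQle m hm)
    obtain ⟨h6, h7⟩ := (h4.mono hsub).monotoneOn_of_le_one hp
      (fun t ht => ⟨(h5 t (hsub ht)).1.le, (hle t ht).trans hc₁'.le⟩) h2
    exact ⟨hle, h7, (h5 ℓ (hsub hℓmem)).1, h6 ℓ hℓmem,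
      Real.le_sqrt_of_sq_le (h5 ℓ (hsub hℓmem)).2.2⟩
  have hss_bounds : ∀ m ∈ Ioc 0 m₁, cc m ≤ c₁ ∧ 0 < ss m ∧ speed p (cc m) ≤ ss m ∧
      ss m ≤ (N + H) * cc m ∧ ss m ≤ N + H := by
    intro m hm
    obtain ⟨h1, h2, h3, h4, h5⟩ := hpas2 m hm
    have h6 : cc m ≤ c₁ := h1 ℓ hℓmem
    have hsp : 0 < speed p (cc m) :=
      Real.sqrt_pos.2 (pot_pos hp h3.ne' (by rw [abs_of_pos h3]; linarith))
    have hle := speed_le_abs hp (cc m)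
    rw [abs_of_pos h3] at hle
    have hge : speed p (cc m) ≤ ss m := by
      rw [hss]; simp only
      -- K ≤ H enters here: the tails alone already require an active slope of at least `speed p (cc
      -- m)`, that is, nonnegative energy.
      rw [le_div_iff₀ hK0]
      nlinarith [mul_nonneg hN h4, mul_le_mul_of_nonneg_right hKH hsp.le]
    have hup : ss m ≤ (N + H) * cc m := by
      rw [hss]; simp only
      rw [div_le_iff₀ hK0]
      have e1 : N * dd m ≤ N * cc m := mul_le_mul_of_nonneg_left (h5.trans hle) hN
      have e2 : H * speed p (cc m) ≤ H * cc m := mul_le_mul_of_nonneg_left hle (by linarith)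
      have e3 : (N + H) * cc m * 1 ≤ (N + H) * cc m * K :=
        mul_le_mul_of_nonneg_left hK (mul_nonneg (by linarith) h3.le)
      nlinarith
    refine ⟨h6, hsp.trans_le hge, hge, hup, hup.trans ?_⟩
    exact mul_le_of_le_one_right (by linarith) (by linarith)
  have henergy : ∀ m ∈ Ioc 0 m₁, 0 ≤ ss m ^ 2 - pot p (cc m) := by
    intro m hm
    obtain ⟨h1, h2, h3, -, -⟩ := hss_bounds m hm
    have h6 := (hpas2 m hm).2.2.1
    rw [← speed_sq hp (by rw [abs_of_pos h6]; linarith)]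
    exact sub_nonneg.2 (pow_le_pow_left₀ (speed_nonneg _) h3 2)
  have hact : ∀ m ∈ Ioc 0 m₁, F (cc m, ss m) 0 = cc m ∧ G (cc m, ss m) 0 = ss m ∧
      IsTrajectory p R (Ioo (-(3 * ℓ)) (3 * ℓ)) (F (cc m, ss m)) (G (cc m, ss m)) := by
    intro m hm
    obtain ⟨h1, h2, h3, h4, h5⟩ := hss_bounds m hm
    have h6 := (hpas2 m hm).2.2.1
    exact hFG _ _ (by rw [abs_of_pos h6]; linarith) (by rw [abs_of_pos h2]; linarith)
  -- for small parameters the active slope stays positive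
  obtain ⟨m₀, hm₀, hqm₀⟩ : ∃ m₀ ∈ Ioc 0 m₁, q m₀ < 1 := by
    have : ∀ᶠ m in nhds 0, q m < 1 :=
      hqc.continuousAt.eventually (gt_mem_nhds (by rw [hq0]; exact one_pos))
    obtain ⟨ε, hε, h⟩ := Metric.eventually_nhds_iff.1 this
    refine ⟨min (ε / 2) m₁, ⟨lt_min (by linarith) hm₁0, min_le_right _ _⟩, h ?_⟩
    rw [Real.dist_eq, sub_zero, abs_of_pos (lt_min (by linarith) hm₁0)]
    exact (min_le_left _ _).trans_lt (by linarith)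
  have hrm₀ : 0 < r m₀ := by
    obtain ⟨h1, h2, h3⟩ := hact m₀ hm₀
    -- Below height one the nonlinearity is nonnegative, so the slope never drops below its positive
    -- initial value.
    have hmono : MonotoneOn (G (cc m₀, ss m₀)) (Icc 0 ℓ) :=
      monotoneOn_of_hasDerivWithinAt_nonneg (convex_Icc _ _) (hGt _).continuousOn
        (fun t ht => (h3 t (hsub (interior_subset ht))).2.hasDerivWithinAt) fun t ht =>
          nlTrunc_nonneg hp hR0 ((hleQ _ t (interior_subset ht)).trans hqm₀.le)
    refine (hss_bounds m₀ hm₀).2.1.trans_le (le_csInf (hIne.image _) ?_)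
    rintro _ ⟨t, ht, rfl⟩
    exact h2.symm.le.trans (hmono h0mem ht ht.1)
  -- at the largest parameter it does not
  have hm₁mem : m₁ ∈ Ioc 0 m₁ := ⟨hm₁0, le_rfl⟩
  have hrm₁ : r m₁ < 0 := by
    by_contra! hge
    have hZ : ∀ t ∈ Icc 0 ℓ, 0 ≤ G (cc m₁, ss m₁) t := fun t ht => hge.trans (hger _ t ht)
    obtain ⟨a1, a2, a3, a4, a5⟩ := hss_bounds m₁ hm₁mem
    obtain ⟨b1, b2, b3, b4, b5⟩ := hpas2 m₁ hm₁mem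
    obtain ⟨h1, h2, h3⟩ := hact m₁ hm₁mem
    have hcc₁ : cc m₁ = c₁ := by
      refine le_antisymm a1 ?_
      rw [← hQm₁]
      refine csSup_le (hIne.image _) ?_
      rintro _ ⟨t, ht, rfl⟩
      exact b2 ht hℓmem ht.2
    obtain ⟨e1, e2, e3⟩ := h3.solvesOn_of_nonneg hp hA b3 (by linarith) hR a3 a5 h1 h2 hsub hZ
    -- If the slope stayed nonnegative at m₁, where the vertex height is exactly c₁, the trajectory
    -- would outlive the time bound C < ℓ.
    refine absurd (hC ℓ hℓ0.le _ _ e1 fun t ht => ?_) (not_le.2 hℓC)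
    obtain ⟨f1, f2, f3, f4⟩ := e3 t ht
    refine ⟨hcc₁ ▸ f1, f2, f3, hZ t ht, ?_⟩
    linarith [henergy m₁ hm₁mem]
  obtain ⟨m, hm, hrm⟩ := intermediate_value_Icc' hm₀.2 hrc.continuousOn
    (show (0 : ℝ) ∈ Icc (r m₁) (r m₀) from ⟨hrm₁.le, hrm₀.le⟩)
  have hmm : m ∈ Ioc 0 m₁ := ⟨hm₀.1.trans_le hm.1, hm.2⟩
  obtain ⟨a1, a2, a3, a4, a5⟩ := hss_bounds m hmm
  obtain ⟨b1, b2, b3, b4, b5⟩ := hpas2 m hmm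
  obtain ⟨h1, h2, h3⟩ := hact m hmm
  obtain ⟨k1, k2, k3⟩ := hpas m hmm
  have hZ : ∀ t ∈ Icc 0 ℓ, 0 ≤ G (cc m, ss m) t := fun t ht => hrm ▸ hger _ t ht
  obtain ⟨e1, e2, e3⟩ := h3.solvesOn_of_nonneg hp hA b3 (by linarith) hR a3 a5 h1 h2 hsub hZ
  -- The least slope 0 is attained somewhere, and with positive initial slope and nonnegative energy
  -- this forces it to vanish at ℓ.
  have hZℓ : G (cc m, ss m) ℓ = 0 := by
    obtain ⟨t, ht, hGt0⟩ := (isCompact_Icc.image (hGt (cc m, ss m))).sInf_mem (hIne.image _)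
    exact e1.slope_right_eq_zero hp hZ (fun t ht => b3.trans_le (e3 t ht).1) (by rw [h2]; exact a2)
      (fun t ht => (e3 t ht).2.2.2) (henergy m hmm) ht (hGt0.trans hrm)
  exact ⟨m, F (m, 0), G (m, 0), F (cc m, ss m), G (cc m, ss m), hmm.1, hmm.2.trans hm₁.2, k1, k2, k3,
    b1, h3, h1, h2, by rw [h2]; exact ⟨a3, a4, a5⟩, hZ, hZℓ⟩

end

end SingleKnot

namespace SingleKnot

noncomputable section

variable {p : ℝ}

/-! ### Profiles on the compact edges -/

lemma integral_eq_two_mul_of_symm {g : ℝ → ℝ} {ℓ : ℝ} (hℓ : 0 ≤ ℓ)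
    (hg : ContinuousOn g (Icc 0 (2 * ℓ))) (hs : ∀ x ∈ Icc 0 ℓ, g (2 * ℓ - x) = g x) :
    ∫ x in (0 : ℝ)..(2 * ℓ), g x = 2 * ∫ x in (0 : ℝ)..ℓ, g x := by
  have h1 : IntervalIntegrable g volume 0 ℓ :=
    (hg.mono (by rw [uIcc_of_le hℓ]; exact Icc_subset_Icc_right (by linarith))).intervalIntegrable
  have h2 : IntervalIntegrable g volume ℓ (2 * ℓ) :=
    (hg.mono (by rw [uIcc_of_le (by linarith)]; exact Icc_subset_Icc_left hℓ)).intervalIntegrable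
  rw [← intervalIntegral.integral_add_adjacent_intervals h1 h2, two_mul (∫ x in (0 : ℝ)..ℓ, g x)]
  congr 1
  have h3 := intervalIntegral.integral_comp_sub_left (a := 0) (b := ℓ) g (2 * ℓ)
  rw [show 2 * ℓ - ℓ = ℓ by ring, sub_zero] at h3
  rw [← h3]
  refine intervalIntegral.integral_congr fun x hx => ?_
  rw [uIcc_of_le hℓ] at hx
  exact hs x hx

/-- The `L^p` mass of a nondecreasing profile of nonnegative energy is controlled by that of half a
soliton. -/
lemma SolvesOn.integral_rpow_le_vari (hp : 2 < p) {W w : ℝ → ℝ} {ℓ R s : ℝ} (hℓ : 0 ≤ ℓ)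
    (h : SolvesOn p (Icc 0 ℓ) W w) (hw : ∀ t ∈ Icc 0 ℓ, 0 ≤ w t)
    (hW : ∀ t ∈ Icc 0 ℓ, 0 ≤ W t ∧ W t ≤ R) (hs : w 0 = s) (hwℓ : w ℓ = 0)
    (hE0 : pot p (W 0) ≤ s ^ 2) (hpot : 0 ≤ pot p (W 0))
    (hE : ∀ t ∈ Icc 0 ℓ, w t ^ 2 - pot p (W t) = s ^ 2 - pot p (W 0)) :
    (1 / 2 - 1 / p) * ∫ t in (0 : ℝ)..ℓ, |W t| ^ p ≤ vari p (peak p) + s * R := by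
  have h0 : (0 : ℝ) ∈ Icc 0 ℓ := ⟨le_rfl, hℓ⟩
  have h1 : ℓ ∈ Icc 0 ℓ := ⟨hℓ, le_rfl⟩
  have hs0 : 0 ≤ s := hs ▸ hw 0 h0
  have hu : uIcc 0 ℓ = Icc 0 ℓ := uIcc_of_le hℓ
  -- The derivative of s W + `vari p W` - W w / 2. Energy conservation gives both w ≤ s + `speed p
  -- W` and w² ≥ `pot p W`, and together they make D at least (1/2 - 1/p)|W|^p.
  set D : ℝ → ℝ := fun t =>
    s * w t + speed p (W t) * w t - (w t * w t + W t * nl p (W t)) / 2 with hD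
  have hd : ∀ t ∈ uIcc 0 ℓ,
      HasDerivAt (fun t => s * W t + vari p (W t) - W t * w t / 2) (D t) t := by
    intro t ht
    rw [hu] at ht
    exact (((h t ht).1.const_mul s).add ((hasDerivAt_vari hp (W t)).comp t (h t ht).1)).sub
      (((h t ht).1.mul (h t ht).2).div_const 2)
  have hcW := h.continuousOn
  have hcw := h.continuousOn_deriv
  have hcD : ContinuousOn D (uIcc 0 ℓ) := by
    rw [hu]
    exact ((continuousOn_const.mul hcw).add (((continuous_speed hp).comp_continuousOn hcW).mul hcw)).sub
      (((hcw.mul hcw).add (hcW.mul ((continuous_nl hp).comp_continuousOn hcW))).div_const 2)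
  have hftc := intervalIntegral.integral_eq_sub_of_hasDerivAt hd hcD.intervalIntegrable
  have hle : (1 / 2 - 1 / p) * ∫ t in (0 : ℝ)..ℓ, |W t| ^ p ≤ ∫ t in (0 : ℝ)..ℓ, D t := by
    rw [← intervalIntegral.integral_const_mul]
    refine intervalIntegral.integral_mono_on hℓ ?_ hcD.intervalIntegrable fun t ht => ?_
    · refine ContinuousOn.intervalIntegrable ?_
      rw [hu]
      exact continuousOn_const.mul ((continuous_abs_rpow hp).comp_continuousOn hcW)
    · have e1 := hE t ht
      have e2 := nl_mul_self hp (W t)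
      have e3 : w t ≤ s + speed p (W t) := by
        rcases le_total 0 (pot p (W t)) with hq | hq
        · have e4 : speed p (W t) ^ 2 = pot p (W t) := Real.sq_sqrt hq
          refine le_of_sq_le_sq ?_ (add_nonneg hs0 (speed_nonneg _))
          nlinarith [mul_nonneg hs0 (speed_nonneg (p := p) (W t))]
        · have : w t ≤ s := le_of_sq_le_sq (by linarith) hs0
          linarith [speed_nonneg (p := p) (W t)]
      have e5 := mul_le_mul_of_nonneg_right e3 (hw t ht)
      simp only [hD]
      rw [pot] at e1
      have e6 : 2 / p * |W t| ^ p = 2 * (1 / p * |W t| ^ p) := by ring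
      have e7 : W t * nl p (W t) = W t ^ 2 - |W t| ^ p := by linarith
      have e8 : |W t| ^ 2 = W t ^ 2 := sq_abs _
      rw [e7]
      nlinarith
  refine hle.trans ?_
  rw [hftc, hwℓ, hs]
  have f1 : vari p (W ℓ) ≤ vari p (peak p) := vari_le_peak hp _
  have f2 : 0 ≤ vari p (W 0) := vari_nonneg hp (hW 0 h0).1
  have f3 : s * W ℓ ≤ s * R := mul_le_mul_of_nonneg_left (hW ℓ h1).2 hs0
  have f4 : 0 ≤ s * W 0 := mul_nonneg hs0 (hW 0 h0).1
  linarith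

lemma SolvesOn.comp_sub {s : Set ℝ} {f w : ℝ → ℝ} (h : SolvesOn p s f w) (a : ℝ) {t : Set ℝ}
    (hts : ∀ x ∈ t, x - a ∈ s) : SolvesOn p t (fun x => f (x - a)) fun x => w (x - a) := fun x hx =>
  ⟨(h _ (hts x hx)).1.comp_sub_const x a, (h _ (hts x hx)).2.comp_sub_const x a⟩

/-- Solutions at rest in the middle of `[0, 2ℓ]`, extended symmetrically, stay classical. -/
lemma IsTrajectory.solvesOn_of_reflect (hp : 2 < p) {R ℓ : ℝ} (hR : 0 ≤ R) (hℓ : 0 < ℓ)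
    {Y Z : ℝ → ℝ} (h : IsTrajectory p R (Ioo (-(3 * ℓ)) (3 * ℓ)) Y Z)
    (hb : ∀ t ∈ Icc 0 ℓ, 0 ≤ Y t ∧ Y t ≤ R ∧ |Z t| ≤ R) (hZ : Z ℓ = 0) :
    SolvesOn p (Icc 0 (2 * ℓ)) Y Z ∧
      ∀ t ∈ Icc 0 (2 * ℓ), Y (2 * ℓ - t) = Y t ∧ Z (2 * ℓ - t) = -Z t := by
  have hsym : ∀ t ∈ Icc 0 (2 * ℓ), Y (2 * ℓ - t) = Y t ∧ Z (2 * ℓ - t) = -Z t := fun t ht =>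
    IsTrajectory.reflect hp hR (t₀ := ℓ) (d := 2 * ℓ) (by linarith)
      (fun t ht => h t ⟨by linarith [ht.1], by linarith [ht.2]⟩) hZ t
      ⟨by linarith [ht.1], by linarith [ht.2]⟩
  refine ⟨fun t ht => ?_, hsym⟩
  have hbt : 0 ≤ Y t ∧ Y t ≤ R ∧ |Z t| ≤ R := by
    rcases le_total t ℓ with hle | hle
    · exact hb t ⟨ht.1, hle⟩
    · have := hb (2 * ℓ - t) ⟨by linarith [ht.2], by linarith⟩
      rwa [(hsym t ht).1, (hsym t ht).2, abs_neg] at this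
  have := h t ⟨by linarith [ht.1], by linarith [ht.2]⟩
  rwa [clampSym_of_abs_le hbt.2.2, nlTrunc_of_mem hp ⟨hbt.1, hbt.2.1⟩] at this

/-- A symmetric solution on `[0, 2ℓ]` with boundary value `c` and slope `s` at the origin. -/
structure IsProfile (p ℓ c s : ℝ) (V v : ℝ → ℝ) : Prop where
  solvesOn : SolvesOn p (Icc 0 (2 * ℓ)) V v
  left : V 0 = c
  right : V (2 * ℓ) = c
  slope_left : v 0 = s
  slope_right : v (2 * ℓ) = -s
  slope_mid : v ℓ = 0
  integral : ∫ t in (0 : ℝ)..(2 * ℓ), |V t| ^ p = 2 * ∫ t in (0 : ℝ)..ℓ, |V t| ^ p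

lemma isProfile_of_symm (hp : 2 < p) {ℓ c s : ℝ} (hℓ : 0 < ℓ) {V v : ℝ → ℝ}
    (h : SolvesOn p (Icc 0 (2 * ℓ)) V v)
    (hsym : ∀ t ∈ Icc 0 (2 * ℓ), V (2 * ℓ - t) = V t ∧ v (2 * ℓ - t) = -v t) (hV : V 0 = c)
    (hv : v 0 = s) : IsProfile p ℓ c s V v where
  solvesOn := h
  left := hV
  right := by
    have := (hsym 0 ⟨le_rfl, by linarith⟩).1
    rwa [sub_zero, hV] at this
  slope_left := hv
  slope_right := by
    have := (hsym 0 ⟨le_rfl, by linarith⟩).2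
    rwa [sub_zero, hv] at this
  slope_mid := by
    have := (hsym ℓ ⟨hℓ.le, by linarith⟩).2
    rw [show 2 * ℓ - ℓ = ℓ by ring] at this
    linarith
  integral := integral_eq_two_mul_of_symm hℓ.le
    ((continuous_abs_rpow hp).comp_continuousOn h.continuousOn) fun x hx => by
      simp only [(hsym x ⟨hx.1, by linarith [hx.2]⟩).1]

/-- Both quantities are continuous in c and vanish at c = 0. The first bounds the mass of tails and
passive profiles, the second the excess of an active profile over J. -/
lemma exists_small_height (hp : 2 < p) {δ B : ℝ} (hδ : 0 < δ) :
    ∃ c₁ : ℝ, 0 < c₁ ∧ c₁ < 1 ∧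
      ∀ c, 0 < c → c ≤ c₁ → c ^ (p - 1) * c / (1 - c ^ (p - 2)) ≤ δ ∧ B * c ≤ δ := by
  have hc : ContinuousAt (fun c : ℝ => c ^ (p - 1) * c / (1 - c ^ (p - 2))) 0 := by
    refine ContinuousAt.div ?_ ?_ ?_
    · exact (Real.continuousAt_rpow_const _ _ (Or.inr (by linarith))).mul continuousAt_id
    · exact continuousAt_const.sub (Real.continuousAt_rpow_const _ _ (Or.inr (by linarith)))
    · rw [Real.zero_rpow (by linarith)]; norm_num
  have h1 : ∀ᶠ c : ℝ in nhds 0, c ^ (p - 1) * c / (1 - c ^ (p - 2)) < δ :=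
    hc.eventually (gt_mem_nhds (by simpa using hδ))
  have h2 : ∀ᶠ c : ℝ in nhds 0, B * c < δ :=
    (continuous_const.mul continuous_id).continuousAt.eventually (gt_mem_nhds (by simpa using hδ))
  obtain ⟨ε, hε, h⟩ := Metric.eventually_nhds_iff.1 (h1.and h2)
  refine ⟨min (ε / 2) (1 / 2), by positivity, (min_le_right _ _).trans_lt (by norm_num),
    fun c hc0 hc1 => ?_⟩
  have := h (y := c) (by
    rw [Real.dist_eq, sub_zero, abs_of_pos hc0]
    linarith [hc1.trans (min_le_left _ _)])
  exact ⟨this.1.le, this.2.le⟩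

/-- Profiles for the passive and the active edges that match a half-soliton tail at the vertex. -/
lemma exists_profiles (hp : 2 < p) {N H K δ : ℝ} (hN : 0 ≤ N) (hK : 1 ≤ K) (hKH : K ≤ H)
    (hδ : 0 < δ) :
    ∃ ℓ₀ : ℝ, 0 < ℓ₀ ∧ ∀ ℓ, ℓ₀ ≤ ℓ → ∃ (c d s : ℝ) (V v W w : ℝ → ℝ), 0 < c ∧ c < 1 ∧
      IsProfile p ℓ c (-d) V v ∧ IsProfile p ℓ c s W w ∧ K * s = N * d + H * speed p c ∧
      c ^ (p - 1) * c / (1 - c ^ (p - 2)) ≤ δ ∧ ∫ t in (0 : ℝ)..ℓ, |V t| ^ p ≤ δ ∧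
      (1 / 2 - 1 / p) * ∫ t in (0 : ℝ)..ℓ, |W t| ^ p ≤ vari p (peak p) + δ := by
  have hpk := one_lt_peak hp
  obtain ⟨R, hRB, hA⟩ := exists_admissible hp (N + H) (by linarith)
  have hR1 := hA.one_le
  obtain ⟨c₁, hc₁, hc₁', hsmall⟩ :=
    exists_small_height hp hδ (B := (N + H) * R)
  obtain ⟨ℓ₀, hℓ₀, hsh⟩ := exists_shooting hp hN hK hKH hc₁ hc₁' hRB hA
  refine ⟨ℓ₀, hℓ₀, fun ℓ hℓ => ?_⟩
  have hℓ0 : 0 < ℓ := hℓ₀.trans_le hℓ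
  obtain ⟨m, y, z, Y, Z, hm, hm1, hy0, hz0, hyz, hyc, hYZ, hY0, hZ0, ⟨hs1, hs2, hs3⟩, hZ, hZℓ⟩ :=
    hsh ℓ hℓ
  have hsub : Icc 0 ℓ ⊆ Ioo (-(3 * ℓ)) (3 * ℓ) := fun t ht =>
    ⟨by linarith [ht.1], by linarith [ht.2]⟩
  have hℓmem : ℓ ∈ Icc 0 ℓ := ⟨hℓ0.le, le_rfl⟩
  obtain ⟨p1, p2⟩ := hyz.solvesOn_of_rest hp hA hm hm1 hy0 hz0
  obtain ⟨p3, p4⟩ := (p1.mono hsub).monotoneOn_of_le_one hp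
    (fun t ht => ⟨(p2 t (hsub ht)).1.le, (hyc t ht).trans hc₁'.le⟩) hz0
  obtain ⟨c, hc⟩ : ∃ c, c = y ℓ := ⟨_, rfl⟩
  have hc0 : 0 < c := hc ▸ (p2 ℓ (hsub hℓmem)).1
  have hcc₁ : c ≤ c₁ := hc ▸ hyc ℓ hℓmem
  rw [← hc] at hY0 hZ0 hs1 hs2
  -- The passive trajectory is at rest at time 0 and hence even; shifting it by ℓ puts its rest
  -- point at the end of a pendant or the middle of a loop.
  have hsym : ∀ t ∈ Ioo (-(3 * ℓ)) (3 * ℓ), y (-t) = y t ∧ z (-t) = -z t := fun t ht => by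
    have := IsTrajectory.reflect hp (R := R) (by linarith) (t₀ := 0) (d := 3 * ℓ) (by linarith)
      (by simpa using hyz) hz0 t (by simpa using ht)
    simpa using this
  have hV : IsProfile p ℓ c (-z ℓ) (fun x => y (x - ℓ)) fun x => z (x - ℓ) := by
    refine isProfile_of_symm hp hℓ0 (p1.comp_sub ℓ fun x hx =>
      ⟨by linarith [hx.1], by linarith [hx.2]⟩) (fun t ht => ?_) ?_ ?_
    · have := hsym (t - ℓ) ⟨by linarith [ht.1], by linarith [ht.2]⟩
      rwa [show -(t - ℓ) = 2 * ℓ - t - ℓ by ring] at this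
    · simp only [zero_sub]
      rw [(hsym ℓ (hsub hℓmem)).1, hc]
    · simp only [zero_sub]
      exact (hsym ℓ (hsub hℓmem)).2
  obtain ⟨q1, -, q3⟩ := hYZ.solvesOn_of_nonneg hp hA hc0 (by linarith) hRB hs1 hs3 hY0 rfl hsub hZ
  have hYb : ∀ t ∈ Icc 0 ℓ, 0 ≤ Y t ∧ Y t ≤ R ∧ |Z t| ≤ R := fun t ht =>
    ⟨hc0.le.trans (q3 t ht).1, (q3 t ht).2.1, (q3 t ht).2.2.1⟩
  obtain ⟨r1, r2⟩ := hYZ.solvesOn_of_reflect hp (by linarith) hℓ0 hYb hZℓ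
  obtain ⟨t1, t2⟩ := hsmall c hc0 hcc₁
  have hpotc : speed p c ^ 2 = pot p c := speed_sq hp (by rw [abs_of_pos hc0]; linarith)
  refine ⟨c, z ℓ, Z 0, _, _, Y, Z, hc0, by linarith, hV, isProfile_of_symm hp hℓ0 r1 r2 hY0 rfl,
    ?_, t1, ?_, ?_⟩
  · rw [hZ0]; field_simp
  · refine le_trans ?_ t1
    have hVi := (hV.solvesOn.mono (Icc_subset_Icc_right (by linarith))).integral_rpow_le hp hℓ0.le
      hc0.le (by linarith) fun x hx => ?_
    · refine hVi.trans ?_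
      have hlt : c ^ (p - 2) < 1 := Real.rpow_lt_one hc0.le (by linarith) (by linarith)
      refine div_le_div_of_nonneg_right ?_ (by linarith)
      refine mul_le_mul_of_nonneg_left ?_ (by positivity)
      rw [hV.slope_mid, hV.slope_left, zero_sub, neg_neg]
      have h1 : z ℓ ≤ speed p c := hc ▸ Real.le_sqrt_of_sq_le (p2 ℓ (hsub hℓmem)).2.2
      have h2 := speed_le_abs hp c
      rw [abs_of_pos hc0] at h2
      exact h1.trans h2
    · have h1 : ℓ - x ∈ Icc 0 ℓ := ⟨by linarith [hx.2], by linarith [hx.1]⟩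
      have h2 := (hsym (ℓ - x) (hsub h1)).1
      rw [neg_sub] at h2
      simp only [h2]
      exact ⟨(p2 _ (hsub h1)).1.le, hc ▸ p4 h1 hℓmem h1.2⟩
  · have h1 := q1.integral_rpow_le_vari hp hℓ0.le hZ (fun t ht => ⟨(hYb t ht).1, (hYb t ht).2.1⟩)
      rfl hZℓ (by rw [hY0, ← hpotc]; exact pow_le_pow_left₀ (speed_nonneg _) hs1 2)
      (by rw [hY0, ← hpotc]; positivity) (fun t ht => by rw [hY0]; exact (q3 t ht).2.2.2)
    refine h1.trans ?_
    have : Z 0 * R ≤ (N + H) * c * R := mul_le_mul_of_nonneg_right hs2 (by linarith)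
    linarith

end

end SingleKnot

namespace SingleKnot

noncomputable section

variable {p : ℝ} {H P L : ℕ}

/-! ### Bound states concentrated on few edges -/

lemma sum_ite_lt {n a : ℕ} (h : a ≤ n) (x y : ℝ) :
    ∑ i : Fin n, (if i.val < a then x else y) = a * x + (n - a) * y := by
  obtain ⟨k, rfl⟩ := Nat.exists_eq_add_of_le h
  rw [Fin.sum_univ_eq_sum_range (fun i => if i < a then x else y), Finset.sum_range_add,
    Finset.sum_congr rfl fun i hi => if_pos (Finset.mem_range.1 hi),
    Finset.sum_congr rfl fun i _ => if_neg (Nat.not_lt.2 (Nat.le_add_right a i))]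
  simp

/-- The function equal to `Y` on the half-lines, to `W` on the first `a` pendants and the first `b`
loops, and to `V` on the other pendants and loops. -/
def glue (a b : ℕ) (Y W V : ℝ → ℝ) : GraphFun H P L
  | .inl _ => Y
  | .inr (.inl i) => if i.val < a then W else V
  | .inr (.inr j) => if j.val < b then W else V

/-- For long edges there are bound states that are close to half a soliton on `K` edges of length
`ℓ`, counting every loop twice, and small elsewhere. -/
theorem exists_boundState_action_le (hp : 2 < p) {a b K : ℕ} (ha : a ≤ P) (hb : b ≤ L)
    (hab : K = a + 2 * b) (hK : 1 ≤ K) (hKH : K ≤ H) {δ : ℝ} (hδ : 0 < δ) :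
    ∃ ℓ₀ : ℝ, 0 < ℓ₀ ∧ ∀ ℓ, ℓ₀ ≤ ℓ → ∃ u : GraphFun H P L, IsBoundState p ℓ u ∧
      action p ℓ u ≤ K * vari p (peak p) + (H + P + 2 * L) * δ := by
  have hKR : (K : ℝ) = a + 2 * b := by rw [hab]; push_cast; ring
  have haR : (a : ℝ) ≤ P := by exact_mod_cast ha
  have hbR : (b : ℝ) ≤ L := by exact_mod_cast hb
  -- Of the P + 2L compact edges, K are active and the rest passive.
  obtain ⟨ℓ₀, hℓ₀, h⟩ := exists_profiles hp (N := P + 2 * L - K) (H := H) (K := K)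
    (by linarith) (by exact_mod_cast hK) (by exact_mod_cast hKH) hδ
  refine ⟨ℓ₀, hℓ₀, fun ℓ hℓ => ?_⟩
  have hℓ0 : 0 < ℓ := hℓ₀.trans_le hℓ
  obtain ⟨c, d, s, V, v, W, w, hc0, hc1, hV, hW, hkir, hc, hVi, hWi⟩ := h ℓ hℓ
  obtain ⟨Y, y, hY, hY0, hy0, hYc, hYL, hyL, hYi⟩ := exists_half_line hp hc0 hc1
  have hpen : ∀ {f g : ℝ → ℝ} {s : ℝ}, IsProfile p ℓ c s f g → SolvesOn p (Icc 0 ℓ) f g :=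
    fun h => h.solvesOn.mono (Icc_subset_Icc_right (by linarith))
  have hu : IsBoundState p ℓ (glue a b Y W V : GraphFun H P L) := by
    refine isBoundState_of_solvesOn hp hℓ0 (w := glue a b y w v) (R := c) hc0.ne' ?_ ?_ ?_ ?_
      (fun _ => hYc) (fun _ => hYL) (fun _ => hyL) ?_ ?_
    · exact ⟨.inl ⟨0, hK.trans hKH⟩⟩
    · rintro (i | i | j)
      · exact hY
      · simp only [glue, dom]
        split_ifs
        exacts [hpen hW, hpen hV]
      · simp only [glue, dom]
        split_ifs
        exacts [hW.solvesOn, hV.solvesOn]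
    · rintro (i | i | j) <;> simp only [glue] <;> try split_ifs
      exacts [hY0, hW.left, hV.left, hW.left, hV.left]
    · intro j
      simp only [glue]
      split_ifs
      exacts [hW.right, hV.right]
    · intro i
      simp only [glue]
      split_ifs
      exacts [hW.slope_mid, hV.slope_mid]
    · have h1 : ∀ i : Fin P, (if i.val < a then w else v) 0 = if i.val < a then s else -d :=
        fun i => by split_ifs; exacts [hW.slope_left, hV.slope_left]
      have h2 : ∀ j : Fin L, (if j.val < b then w else v) 0 - (if j.val < b then w else v) (2 * ℓ) =
          if j.val < b then 2 * s else -(2 * d) := fun j => by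
        split_ifs
        · rw [hW.slope_left, hW.slope_right]; ring
        · rw [hV.slope_left, hV.slope_right]; ring
      simp only [glue, h1, h2, sum_ite_lt ha, sum_ite_lt hb, hy0, Finset.sum_const,
        Finset.card_univ, Fintype.card_fin, nsmul_eq_mul]
      rw [hKR] at hkir
      linarith
  refine ⟨_, hu, ?_⟩
  rw [hu.action_eq hp hℓ0]
  set q := 1 / 2 - 1 / p with hq
  have hq0 : 0 ≤ q := sub_nonneg.2 (one_div_le_one_div_of_le two_pos hp.le)
  have hq1 : q ≤ 1 := by
    have : 0 < 1 / p := by positivity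
    linarith
  have hmul : ∀ {x : ℝ}, x ≤ δ → q * x ≤ δ := fun hx =>
    (mul_le_mul_of_nonneg_left hx hq0).trans (mul_le_of_le_one_left hδ.le hq1)
  have hset : ∀ {t : ℝ} (f : ℝ → ℝ), 0 ≤ t → ∫ x in Icc 0 t, |f x| ^ p =
      ∫ x in (0 : ℝ)..t, |f x| ^ p := fun f ht => by
    rw [intervalIntegral.integral_of_le ht, integral_Icc_eq_integral_Ioc]
  rw [Finset.mul_sum, Fintype.sum_sum_type, Fintype.sum_sum_type]
  have b1 : ∑ i : Fin H, q * ∫ x in dom ℓ (.inl i : Edge H P L),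
      |(glue a b Y W V : GraphFun H P L) (.inl i) x| ^ p ≤ ∑ _i : Fin H, δ :=
    Finset.sum_le_sum fun i _ => hmul (hYi.trans hc)
  have b2 : ∑ i : Fin P, q * ∫ x in dom ℓ (.inr (.inl i) : Edge H P L),
      |(glue a b Y W V : GraphFun H P L) (.inr (.inl i)) x| ^ p ≤
        ∑ i : Fin P, if i.val < a then vari p (peak p) + δ else δ := by
    refine Finset.sum_le_sum fun i _ => ?_
    simp only [glue, dom, hset _ hℓ0.le]
    split_ifs
    exacts [hWi, hmul hVi]
  have b3 : ∑ j : Fin L, q * ∫ x in dom ℓ (.inr (.inr j) : Edge H P L),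
      |(glue a b Y W V : GraphFun H P L) (.inr (.inr j)) x| ^ p ≤
        ∑ j : Fin L, if j.val < b then 2 * (vari p (peak p) + δ) else 2 * δ := by
    refine Finset.sum_le_sum fun j _ => ?_
    simp only [glue, dom, hset _ (by linarith : 0 ≤ 2 * ℓ)]
    split_ifs
    · rw [hW.integral]; linarith
    · rw [hV.integral]; linarith [hmul hVi]
  rw [sum_ite_lt ha] at b2
  rw [sum_ite_lt hb] at b3
  simp only [Finset.sum_const, Finset.card_univ, Fintype.card_fin, nsmul_eq_mul] at b1
  rw [hKR]
  linarith

/-! ### Comparison of the two action levels -/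

/-- Nonnegativity of the action supplies the lower bound without which the real infimum would be a
default value. -/
theorem leastAction_le (hp : 2 < p) {ℓ : ℝ} (hℓ : 0 < ℓ) {u : GraphFun H P L}
    (hu : IsBoundState p ℓ u) : leastAction H P L p ℓ ≤ action p ℓ u :=
  csInf_le ⟨0, by rintro _ ⟨v, hv, rfl⟩; exact hv.action_nonneg hp hℓ⟩ ⟨u, hu, rfl⟩

theorem exists_length_not_coreSymmetric (hp : 2 < p) {a b K : ℕ} (ha : a ≤ P) (hb : b ≤ L)
    (hab : K = a + 2 * b) (hKH : K ≤ H) (hK : K = 1 ∨ (K = 2 ∧ 2 ≤ H)) (hN : 2 * K ≤ P + 2 * L) :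
    ∃ ℓ₀ : ℝ, 0 < ℓ₀ ∧ ∀ ℓ : ℝ, ℓ₀ ≤ ℓ → ∀ u : GraphFun H P L,
      IsActionGroundState p ℓ u → ¬ IsCoreSymmetric ℓ u := by
  have hv := vari_one_pos hp
  have hden : (0 : ℝ) < H + P + 2 * L + 1 := by positivity
  -- The extra 1 in the denominator makes the total error of the comparison state strictly less than
  -- the gap `vari p 1 / 2`.
  set δ := vari p 1 / 2 / (H + P + 2 * L + 1 : ℝ) with hδ
  have hδ0 : 0 < δ := by positivity
  have hδ1 : (H + P + 2 * L + 1) * δ = vari p 1 / 2 := mul_div_cancel₀ _ hden.ne'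
  obtain ⟨ℓ₁, hℓ₁, h1⟩ := exists_action_lower_bound hp H P L K hN hK
  obtain ⟨ℓ₂, -, h2⟩ := exists_boundState_action_le (H := H) hp ha hb hab (by omega) hKH hδ0
  refine ⟨max ℓ₁ ℓ₂, lt_max_of_lt_left hℓ₁, fun ℓ hℓ u hu hsym => ?_⟩
  have hℓ1 : ℓ₁ ≤ ℓ := (le_max_left _ _).trans hℓ
  obtain ⟨v, hvb, hva⟩ := h2 ℓ ((le_max_right _ _).trans hℓ)
  have e1 := h1 ℓ hℓ1 u hu.1 hsym
  have e2 := leastAction_le hp (hℓ₁.trans_le hℓ1) hvb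
  have e3 := hu.2
  linarith

end

end SingleKnot

theorem mainTheorem6 (p : ℝ) (hp : 2 < p) (H P L : ℕ) (hH : 1 ≤ H) (hPL : 1 < P + L)
    (hP : P = 0 → 2 ≤ H) :
    ∃ ℓ₀ : ℝ, 0 < ℓ₀ ∧ ∀ ℓ : ℝ, ℓ₀ ≤ ℓ → ∀ u : SingleKnot.GraphFun H P L,
      SingleKnot.IsActionGroundState p ℓ u → ¬ SingleKnot.IsCoreSymmetric ℓ u := by
  -- Without pendants the comparison state concentrates on one loop, so K = 2, which needs H ≥ 2,
  -- and L ≥ 2 gives 2K ≤ 2L. Otherwise one pendant suffices, with K = 1.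
  rcases Nat.eq_zero_or_pos P with h | h
  · exact SingleKnot.exists_length_not_coreSymmetric hp (a := 0) (b := 1) (K := 2) (by omega)
      (by omega) (by omega) (hP h) (Or.inr ⟨rfl, hP h⟩) (by omega)
  · exact SingleKnot.exists_length_not_coreSymmetric hp (a := 1) (b := 0) (K := 1) (by omega)
      (by omega) (by omega) hH (Or.inl rfl) (by omega)
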